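/- Let $B_4=\langle \sigma_1,\sigma_2,\sigma_3 \mid \sigma_1\sigma_2\sigma_1=\sigma_2\sigma_1\sigma_2,\ \sigma_2\sigma_3\sigma_2=\sigma_3\sigma_2\sigma_3,\ \sigma_1\sigma_3=\sigma_3\sigma_1\rangle$ be the four-strand braid group with its dual (Birman–Ko–Lee) Garside structure $BKL_4$. That is, put $$a_{1,2}=\sigma_1,\quad a_{2,3}=\sigma_2,\quad a_{3,4}=\sigma_3,\quad a_{1,3}=\sigma_2^{-1}\sigma_1\sigma_2,\quad a_{2,4}=\sigma_3^{-1}\sigma_2\sigma_3,\quad a_{1,4}=\sigma_3^{-1}\sigma_2^{-1}\sigma_1\sigma_2\sigma_3,$$ let $BKL_4^+$ be the submonoid generated by the $a_{p,q}$, write $x\preccurlyeq y$ if $x^{-1}y\in BKL_4^+$ (a lattice order; $\wedge$ denotes the greatest common divisor), and let $\delta=\sigma_1\sigma_2\sigma_3$ be the Garside element. Write $x^z=z^{-1}xz$ and $\tau(x)=\delta^{-1}x\delta$. An element $s$ is simple if $1\preccurlyeq s\preccurlyeq\delta$, and then $\partial(s)=s^{-1}\delta$; a pair $s_1s_2$ of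 simple elements is left-weighted if $\partial(s_1)\wedge s_2=1$. Every $x\in B_4$ has a unique normal form $x=\delta^p x_1\cdots x_r$, where $r\ge 0$, $p$ is the greatest integer with $\delta^p\preccurlyeq x$, the $x_i$ are simple, $x_r\neq 1$ if $r\geq 1$, and $x_ix_{i+1}$ is left-weighted for $1\le i<r$; put $\ell(x)=r$. If $r\ge1$, put $\iota(x)=\tau^{-p}(x_1)$ and $\varphi(x)=x_r$. The element $x$ is rigid if $r\ge 1$ and the pair $\varphi(x)\iota(x)$ is left-weighted. If $\ell(x)\ge 1$, the cycling of $x$ is $\mathbf c(x)=x^{\iota(x)}$ and its cyclic sliding is $\mathfrak s(x)=x^{\iota(x)\wedge\partial(\varphi(x))}$; if $\ell(x)=0$, put $\mathbf c(x)=\mathfrak s(x)=x$. The set of sliding circuits $SC(x)$ is the set of all conjugates $y$ of $x$ with $\mathfrak s^k(y)=y$ for some $k\ge 1$. For $x$ rigid and $y\in SC(x)$, let $O_y=\{\tau^k\mathbf c^l(y): k,l\in\mathbb N\}$. A minimal arrow for $y$ is a simple element $s\ne1$ with $y^s\in SC(x)$ such that the only $t$ with $1\preccurlyeq t\preccurlyeq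 s$ and $y^t\in SC(x)$ are $t=1$ and $t=s$; it is useful if $y^s\notin O_y$. The quotient graph $\widetilde{SCG}(x)$ is the oriented graph whose vertices are the distinct sets $O_y$, $y\in SC(x)$, and whose arrows starting at a vertex $O$ correspond to the minimal useful arrows $s$ for a chosen representative $y'\in O$, the arrow $s$ leading from $O=O_{y'}$ to $O_{z'}$ with $z'=y'^s$. **Proposition.** Let $x\in BKL_4$ be rigid, and suppose that $SC(x)$ contains an element $y$ whose normal form $y=\delta^p y_1\cdots y_r$ has all its factors $y_1,\dots,y_r$ in $\mathcal E=\{a_{2,3},a_{3,4},a_{1,4},a_{1,2}\}$. Then the graph $\widetilde{SCG}(x)$ has at most six vertices. Moreover, $\#SC(x)\le 24\cdot\ell(x)$. -/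

import Mathlib

namespace BKL4

/-- Relators of the Artin presentation of the four-strand braid group; the generator with index
`i : Fin 3` is the Artin generator `σ_{i+1}`. -/
def braidRelators : Set (FreeGroup (Fin 3)) :=
  let s : Fin 3 → FreeGroup (Fin 3) := FreeGroup.of
  {s 0 * s 1 * s 0 * (s 1 * s 0 * s 1)⁻¹,
   s 1 * s 2 * s 1 * (s 2 * s 1 * s 2)⁻¹,
   s 0 * s 2 * (s 2 * s 0)⁻¹}

/-- The braid group on four strands. -/
abbrev B4 : Type := PresentedGroup braidRelators

/-! ### The dual (Birman-Ko-Lee) Garside structure -/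

def σ₁ : B4 := PresentedGroup.of 0
def σ₂ : B4 := PresentedGroup.of 1
def σ₃ : B4 := PresentedGroup.of 2

/-- The band generators `a_{p,q}`. The punctures `1, 2, 3, 4` sit at the corners
south-east, south-west, north-west, north-east of a square. -/
def a₁₂ : B4 := σ₁
def a₂₃ : B4 := σ₂
def a₃₄ : B4 := σ₃
def a₁₃ : B4 := σ₂⁻¹ * σ₁ * σ₂
def a₂₄ : B4 := σ₃⁻¹ * σ₂ * σ₃
def a₁₄ : B4 := σ₃⁻¹ * σ₂⁻¹ * σ₁ * σ₂ * σ₃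

/-- The set of the four generators corresponding to the sides (west, north, east, south) of the
square. -/
def edgeGenerators : Set B4 := {a₂₃, a₃₄, a₁₄, a₁₂}

/-- The monoid of positive braids of the dual structure. -/
def positive : Submonoid B4 := Submonoid.closure {a₁₂, a₂₃, a₃₄, a₁₃, a₂₄, a₁₄}

/-- The prefix order `x ≼ y`. -/
def Prefix (x y : B4) : Prop := x⁻¹ * y ∈ positive

/-- The Garside element. -/
def δ : B4 := σ₁ * σ₂ * σ₃

/-- Simple elements: the positive prefixes of `δ`. -/
def IsSimple (s : B4) : Prop := Prefix 1 s ∧ Prefix s δ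

/-- `conjBy x z` is `x ^ z = z⁻¹ x z`. -/
def conjBy (x z : B4) : B4 := z⁻¹ * x * z

/-- The inner automorphism `τ : x ↦ δ⁻¹ x δ`. -/
def τ : MulAut B4 := MulAut.conj δ⁻¹

/-- `d` is the greatest common divisor of `x` and `y` for the prefix order. -/
def IsGcd (d x y : B4) : Prop :=
  Prefix d x ∧ Prefix d y ∧ ∀ e, Prefix e x → Prefix e y → Prefix e d

/-- The greatest common divisor `x ∧ y` for the prefix order (which is a lattice order). -/
noncomputable def meet (x y : B4) : B4 := Classical.epsilon fun d => IsGcd d x y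

/-- The right complement `∂(s) = s⁻¹ δ`. -/
def rightComplement (s : B4) : B4 := s⁻¹ * δ

/-- The pair `s₁ s₂` is left-weighted: `∂(s₁) ∧ s₂ = 1`. -/
def LeftWeighted (s₁ s₂ : B4) : Prop := IsGcd 1 (rightComplement s₁) s₂

/-- `x = δ ^ p * x₁ * ⋯ * x_r`, with `L = [x₁, …, x_r]`, is in left normal form. -/
structure IsNormalForm (x : B4) (p : ℤ) (L : List B4) : Prop where
  eq_prod : x = δ ^ p * L.prod
  greatest : IsGreatest {k : ℤ | Prefix (δ ^ k) x} p
  simple : ∀ s ∈ L, IsSimple s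
  last_ne_one : ∀ h : L ≠ [], L.getLast h ≠ 1
  leftWeighted : L.IsChain LeftWeighted

/-- The left normal form of `x`, as the pair of the exponent of `δ` and the list of factors. Every
element has exactly one left normal form. -/
noncomputable def normalForm (x : B4) : ℤ × List B4 :=
  Classical.epsilon fun q => IsNormalForm x q.1 q.2

/-- The infimum `inf(x)`. -/
noncomputable def infimum (x : B4) : ℤ := (normalForm x).1

/-- The factors `x₁, …, x_r` of the normal form of `x` (those other than powers of `δ`). -/
noncomputable def factors (x : B4) : List B4 := (normalForm x).2

/-- The canonical length `ℓ(x)`. -/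
noncomputable def canonicalLength (x : B4) : ℕ := (factors x).length

/-- The initial factor `ι(x) = τ ^ (-p) (x₁)`; used only when `ℓ(x) ≥ 1`. -/
noncomputable def initialFactor (x : B4) : B4 := (τ ^ (-infimum x)) ((factors x).headD 1)

/-- The final factor `φ(x) = x_r`; used only when `ℓ(x) ≥ 1`. -/
noncomputable def finalFactor (x : B4) : B4 := (factors x).getLastD 1

/-- `x` is rigid: `ℓ(x) ≥ 1` and the pair `φ(x) ι(x)` is left-weighted. -/
def IsRigid (x : B4) : Prop :=
  1 ≤ canonicalLength x ∧ LeftWeighted (finalFactor x) (initialFactor x)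

/-! ### Cycling, cyclic sliding, sliding circuits -/

/-- Cycling: `x ↦ x ^ ι(x)`, the identity on elements of canonical length zero. -/
noncomputable def cycling (x : B4) : B4 :=
  if canonicalLength x = 0 then x else conjBy x (initialFactor x)

/-- The preferred prefix `ι(x) ∧ ∂(φ(x))`; used only when `ℓ(x) ≥ 1`. -/
noncomputable def preferredPrefix (x : B4) : B4 :=
  meet (initialFactor x) (rightComplement (finalFactor x))

/-- Cyclic sliding: conjugation by the preferred prefix, the identity on elements of canonical
length zero. -/
noncomputable def sliding (x : B4) : B4 :=
  if canonicalLength x = 0 then x else conjBy x (preferredPrefix x)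

/-- The set of sliding circuits: the conjugates `y` of `x` with `𝔰^k(y) = y` for some `k ≥ 1`. -/
def SC (x : B4) : Set B4 := {y | IsConj x y ∧ ∃ k : ℕ, 1 ≤ k ∧ sliding^[k] y = y}

/-! ### The quotient graph -/

/-- `s` is a minimal arrow for `y` (an element of `SC x`). -/
def IsMinimalArrow (x y s : B4) : Prop :=
  IsSimple s ∧ s ≠ 1 ∧ conjBy y s ∈ SC x ∧
    ∀ t, Prefix 1 t → Prefix t s → conjBy y t ∈ SC x → t = 1 ∨ t = s

/-- The orbit `O_y = {τ^k (c^l y)}` of `y` under cycling and conjugation by `δ`. -/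
def orbit (y : B4) : Set B4 := {z | ∃ k l : ℕ, z = (τ ^ k) (cycling^[l] y)}

/-- `s` is a minimal useful arrow for `y` (an element of `SC x`). -/
def IsMinimalUsefulArrow (x y s : B4) : Prop :=
  IsMinimalArrow x y s ∧ conjBy y s ∉ orbit y

/-- The equivalence relation on `SC x` given by equality of orbits. -/
def orbitSetoid (x : B4) : Setoid (SC x) := Setoid.comap (fun y => orbit y) ⊥

/-- The set of orbits in `SC x`, as the quotient of `SC x`. -/
def SCQuotient (x : B4) : Type := Quotient (orbitSetoid x)

/-- A representative in `SC x` of an orbit. -/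
noncomputable def SCQuotient.rep {x : B4} (O : SCQuotient x) : B4 :=
  (Quotient.out (s := orbitSetoid x) O : SC x)

/-- The arrows of the quotient graph: those from `O` to `O'` are the minimal useful arrows from
the chosen representative of `O` to an element of the orbit `O'`. -/
noncomputable instance (x : B4) : Quiver (SCQuotient x) where
  Hom O O' := {s : B4 // IsMinimalUsefulArrow x O.rep s ∧ conjBy O.rep s ∈ orbit O'.rep}

/-- The quotient graph of `x`, as an oriented graph whose vertices are the orbits in `SC x`. -/
noncomputable def quotientGraph (x : B4) : CategoryTheory.Quiv.{0, 0} :=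
  CategoryTheory.Quiv.of (SCQuotient x)

end BKL4

/-! Two independent ingredients carry the proof: a lattice description of rigid conjugates, and a
finite transducer acting on words of atoms.

The group is shown to be a lattice from scratch. The fourteen simple elements form an abstract germ
whose coherence is a finite check. The germ acts on formal normal forms, the action extends to `B4`
(`nfHom`), and applying a positive braid to the empty form reveals its greatest simple prefix.
Greatest common divisors follow by induction on the exponent sum (`exists_isGLB`). Left translations
and right multiplications by powers of `δ` are automorphisms of this lattice, so the bounds on a
conjugate `conjBy y g`, and its rigidity, become fixed-point conditions on `g` for commuting,
meet-preserving operators `pull` and `slide` (`rig_conjBy_iff`). Periodicity under sliding then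
forces every element of `SC x` to be rigid with the infimum and supremum of `x` (`rig_of_mem_SC`).
As the exponent sum is a conjugacy invariant, all of them have only atoms as factors: this is
`Atomic`.

For such `y`, decycling is inverse to cycling and `r` decyclings amount to `τ ^ p`, so an orbit has
at most `4 * r` elements (`encard_orbit_le`) and `y` is determined by the sequence `w` of its
successive final atoms. A minimal conjugator is an atom or the complement of the final factor
(`exists_minimal_conj`), and the latter stays in the orbit. An atom `t` leading to another orbit is
transported along decycling to a sequence with `w n * t n = t (n + 1) * w' n`, each step exchanging
one two-atom factorization of a simple element for another (`exists_flips`).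

Finite case checks on these exchanges give two facts about a word of sides. If a move produces a
word with a diagonal, a further move goes back or stays in the same orbit (`back_or_rot`). Among
moves to words of sides, at most one atom leaves the orbit (`eq_or_eq_of_ne`). Each word has at most
three candidate atoms. Hence the graph is either one centre with at most three leaves, or two
adjacent centres each with at most two leaves. This gives at most six orbits, and `6 * (4 * r)`
elements. -/

namespace BKL4

/-! ### The germ of simple elements -/

/-- The fourteen simple elements, as an abstract germ. -/
inductive Simple
  | one | a12 | a23 | a34 | a14 | a13 | a24
  | t123 | t234 | t134 | t124 | p12 | p23 | delta
  deriving DecidableEq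

namespace Simple

/-- All simple elements. -/
def all : List Simple :=
  [one, a12, a23, a34, a14, a13, a24, t123, t234, t134, t124, p12, p23, delta]

instance : Fintype Simple where
  elems := ⟨all, by decide⟩
  complete s := by cases s <;> decide

/-- The partial product of simple elements. -/
def mul : Simple → Simple → Option Simple
  | one, s => some s
  | s, one => some s
  | a12, a23 => some t123 | a23, a13 => some t123 | a13, a12 => some t123
  | a23, a34 => some t234 | a34, a24 => some t234 | a24, a23 => some t234
  | a34, a14 => some t134 | a14, a13 => some t134 | a13, a34 => some t134
  | a14, a12 => some t124 | a12, a24 => some t124 | a24, a14 => some t124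
  | a12, a34 => some p12 | a34, a12 => some p12
  | a23, a14 => some p23 | a14, a23 => some p23
  | a12, t234 => some delta | a23, t134 => some delta
  | a34, t124 => some delta | a14, t123 => some delta
  | a13, p12 => some delta | a24, p23 => some delta
  | t123, a34 => some delta | t234, a14 => some delta
  | t134, a12 => some delta | t124, a23 => some delta
  | p12, a24 => some delta | p23, a13 => some delta
  | _, _ => none

/-- The right complement with respect to `delta`. -/
def compl : Simple → Simple
  | one => delta | delta => one
  | a12 => t234 | a23 => t134 | a34 => t124 | a14 => t123 | a13 => p12 | a24 => p23
  | t123 => a34 | t234 => a14 | t134 => a12 | t124 => a23 | p12 => a24 | p23 => a13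

/-- Conjugation by `delta`. -/
def rot : Simple → Simple
  | one => one | delta => delta
  | a12 => a14 | a14 => a34 | a34 => a23 | a23 => a12 | a13 => a24 | a24 => a13
  | t123 => t124 | t124 => t134 | t134 => t234 | t234 => t123 | p12 => p23 | p23 => p12

/-- The atoms below a simple element, as a bit mask. -/
def mask : Simple → ℕ
  | one => 0 | a12 => 1 | a23 => 2 | a34 => 4 | a14 => 8 | a13 => 16 | a24 => 32
  | t123 => 19 | t234 => 38 | t134 => 28 | t124 => 41 | p12 => 5 | p23 => 10 | delta => 63

/-- The meet of two simple elements. -/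
def meet (s t : Simple) : Simple :=
  -- Simple elements correspond to noncrossing partitions of four points, whose meets are
  -- intersections. A match therefore always exists and the default is never used.
  (all.find? fun u => mask u = mask s &&& mask t).getD one

/-- The quotient `s⁻¹ t`, when `s` is a prefix of `t`. -/
def ldiv (s t : Simple) : Simple :=
  (all.find? fun u => mul s u = some t).getD one

/-- First factor of the left-weighted form of `s t`. -/
def fstN (s t : Simple) : Simple := (mul s (meet (compl s) t)).getD one

/-- Second factor of the left-weighted form of `s t`. -/
def sndN (s t : Simple) : Simple := ldiv (meet (compl s) t) t

/-- What divides the complement of `s` can be absorbed into `s`; in particular the default value in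
`fstN` never occurs. -/
theorem mul_meet_compl (s t : Simple) : mul s (meet (compl s) t) = some (fstN s t) := by
  revert s t; decide

theorem mul_sndN (s t : Simple) : mul (meet (compl s) t) (sndN s t) = some t := by
  revert s t; decide

/-- The coherence that turns the partial product into an action: both sides compute the greatest
simple prefix of `s * t * r` and what remains. -/
theorem normalize_mul (s t m : Simple) (h : mul s t = some m) (r : Simple) :
    fstN s (fstN t r) = fstN m r ∧ mul (sndN s (fstN t r)) (sndN t r) = some (sndN m r) := by
  revert s t m r; decide +kernel

theorem meet_norm (s t : Simple) : meet (compl (fstN s t)) (sndN s t) = one := by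
  revert s t; decide

theorem mul_eq_one (s t : Simple) (h : mul s t = some one) : s = one ∧ t = one := by
  revert s t; decide

end Simple
end BKL4

/-! ### Formal normal forms and the action of the braid group on them -/

namespace BKL4
namespace Simple

/-- Left-weightedness in the germ. -/
def LW (s t : Simple) : Prop := meet (compl s) t = one

instance : DecidableRel LW := fun s t => inferInstanceAs (Decidable (meet (compl s) t = one))

/-- `rot` as a permutation. -/
def rotPerm : Equiv.Perm Simple where
  toFun := rot
  invFun s := rot (rot (rot s))
  left_inv s := by cases s <;> rfl
  right_inv s := by cases s <;> rfl

theorem mul_rot (s t m : Simple) : mul (rot s) (rot t) = some (rot m) ↔ mul s t = some m := by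
  revert s t m; decide

theorem mul_rotPerm_zpow (p : ℤ) : ∀ {s t m : Simple}, mul s t = some m →
    mul ((rotPerm ^ p) s) ((rotPerm ^ p) t) = some ((rotPerm ^ p) m) := by
  induction p using Int.induction_on with
  | zero => simp
  | succ n ih =>
    intro s t m h
    rw [zpow_add_one]
    exact ih ((mul_rot s t m).2 h)
  | pred n ih =>
    intro s t m h
    rw [zpow_sub_one]
    refine ih ((mul_rot _ _ _).1 ?_)
    change mul (rotPerm (rotPerm⁻¹ s)) (rotPerm (rotPerm⁻¹ t)) = some (rotPerm (rotPerm⁻¹ m))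
    simpa using h

theorem rotPerm_zpow_delta (p : ℤ) : (rotPerm ^ p) delta = delta := by
  have h : rotPerm delta = delta := rfl
  exact Function.IsFixedPt.perm_zpow h p

/-- Left multiplication of a positive left-weighted word by a simple element. -/
def act : Simple → List Simple → List Simple
  | s, [] => if s = one then [] else [s]
  | s, r :: L => fstN s r :: act (sndN s r) L

theorem fstN_sndN_of_mul (s t m : Simple) (h : mul s t = some m) :
    fstN s t = m ∧ sndN s t = one := by
  revert s t m; decide

theorem act_act {s t m : Simple} (h : mul s t = some m) (L : List Simple) :
    act s (act t L) = act m L := by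
  induction L generalizing s t m with
  | nil =>
    by_cases ht : t = one
    · subst ht
      have : s = m := by revert s m; decide
      subst this; rfl
    · have hm : m ≠ one := fun hm => ht (mul_eq_one s t (hm ▸ h)).2
      obtain ⟨h1, h2⟩ := fstN_sndN_of_mul s t m h
      simp [act, ht, hm, h1, h2]
  | cons r L ih =>
    obtain ⟨h1, h2⟩ := normalize_mul s t m h r
    simp only [act, h1, ih h2]

theorem LW.norm {s t : Simple} (h : LW s t) : fstN s t = s ∧ sndN s t = t := by
  revert s t; decide

theorem act_of_isChain {s : Simple} {L : List Simple} (h : (s :: L).IsChain LW)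
    (h1 : one ∉ s :: L) : act s L = s :: L := by
  induction L generalizing s with
  | nil => simp [act]; rintro rfl; simp at h1
  | cons r L ih =>
    rw [List.isChain_cons_cons] at h
    rw [act, h.1.norm.1, h.1.norm.2, ih h.2 (fun h' => h1 (List.mem_cons_of_mem _ h'))]

theorem fstN_ne_one {s r : Simple} (h : r ≠ one) : fstN s r ≠ one := by
  revert s r; decide

theorem lw_norm (s t : Simple) : LW (fstN s t) (sndN s t) := meet_norm s t

/-- The domino rule, by finite check: a multiplier pushed from left to right through a left-weighted
word leaves a left-weighted word behind it. -/
theorem LW.domino {r t : Simple} (h : LW r t) (s : Simple) :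
    LW (fstN s r) (fstN (sndN s r) t) := by
  revert r t s; decide +kernel

theorem one_notMem_act {L : List Simple} (s : Simple) (h : one ∉ L) : one ∉ act s L := by
  induction L generalizing s with
  | nil => by_cases hs : s = one <;> simp [act, hs, eq_comm]
  | cons r L ih =>
    simp only [List.mem_cons, not_or] at h
    simp only [act, List.mem_cons, not_or]
    exact ⟨(fstN_ne_one (Ne.symm h.1)).symm, ih _ h.2⟩

theorem isChain_act {L : List Simple} (s : Simple) (h : L.IsChain LW) : (act s L).IsChain LW := by
  induction L generalizing s with
  | nil => by_cases hs : s = one <;> simp [act, hs]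
  | cons r L ih =>
    cases L with
    | nil =>
      by_cases hs : sndN s r = one
      · simp [act, hs]
      · simp [act, hs, lw_norm]
    | cons t L =>
      have h' := ih (sndN s r) h.tail
      rw [List.isChain_cons_cons] at h
      simp only [act] at h' ⊢
      rw [List.isChain_cons_cons]
      exact ⟨h.1.domino s, h'⟩

/-- Absorbs the leading factors `delta` into the exponent. -/
def reduce : ℤ → List Simple → ℤ × List Simple
  | p, [] => (p, [])
  | p, s :: L => if s = delta then reduce (p + 1) L else (p, s :: L)

theorem eq_delta_of_lw_delta {s : Simple} (h : LW s delta) : s = delta := by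
  revert s; decide

theorem delta_notMem {s : Simple} {L : List Simple} (h : (s :: L).IsChain LW)
    (hs : s ≠ delta) : delta ∉ s :: L := by
  induction L generalizing s with
  | nil => simpa using hs.symm
  | cons r L ih =>
    rw [List.isChain_cons_cons] at h
    have hr : r ≠ delta := by
      rintro rfl; exact hs (eq_delta_of_lw_delta h.1)
    have := ih h.2 hr
    simp only [List.mem_cons, not_or] at this ⊢
    exact ⟨hs.symm, this⟩

/-- Pairs `(p, L)` encoding a left normal form. -/
def IsNF (x : ℤ × List Simple) : Prop := x.2.IsChain LW ∧ one ∉ x.2 ∧ delta ∉ x.2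

theorem isNF_reduce (p : ℤ) {L : List Simple} (h : L.IsChain LW) (h1 : one ∉ L) :
    IsNF (reduce p L) := by
  induction L generalizing p with
  | nil => simp [reduce, IsNF]
  | cons s L ih =>
    by_cases hs : s = delta
    · simpa [reduce, hs] using ih (p + 1) h.tail (fun h' => h1 (List.mem_cons_of_mem _ h'))
    · rw [reduce, if_neg hs]
      exact ⟨h, h1, delta_notMem h hs⟩

theorem reduce_of_isNF {x : ℤ × List Simple} (h : IsNF x) : reduce x.1 x.2 = x := by
  obtain ⟨p, L⟩ := x
  cases L with
  | nil => rfl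
  | cons s L =>
    have : s ≠ delta := fun hs => h.2.2 (by simp [hs])
    simp [reduce, this]

/-- Left multiplication of a normal form by a simple element. -/
def gact (s : Simple) (x : ℤ × List Simple) : ℤ × List Simple :=
  reduce x.1 (act ((rotPerm ^ x.1) s) x.2)

theorem norm_delta (s : Simple) : fstN s delta = delta ∧ sndN s delta = rot s := by
  revert s; decide

/-- A letter `delta` crossed by a multiplier turns it by `rot`, which is the twist that `gact`
applies when that letter has been absorbed into the exponent. -/
theorem gact_reduce (s : Simple) (p : ℤ) (L : List Simple) :
    gact s (reduce p L) = reduce p (act ((rotPerm ^ p) s) L) := by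
  induction L generalizing p with
  | nil => rfl
  | cons r L ih =>
    by_cases hr : r = delta
    · subst hr
      have h := norm_delta ((rotPerm ^ p) s)
      have h2 : rot ((rotPerm ^ p) s) = (rotPerm ^ (p + 1)) s := by
        rw [add_comm, zpow_add, zpow_one]; rfl
      simp [reduce, act, h.1, h.2, ih, h2]
    · simp [reduce, hr, gact]

theorem gact_gact {s t m : Simple} (h : mul s t = some m) (x : ℤ × List Simple) :
    gact s (gact t x) = gact m x := by
  rw [gact.eq_1 t, gact_reduce, act_act (mul_rotPerm_zpow _ h), gact]

theorem delta_norm (s : Simple) : fstN delta s = delta ∧ sndN delta s = s := by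
  revert s; decide

theorem gact_delta {x : ℤ × List Simple} (h : IsNF x) : gact delta x = (x.1 + 1, x.2) := by
  obtain ⟨p, L⟩ := x
  have hd : act delta L = delta :: L := by
    cases L with
    | nil => rfl
    | cons r L =>
      rw [act, (delta_norm r).1, (delta_norm r).2, act_of_isChain h.1 h.2.1]
  simp only [gact, rotPerm_zpow_delta, hd, reduce, if_true]
  exact reduce_of_isNF (x := (p + 1, L)) h

theorem isNF_gact (s : Simple) {x : ℤ × List Simple} (h : IsNF x) : IsNF (gact s x) :=
  isNF_reduce _ (isChain_act _ h.1) (one_notMem_act _ h.2.1)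

/-- Normal forms, as a type. -/
def NF : Type := {x : ℤ × List Simple // IsNF x}

/-- Left multiplication by a simple element. -/
def nfAct (s : Simple) (x : NF) : NF := ⟨gact s x.1, isNF_gact s x.2⟩

theorem nfAct_nfAct {s t m : Simple} (h : mul s t = some m) (x : NF) :
    nfAct s (nfAct t x) = nfAct m x := Subtype.ext (gact_gact h x.1)

theorem nfAct_delta_bijective : Function.Bijective (nfAct delta) := by
  constructor
  · intro x y h
    have h' := congrArg Subtype.val h
    simp only [nfAct, gact_delta x.2, gact_delta y.2, Prod.mk.injEq, add_left_inj] at h'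
    exact Subtype.ext (Prod.ext h'.1 h'.2)
  · intro x
    refine ⟨⟨(x.1.1 - 1, x.1.2), x.2⟩, Subtype.ext ?_⟩
    simp only [nfAct]
    rw [gact_delta (x := (x.1.1 - 1, x.1.2)) x.2]
    simp

theorem mul_compl (s : Simple) : mul s (compl s) = some delta := by revert s; decide

theorem exists_mul_eq_delta (s : Simple) : ∃ t, mul t s = some delta := by revert s; decide

/-- Every simple element divides `delta` on both sides, and `delta` acts bijectively, by raising the
exponent by one. -/
theorem nfAct_bijective (s : Simple) : Function.Bijective (nfAct s) := by
  constructor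
  · obtain ⟨t, ht⟩ := exists_mul_eq_delta s
    refine Function.Injective.of_comp (f := nfAct t) ?_
    rw [show nfAct t ∘ nfAct s = nfAct delta from funext (nfAct_nfAct ht)]
    exact nfAct_delta_bijective.1
  · refine Function.Surjective.of_comp (g := nfAct (compl s)) ?_
    rw [show nfAct s ∘ nfAct (compl s) = nfAct delta from funext (nfAct_nfAct (mul_compl s))]
    exact nfAct_delta_bijective.2

/-- Left multiplication by a simple element, as a permutation of the normal forms. -/
noncomputable def nfPerm (s : Simple) : Equiv.Perm NF := Equiv.ofBijective _ (nfAct_bijective s)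

theorem nfPerm_mul {s t m : Simple} (h : mul s t = some m) : nfPerm s * nfPerm t = nfPerm m :=
  Equiv.ext (nfAct_nfAct h)

end Simple

open Simple in
/-- The action of the braid group on the normal forms. -/
noncomputable def nfHom : B4 →* Equiv.Perm NF :=
  PresentedGroup.toGroup (f := ![nfPerm a12, nfPerm a23, nfPerm a34]) (by
    -- In the triangle `123` the three products `a12 a23`, `a23 a13`, `a13 a12` coincide; applying
    -- this twice gives the braid relation.
    have h1 : nfPerm a12 * nfPerm a23 * nfPerm a12 = nfPerm a23 * nfPerm a12 * nfPerm a23 := by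
      rw [nfPerm_mul (show mul a12 a23 = some t123 from rfl),
        ← nfPerm_mul (show mul a23 a13 = some t123 from rfl), mul_assoc, mul_assoc,
        nfPerm_mul (show mul a13 a12 = some t123 from rfl),
        nfPerm_mul (show mul a12 a23 = some t123 from rfl)]
    have h2 : nfPerm a23 * nfPerm a34 * nfPerm a23 = nfPerm a34 * nfPerm a23 * nfPerm a34 := by
      rw [nfPerm_mul (show mul a23 a34 = some t234 from rfl),
        ← nfPerm_mul (show mul a34 a24 = some t234 from rfl), mul_assoc, mul_assoc,
        nfPerm_mul (show mul a24 a23 = some t234 from rfl),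
        nfPerm_mul (show mul a23 a34 = some t234 from rfl)]
    have h3 : nfPerm a12 * nfPerm a34 = nfPerm a34 * nfPerm a12 := by
      rw [nfPerm_mul (show mul a12 a34 = some p12 from rfl),
        nfPerm_mul (show mul a34 a12 = some p12 from rfl)]
    intro r hr
    simp only [braidRelators, Set.mem_insert_iff, Set.mem_singleton_iff] at hr
    rcases hr with rfl | rfl | rfl
    · rw [map_mul, map_inv, mul_inv_eq_one]
      simpa using h1
    · rw [map_mul, map_inv, mul_inv_eq_one]
      simpa using h2
    · rw [map_mul, map_inv, mul_inv_eq_one]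
      simpa using h3)

end BKL4

/-! ### Relations between the band generators -/

namespace BKL4

theorem braid₁₂ : σ₁ * σ₂ * σ₁ = σ₂ * σ₁ * σ₂ := by
  have h : PresentedGroup.mk braidRelators _ = 1 := PresentedGroup.one_of_mem
    (show FreeGroup.of 0 * FreeGroup.of 1 * FreeGroup.of 0 *
      (FreeGroup.of 1 * FreeGroup.of 0 * FreeGroup.of 1)⁻¹ ∈ braidRelators from by
        simp [braidRelators])
  rwa [map_mul, map_inv, mul_inv_eq_one] at h

theorem braid₂₃ : σ₂ * σ₃ * σ₂ = σ₃ * σ₂ * σ₃ := by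
  have h : PresentedGroup.mk braidRelators _ = 1 := PresentedGroup.one_of_mem
    (show FreeGroup.of 1 * FreeGroup.of 2 * FreeGroup.of 1 *
      (FreeGroup.of 2 * FreeGroup.of 1 * FreeGroup.of 2)⁻¹ ∈ braidRelators from by
        simp [braidRelators])
  rwa [map_mul, map_inv, mul_inv_eq_one] at h

theorem comm₁₃ : σ₁ * σ₃ = σ₃ * σ₁ := by
  have h : PresentedGroup.mk braidRelators _ = 1 := PresentedGroup.one_of_mem
    (show FreeGroup.of 0 * FreeGroup.of 2 *
      (FreeGroup.of 2 * FreeGroup.of 0)⁻¹ ∈ braidRelators from by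
        simp [braidRelators])
  rwa [map_mul, map_inv, mul_inv_eq_one] at h

theorem a₂₃_mul_a₁₃ : a₂₃ * a₁₃ = a₁₂ * a₂₃ := by simp [a₂₃, a₁₃, a₁₂, mul_assoc]

theorem a₁₃_mul_a₁₂ : a₁₃ * a₁₂ = a₁₂ * a₂₃ := by
  have h := braid₁₂
  simp only [mul_assoc] at h
  simp [a₂₃, a₁₃, a₁₂, mul_assoc, h]

theorem a₃₄_mul_a₂₄ : a₃₄ * a₂₄ = a₂₃ * a₃₄ := by simp [a₃₄, a₂₄, a₂₃, mul_assoc]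

theorem a₂₄_mul_a₂₃ : a₂₄ * a₂₃ = a₂₃ * a₃₄ := by
  have h := braid₂₃
  simp only [mul_assoc] at h
  simp [a₃₄, a₂₄, a₂₃, mul_assoc, h]

theorem a₁₂_mul_a₃₄ : a₁₂ * a₃₄ = a₃₄ * a₁₂ := comm₁₃

theorem a₃₄_mul_a₁₄ : a₃₄ * a₁₄ = a₁₃ * a₃₄ := by simp [a₃₄, a₁₄, a₁₃, mul_assoc]

theorem a₁₃_eq : a₁₃ = σ₁ * σ₂ * σ₁⁻¹ := by
  rw [eq_mul_inv_iff_mul_eq]; exact a₁₃_mul_a₁₂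

theorem a₁₄_eq : a₁₄ = σ₃⁻¹ * a₁₃ * σ₃ := by simp [a₁₄, a₁₃, mul_assoc]

/-- This is `braid₂₃` conjugated by `σ₁`, which commutes with `σ₃`. -/
theorem a₁₃_braid : a₁₃ * σ₃ * a₁₃ = σ₃ * a₁₃ * σ₃ := by
  have h3 : σ₁⁻¹ * σ₃ = σ₃ * σ₁⁻¹ := by
    rw [inv_mul_eq_iff_eq_mul, ← mul_assoc, comm₁₃, mul_inv_cancel_right]
  calc a₁₃ * σ₃ * a₁₃ = σ₁ * σ₂ * (σ₁⁻¹ * σ₃) * σ₁ * σ₂ * σ₁⁻¹ := by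
        rw [a₁₃_eq]; group
    _ = σ₁ * (σ₂ * σ₃ * σ₂) * σ₁⁻¹ := by rw [h3]; group
    _ = (σ₁ * σ₃) * σ₂ * (σ₃ * σ₁⁻¹) := by rw [braid₂₃]; group
    _ = σ₃ * a₁₃ * σ₃ := by rw [comm₁₃, ← h3, a₁₃_eq]; group

theorem a₁₄_mul_a₁₃ : a₁₄ * a₁₃ = a₁₃ * a₃₄ := by
  rw [a₁₄_eq, show a₃₄ = σ₃ from rfl, mul_assoc, mul_assoc, inv_mul_eq_iff_eq_mul, ← mul_assoc,
    ← mul_assoc, a₁₃_braid]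

theorem a₂₄_mul_a₁₄ : a₂₄ * a₁₄ = σ₃⁻¹ * σ₁ * σ₂ * σ₃ := by simp [a₂₄, a₁₄, mul_assoc]

theorem a₁₂_mul_a₂₄ : a₁₂ * a₂₄ = a₂₄ * a₁₄ := by
  have h3 : σ₃⁻¹ * σ₁ = σ₁ * σ₃⁻¹ := by
    rw [inv_mul_eq_iff_eq_mul, ← mul_assoc, ← comm₁₃, mul_inv_cancel_right]
  rw [a₂₄_mul_a₁₄, h3, a₁₂, a₂₄]; group

theorem a₁₄_mul_a₁₂ : a₁₄ * a₁₂ = a₂₄ * a₁₄ := by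
  calc a₁₄ * a₁₂ = σ₃⁻¹ * a₁₃ * (σ₃ * σ₁) := by rw [a₁₄_eq, a₁₂]; group
    _ = σ₃⁻¹ * (a₁₃ * a₁₂) * σ₃ := by rw [← comm₁₃, a₁₂]; group
    _ = a₂₄ * a₁₄ := by rw [a₁₃_mul_a₁₂, a₂₄_mul_a₁₄, a₁₂, a₂₃]; group

theorem a₂₄_mul_a₁₄_mul_a₂₃ : a₂₄ * a₁₄ * a₂₃ = δ := by
  calc a₂₄ * a₁₄ * a₂₃ = σ₃⁻¹ * σ₁ * (σ₂ * σ₃ * σ₂) := by rw [a₂₄_mul_a₁₄, a₂₃]; group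
    _ = σ₃⁻¹ * (σ₁ * σ₃) * σ₂ * σ₃ := by rw [braid₂₃]; group
    _ = δ := by rw [comm₁₃, δ]; group

theorem a₂₃_mul_a₃₄_mul_a₁₄ : a₂₃ * a₃₄ * a₁₄ = δ := by
  simp [a₂₃, a₃₄, a₁₄, δ, mul_assoc]

/-- Cancel `a₂₄` on the left in two factorizations of `δ`. -/
theorem a₁₄_mul_a₂₃ : a₁₄ * a₂₃ = a₂₃ * a₁₄ := by
  have h : a₂₄ * (a₁₄ * a₂₃) = a₂₄ * (a₂₃ * a₁₄) := by
    rw [← mul_assoc, a₂₄_mul_a₁₄_mul_a₂₃, ← mul_assoc, a₂₄_mul_a₂₃, a₂₃_mul_a₃₄_mul_a₁₄]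
  exact mul_left_cancel h

namespace Simple

/-- The simple braid named by an element of the germ. -/
def toB4 : Simple → B4
  | one => 1 | a12 => a₁₂ | a23 => a₂₃ | a34 => a₃₄ | a14 => a₁₄ | a13 => a₁₃ | a24 => a₂₄
  | t123 => a₁₂ * a₂₃ | t234 => a₂₃ * a₃₄ | t134 => a₁₃ * a₃₄ | t124 => a₂₄ * a₁₄
  | p12 => a₁₂ * a₃₄ | p23 => a₂₃ * a₁₄ | delta => δ

theorem toB4_mul : ∀ {s t m : Simple}, mul s t = some m → toB4 s * toB4 t = toB4 m := by
  have e1 : a₁₂ * a₂₃ * a₃₄ = δ := rfl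
  have e2 : a₂₃ * (a₁₃ * a₃₄) = δ := by rw [← mul_assoc, a₂₃_mul_a₁₃]; rfl
  have e3 : a₃₄ * (a₂₄ * a₁₄) = δ := by
    rw [← mul_assoc, a₃₄_mul_a₂₄, a₂₃_mul_a₃₄_mul_a₁₄]
  have e4 : a₁₄ * (a₁₂ * a₂₃) = δ := by
    rw [← mul_assoc, a₁₄_mul_a₁₂, a₂₄_mul_a₁₄_mul_a₂₃]
  have e5 : a₁₃ * (a₁₂ * a₃₄) = δ := by rw [← mul_assoc, a₁₃_mul_a₁₂]; rfl
  have e6 : a₂₄ * (a₂₃ * a₁₄) = δ := by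
    rw [← mul_assoc, a₂₄_mul_a₂₃, a₂₃_mul_a₃₄_mul_a₁₄]
  have e7 : a₁₃ * a₃₄ * a₁₂ = δ := by rw [mul_assoc, ← a₁₂_mul_a₃₄, e5]
  have e8 : a₁₂ * a₃₄ * a₂₄ = δ := by rw [mul_assoc, a₃₄_mul_a₂₄, ← mul_assoc, e1]
  have e9 : a₂₃ * a₁₄ * a₁₃ = δ := by rw [mul_assoc, a₁₄_mul_a₁₃, e2]
  have e10 : a₁₂ * (a₂₃ * a₃₄) = δ := by rw [← mul_assoc, e1]
  have b1 := a₂₃_mul_a₁₃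
  have b2 := a₁₃_mul_a₁₂
  have b3 := a₃₄_mul_a₂₄
  have b4 := a₂₄_mul_a₂₃
  have b5 := a₁₂_mul_a₃₄
  have b6 := a₃₄_mul_a₁₄
  have b7 := a₁₄_mul_a₁₃
  have b8 := a₁₂_mul_a₂₄
  have b9 := a₁₄_mul_a₁₂
  have b10 := a₁₄_mul_a₂₃
  have b11 := a₂₄_mul_a₁₄_mul_a₂₃
  have b12 := a₂₃_mul_a₃₄_mul_a₁₄
  have b13 := b5.symm
  -- Each nontrivial entry of the multiplication table is one of the facts collected above.
  intro s t m h
  cases s <;> cases t <;> simp only [mul, Option.some.injEq, reduceCtorEq] at h <;> subst h <;>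
    first
      | exact one_mul _
      | exact mul_one _
      | rfl
      | assumption

/-- The length of a simple element. -/
def rank : Simple → ℤ
  | one => 0 | a12 => 1 | a23 => 1 | a34 => 1 | a14 => 1 | a13 => 1 | a24 => 1
  | t123 => 2 | t234 => 2 | t134 => 2 | t124 => 2 | p12 => 2 | p23 => 2 | delta => 3

end Simple

/-- The exponent sum, as a homomorphism. -/
def lenHom : B4 →* Multiplicative ℤ :=
  PresentedGroup.toGroup (f := fun _ => Multiplicative.ofAdd 1) (by
    intro r hr
    simp only [braidRelators, Set.mem_insert_iff, Set.mem_singleton_iff] at hr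
    rcases hr with rfl | rfl | rfl <;> simp)

/-- The exponent sum. -/
def len (x : B4) : ℤ := (lenHom x).toAdd

@[simp] theorem len_one : len 1 = 0 := by simp [len]

@[simp] theorem len_mul (x y : B4) : len (x * y) = len x + len y := by simp [len]

@[simp] theorem len_inv (x : B4) : len x⁻¹ = -len x := by simp [len]

@[simp] theorem len_zpow (x : B4) (k : ℤ) : len (x ^ k) = k * len x := by simp [len]

theorem len_σ (i : Fin 3) : len (PresentedGroup.of i) = 1 := by
  rw [len, lenHom, PresentedGroup.toGroup.of, toAdd_ofAdd]

@[simp] theorem len_toB4 (s : Simple) : len s.toB4 = s.rank := by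
  have h1 : len σ₁ = 1 := len_σ 0
  have h2 : len σ₂ = 1 := len_σ 1
  have h3 : len σ₃ = 1 := len_σ 2
  cases s <;> simp [Simple.toB4, a₁₂, a₂₃, a₃₄, a₁₃, a₂₄, a₁₄, δ, h1, h2, h3, Simple.rank]

@[simp] theorem len_δ : len δ = 3 := len_toB4 Simple.delta

open Simple

/-- Atoms of the germ. -/
def Simple.IsAtom (s : Simple) : Prop := s.rank = 1

instance : DecidablePred Simple.IsAtom := fun s => inferInstanceAs (Decidable (s.rank = 1))

theorem mem_gens_iff (x : B4) :
    x ∈ ({a₁₂, a₂₃, a₃₄, a₁₃, a₂₄, a₁₄} : Set B4) ↔ ∃ a : Simple, a.IsAtom ∧ x = a.toB4 := by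
  constructor
  · rintro (rfl | rfl | rfl | rfl | rfl | rfl)
    exacts [⟨a12, rfl, rfl⟩, ⟨a23, rfl, rfl⟩, ⟨a34, rfl, rfl⟩, ⟨a13, rfl, rfl⟩, ⟨a24, rfl, rfl⟩,
      ⟨a14, rfl, rfl⟩]
  · rintro ⟨a, ha, rfl⟩
    cases a <;> simp [toB4] <;> exact absurd ha (by decide)

theorem atom_mem_positive {a : Simple} (ha : a.IsAtom) : a.toB4 ∈ positive :=
  Submonoid.subset_closure ((mem_gens_iff _).2 ⟨a, ha, rfl⟩)

theorem Simple.exists_atom_mul (s : Simple) (h : s ≠ one) :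
    ∃ a t : Simple, a.IsAtom ∧ mul a t = some s ∧ t.rank < s.rank := by
  revert s; decide

theorem Simple.atom_induction {motive : Simple → Prop} (one : motive one)
    (step : ∀ {a t m : Simple}, a.IsAtom → mul a t = some m → motive t → motive m)
    (s : Simple) : motive s := by
  have hr : ∀ s : Simple, 0 ≤ s.rank := by decide
  have key : ∀ n : ℕ, ∀ s : Simple, s.rank = n → motive s := by
    intro n
    induction n using Nat.strong_induction_on with
    | _ n ih =>
      intro s hs
      by_cases h : s = Simple.one
      · exact h ▸ one
      · obtain ⟨a, t, ha, hm, hlt⟩ := s.exists_atom_mul h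
        refine step ha hm (ih t.rank.toNat ?_ t ?_)
        · have := hr t; omega
        · have := hr t; omega
  exact key s.rank.toNat s (by have := hr s; omega)

theorem toB4_mem_positive (s : Simple) : s.toB4 ∈ positive := by
  induction s using Simple.atom_induction with
  | one => exact positive.one_mem
  | step ha hm ih => exact toB4_mul hm ▸ positive.mul_mem (atom_mem_positive ha) ih

/-- The action was prescribed on the Artin generators only. The remaining band generators are
reached by cancelling in relations `a b = c d` of the germ. -/
theorem nfHom_toB4 (s : Simple) : nfHom s.toB4 = nfPerm s := by
  have h1 : nfHom a₁₂ = nfPerm a12 := PresentedGroup.toGroup.of _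
  have h2 : nfHom a₂₃ = nfPerm a23 := PresentedGroup.toGroup.of _
  have h3 : nfHom a₃₄ = nfPerm a34 := PresentedGroup.toGroup.of _
  have key : ∀ {a b c d m : Simple}, mul a b = some m → mul c d = some m →
      nfHom a.toB4 = nfPerm a → nfHom c.toB4 = nfPerm c → nfHom d.toB4 = nfPerm d →
      nfHom b.toB4 = nfPerm b := by
    intro a b c d m h h' ha hc hd
    have := congrArg nfHom ((toB4_mul h).trans (toB4_mul h').symm)
    rw [map_mul, map_mul, ha, hc, hd, nfPerm_mul h', ← nfPerm_mul h] at this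
    exact mul_left_cancel this
  have h4 : nfHom a₁₃ = nfPerm a13 :=
    key (a := a23) (b := a13) (c := a12) (d := a23) rfl rfl h2 h1 h2
  have h5 : nfHom a₂₄ = nfPerm a24 :=
    key (a := a34) (b := a24) (c := a23) (d := a34) rfl rfl h3 h2 h3
  have h6 : nfHom a₁₄ = nfPerm a14 :=
    key (a := a34) (b := a14) (c := a13) (d := a34) rfl rfl h3 h4 h3
  induction s using Simple.atom_induction with
  | one =>
    rw [toB4, map_one]
    have := nfPerm_mul (show mul one one = some one from rfl)
    exact (mul_eq_left.1 this).symm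
  | @step a t m ha hm ih =>
    rw [← toB4_mul hm, map_mul, ih, ← nfPerm_mul hm]
    congr 1
    cases a <;> first | assumption | exact absurd ha (by decide)

end BKL4

/-! ### Simple prefixes read off the action -/

namespace BKL4
open Simple

theorem δ_eq : δ = delta.toB4 := rfl

theorem toB4_mul_δ (s : Simple) : s.toB4 * δ = δ * (rot s).toB4 := by
  have h1 := toB4_mul (mul_compl s)
  have h2 := toB4_mul (mul_compl (compl s))
  have h3 : compl (compl s) = rot s := by cases s <;> rfl
  rw [h3] at h2
  rw [δ_eq, ← h2, ← mul_assoc, h1, h2]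

theorem toB4_mul_δ_zpow (s : Simple) (p : ℤ) :
    s.toB4 * δ ^ p = δ ^ p * ((rotPerm ^ p) s).toB4 := by
  induction p using Int.induction_on generalizing s with
  | zero => simp
  | succ n ih =>
    rw [zpow_add_one, ← mul_assoc, ih, mul_assoc, toB4_mul_δ, ← mul_assoc, add_comm (n : ℤ),
      zpow_add, zpow_one]
    rfl
  | pred n ih =>
    have h : s.toB4 * δ⁻¹ = δ⁻¹ * (rotPerm⁻¹ s).toB4 := by
      rw [mul_inv_eq_iff_eq_mul, mul_assoc, toB4_mul_δ, inv_mul_cancel_left]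
      congr 1
      exact (rotPerm.apply_symm_apply s).symm
    rw [zpow_sub_one, (Commute.refl δ).inv_right.zpow_left _ |>.eq, ← mul_assoc, h, mul_assoc, ih,
      ← mul_assoc, sub_eq_add_neg, add_comm, zpow_add, zpow_neg_one, mul_assoc, mul_assoc,
      (Commute.refl rotPerm).inv_left.zpow_right _ |>.eq]
    rfl

/-- The product of a word of simple elements. -/
def word (L : List Simple) : B4 := (L.map toB4).prod

@[simp] theorem word_nil : word [] = 1 := rfl

@[simp] theorem word_cons (s : Simple) (L : List Simple) : word (s :: L) = s.toB4 * word L := by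
  simp [word]

theorem toB4_fstN_mul_sndN (s t : Simple) : (fstN s t).toB4 * (sndN s t).toB4 = s.toB4 * t.toB4 := by
  rw [← toB4_mul (mul_sndN s t), ← mul_assoc, toB4_mul (mul_meet_compl s t)]

theorem word_act (s : Simple) (L : List Simple) : word (act s L) = s.toB4 * word L := by
  induction L generalizing s with
  | nil => by_cases h : s = one <;> simp [act, h, toB4]
  | cons r L ih => rw [act, word_cons, ih, word_cons, ← mul_assoc, toB4_fstN_mul_sndN, mul_assoc]

/-- The empty normal form. -/
def nfOne : NF := ⟨(0, []), by simp [IsNF]⟩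

/-- The largest simple prefix, read off the normal form. -/
noncomputable def head (g : B4) : Simple :=
  if 0 < (nfHom g nfOne).1.1 then delta else (nfHom g nfOne).1.2.headD one

theorem le_reduce_fst (p : ℤ) (L : List Simple) : p ≤ (reduce p L).1 := by
  induction L generalizing p with
  | nil => exact le_rfl
  | cons s L ih =>
    rw [reduce]
    split_ifs
    · exact (Int.le_add_one le_rfl).trans (ih _)
    · exact le_rfl

theorem head_of_reduce {g : B4} {L : List Simple} (h : (nfHom g nfOne).1 = reduce 0 L) :
    head g = L.headD one := by
  rw [head, h]
  cases L with
  | nil => rfl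
  | cons s L =>
    by_cases hs : s = delta
    · have := le_reduce_fst (0 + 1) L
      rw [reduce, if_pos hs, if_pos (by omega), hs]; rfl
    · rw [reduce, if_neg hs]; rfl

/-- Left-weightedness of `L` need not be recorded: `head_of_reduce` only uses its first letter,
which equals `head g`. -/
theorem exists_word {g : B4} (hg : g ∈ positive) :
    ∃ L : List Simple, g = word L ∧ (nfHom g nfOne).1 = reduce 0 L := by
  induction hg using Submonoid.closure_induction_left with
  | one => exact ⟨[], rfl, by rw [map_one]; rfl⟩
  | mul_left a ha g _ ih =>
    obtain ⟨a, -, rfl⟩ := (mem_gens_iff _).1 ha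
    obtain ⟨L, hL, h⟩ := ih
    refine ⟨act a L, by rw [word_act, ← hL], ?_⟩
    rw [map_mul, nfHom_toB4, Equiv.Perm.mul_apply]
    change gact a (nfHom g nfOne).1 = _
    rw [h, gact_reduce, zpow_zero]; rfl

theorem word_mem_positive (L : List Simple) : word L ∈ positive := by
  induction L with
  | nil => exact positive.one_mem
  | cons s L ih => exact word_cons s L ▸ positive.mul_mem (toB4_mem_positive s) ih

/-- Divisibility in the germ. -/
def Simple.Dvd (s t : Simple) : Prop := ∃ u, mul s u = some t

instance : DecidableRel Simple.Dvd := fun s t => inferInstanceAs (Decidable (∃ u, mul s u = some t))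

theorem prefix_of_dvd_head {g : B4} (hg : g ∈ positive) {s : Simple} (h : s.Dvd (head g)) :
    Prefix s.toB4 g := by
  obtain ⟨L, rfl, hL⟩ := exists_word hg
  rw [head_of_reduce hL] at h
  obtain ⟨u, hu⟩ := h
  cases L with
  | nil =>
    have := (mul_eq_one s u hu).1
    subst this
    simp [Prefix, toB4]
  | cons r L =>
    rw [Prefix, word_cons, ← toB4_mul (m := r) hu, mul_assoc, inv_mul_cancel_left]
    exact positive.mul_mem (toB4_mem_positive _) (word_mem_positive L)

theorem dvd_head_toB4_mul {g : B4} (hg : g ∈ positive) (s : Simple) :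
    s.Dvd (head (s.toB4 * g)) := by
  obtain ⟨L, rfl, hL⟩ := exists_word hg
  have : (nfHom (s.toB4 * word L) nfOne).1 = reduce 0 (act s L) := by
    rw [map_mul, nfHom_toB4, Equiv.Perm.mul_apply]
    change gact s (nfHom (word L) nfOne).1 = _
    rw [hL, gact_reduce, zpow_zero]; rfl
  rw [head_of_reduce this]
  cases L with
  | nil =>
    by_cases h : s = one
    · subst h; exact ⟨one, rfl⟩
    · simp only [act, h, if_false, List.headD]; exact ⟨one, by cases s <;> rfl⟩
  | cons r L => exact ⟨_, mul_meet_compl s r⟩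

/-- With `prefix_of_dvd_head`, the simple prefixes of a positive braid are exactly the divisors in
the germ of its `head`. All questions about them become finite. -/
theorem dvd_head_of_prefix {g : B4} {s : Simple} (h : Prefix s.toB4 g) : s.Dvd (head g) := by
  have := dvd_head_toB4_mul h s
  rwa [mul_inv_cancel_left] at this

theorem head_toB4 (s : Simple) : head s.toB4 = s := by
  have h : (nfHom s.toB4 nfOne).1 = reduce 0 (act s []) := by
    rw [nfHom_toB4]; rfl
  rw [head_of_reduce h]
  by_cases h : s = one
  · subst h; rfl
  · simp [act, h]

theorem toB4_injective : Function.Injective toB4 := Function.LeftInverse.injective head_toB4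

theorem len_nonneg {g : B4} (hg : g ∈ positive) : 0 ≤ len g := by
  induction hg using Submonoid.closure_induction_left with
  | one => simp
  | mul_left a ha g _ ih =>
    obtain ⟨a, ha', rfl⟩ := (mem_gens_iff _).1 ha
    have : a.rank = 1 := ha'
    rw [len_mul, len_toB4]; omega

theorem exists_atom_prefix {g : B4} (hg : g ∈ positive) (h1 : g ≠ 1) :
    ∃ a : Simple, a.IsAtom ∧ Prefix a.toB4 g := by
  induction hg using Submonoid.closure_induction_left with
  | one => exact absurd rfl h1
  | mul_left a ha g hg _ =>
    obtain ⟨a, ha', rfl⟩ := (mem_gens_iff _).1 ha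
    exact ⟨a, ha', by rwa [Prefix, inv_mul_cancel_left]⟩

/-- A nontrivial positive braid starts with an atom, which contributes one to the exponent sum.
Antisymmetry of the prefix order rests on this. -/
theorem eq_one_of_len_eq_zero {g : B4} (hg : g ∈ positive) (h : len g = 0) : g = 1 := by
  by_contra h1
  obtain ⟨a, ha, hp⟩ := exists_atom_prefix hg h1
  have h2 := len_nonneg hp
  have h3 : a.rank = 1 := ha
  simp only [len_mul, len_inv, len_toB4] at h2
  omega

theorem eq_toB4_of_len_eq_one {g : B4} (hg : g ∈ positive) (h : len g = 1) :
    ∃ a : Simple, a.IsAtom ∧ g = a.toB4 := by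
  obtain ⟨a, ha, hp⟩ := exists_atom_prefix hg (by rintro rfl; simp at h)
  refine ⟨a, ha, ?_⟩
  have h3 : a.rank = 1 := ha
  have := eq_one_of_len_eq_zero hp (by simp; omega)
  exact (inv_mul_eq_one.1 this).symm

/-! ### The prefix order is a lattice order -/

/-- The braid group, ordered by the prefix order. -/
instance : PartialOrder B4 where
  le := Prefix
  le_refl x := by simp [Prefix]
  le_trans x y z h1 h2 := by
    have := positive.mul_mem h1 h2
    simpa [Prefix, mul_assoc] using this
  le_antisymm x y h1 h2 := by
    have h3 := len_nonneg h1
    have h4 := len_nonneg h2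
    simp only [len_mul, len_inv] at h3 h4
    exact inv_mul_eq_one.1 (eq_one_of_len_eq_zero h1 (by simp; omega))

theorem le_def {x y : B4} : x ≤ y ↔ x⁻¹ * y ∈ positive := Iff.rfl

theorem one_le_iff {x : B4} : 1 ≤ x ↔ x ∈ positive := by simp [le_def]

instance : MulLeftMono B4 := ⟨fun c x y h => by
  simpa [le_def, mul_assoc] using le_def.1 h⟩

theorem len_mono {x y : B4} (h : x ≤ y) : len x ≤ len y := by
  have := len_nonneg h
  simp only [len_mul, len_inv] at this
  omega

theorem eq_of_le_of_len {x y : B4} (h : x ≤ y) (hl : len y ≤ len x) : x = y :=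
  inv_mul_eq_one.1 (eq_one_of_len_eq_zero h (by have := len_mono h; simp; omega))

theorem Simple.atom_dvd_meet (a s t : Simple) (ha : a.IsAtom) (hs : a.Dvd s) (ht : a.Dvd t) :
    a.Dvd (meet s t) := by
  revert a s t; decide +kernel

theorem Simple.meet_dvd (s t : Simple) : (meet s t).Dvd s ∧ (meet s t).Dvd t := by
  revert s t; decide +kernel

theorem Simple.Dvd.le {s t : Simple} (h : s.Dvd t) : s.toB4 ≤ t.toB4 := by
  obtain ⟨u, hu⟩ := h
  rw [← toB4_mul hu, le_def, inv_mul_cancel_left]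
  exact toB4_mem_positive u

/-- A common prefix of two positive braids which is divisible by all their common atoms. -/
theorem exists_common {x y : B4} (hx : 1 ≤ x) (hy : 1 ≤ y) : ∃ d : B4, 1 ≤ d ∧ d ≤ x ∧ d ≤ y ∧
    ∀ a : Simple, a.IsAtom → a.toB4 ≤ x → a.toB4 ≤ y → a.toB4 ≤ d := by
  rw [one_le_iff] at hx hy
  have h := Simple.meet_dvd (head x) (head y)
  exact ⟨(Simple.meet (head x) (head y)).toB4, one_le_iff.2 (toB4_mem_positive _),
    prefix_of_dvd_head hx h.1, prefix_of_dvd_head hy h.2, fun a ha h1 h2 =>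
    (Simple.atom_dvd_meet a _ _ ha (dvd_head_of_prefix h1) (dvd_head_of_prefix h2)).le⟩

theorem exists_atom_le {x : B4} (hx : 1 ≤ x) (h1 : x ≠ 1) :
    ∃ a : Simple, a.IsAtom ∧ a.toB4 ≤ x := exists_atom_prefix (one_le_iff.1 hx) h1

theorem atom_one_le (a : Simple) : 1 ≤ a.toB4 := one_le_iff.2 (toB4_mem_positive a)

/-- Induction on the exponent sum. Let `d` be a common prefix containing all common atoms; if it is
nontrivial, the gcd is `d` times the gcd of the two quotients. Only the compatibility of atoms with
`d` is needed. -/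
theorem exists_isGLB_of_one_le (n : ℕ) : ∀ x y : B4, 1 ≤ x → 1 ≤ y → len x ≤ n →
    ∃ d, d ≤ x ∧ d ≤ y ∧ ∀ e, 1 ≤ e → e ≤ x → e ≤ y → e ≤ d := by
  induction n with
  | zero =>
    intro x y hx hy hn
    obtain rfl : 1 = x := eq_of_le_of_len hx (by simpa using hn)
    exact ⟨1, le_rfl, hy, fun e _ h _ => h⟩
  | succ n ih =>
    intro x y hx hy hn
    obtain ⟨d, hd, hdx, hdy, hatom⟩ := exists_common hx hy
    by_cases hd1 : d = 1
    · refine ⟨1, hx, hy, fun e he hex hey => ?_⟩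
      by_contra hne
      have hne' : e ≠ 1 := fun h => hne (h ▸ le_rfl)
      obtain ⟨a, ha, hae⟩ := exists_atom_le he hne'
      have h1 := len_mono (hatom a ha (hae.trans hex) (hae.trans hey))
      have h2 : a.rank = 1 := ha
      rw [hd1, len_toB4, len_one] at h1
      omega
    · have hdpos : 0 < len d := by
        have h0 := len_mono hd
        rw [len_one] at h0
        rcases h0.lt_or_eq with h | h
        · exact h
        · exact absurd (eq_of_le_of_len hd (by rw [len_one, ← h])).symm hd1
      have hx' : 1 ≤ d⁻¹ * x := one_le_iff.2 hdx
      have hy' : 1 ≤ d⁻¹ * y := one_le_iff.2 hdy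
      obtain ⟨g, hgx, hgy, hg⟩ := ih (d⁻¹ * x) (d⁻¹ * y) hx' hy' (by
        rw [len_mul, len_inv]; push_cast at hn; omega)
      refine ⟨d * g, ?_, ?_, fun e he hex hey => ?_⟩
      · simpa using mul_le_mul_right hgx d
      · simpa using mul_le_mul_right hgy d
      · by_cases he1 : e = 1
        · rw [he1]
          exact hd.trans (by simpa using mul_le_mul_right (hg 1 le_rfl hx' hy') d)
        obtain ⟨a, ha, hae⟩ := exists_atom_le he he1
        have hax := hae.trans hex
        have hay := hae.trans hey
        have had := hatom a ha hax hay
        have har : a.rank = 1 := ha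
        -- The gcd `k` after removing the first atom `a` of `e` dominates both `a⁻¹ d` and `a⁻¹ e`.
        -- Hence `d ≤ a k`, so `d⁻¹ a k` is a common prefix of the quotients by `d`, and `e ≤ a k ≤
        -- d g`.
        obtain ⟨k, hkx, hky, hk⟩ := ih (a.toB4⁻¹ * x) (a.toB4⁻¹ * y) (one_le_iff.2 hax)
          (one_le_iff.2 hay) (by rw [len_mul, len_inv, len_toB4]; push_cast at hn; omega)
        have h1 : a.toB4⁻¹ * d ≤ k := hk _ (one_le_iff.2 had) (mul_le_mul_right hdx _)
          (mul_le_mul_right hdy _)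
        have h2 : a.toB4⁻¹ * e ≤ k := hk _ (one_le_iff.2 hae) (mul_le_mul_right hex _)
          (mul_le_mul_right hey _)
        have h3 : d⁻¹ * a.toB4 * k ≤ g := by
          refine hg _ ?_ ?_ ?_
          · have := mul_le_mul_right h1 (d⁻¹ * a.toB4)
            simpa [mul_assoc] using this
          · have := mul_le_mul_right hkx (d⁻¹ * a.toB4)
            simpa [mul_assoc] using this
          · have := mul_le_mul_right hky (d⁻¹ * a.toB4)
            simpa [mul_assoc] using this
        calc e = a.toB4 * (a.toB4⁻¹ * e) := by simp
          _ ≤ a.toB4 * k := mul_le_mul_right h2 _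
          _ = d * (d⁻¹ * a.toB4 * k) := by simp [mul_assoc]
          _ ≤ d * g := mul_le_mul_right h3 _

theorem δ_inv_mul_mem {x : B4} (hx : x ∈ positive) : δ⁻¹ * x * δ ∈ positive := by
  obtain ⟨L, rfl, -⟩ := exists_word hx
  clear hx
  induction L with
  | nil => simp
  | cons s L ih =>
    have h : δ⁻¹ * s.toB4 * δ = (rot s).toB4 := by
      rw [mul_assoc, toB4_mul_δ, inv_mul_cancel_left]
    have : δ⁻¹ * word (s :: L) * δ = (δ⁻¹ * s.toB4 * δ) * (δ⁻¹ * word L * δ) := by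
      simp [mul_assoc]
    rw [this, h]
    exact positive.mul_mem (toB4_mem_positive _) ih

theorem δ_pow_four_comm (x : B4) : x * δ ^ 4 = δ ^ 4 * x := by
  let H : Subgroup B4 := Subgroup.centralizer {δ ^ 4}
  have hH : H = ⊤ := by
    rw [eq_top_iff, ← PresentedGroup.closure_range_of, Subgroup.closure_le]
    have key : ∀ s : Simple, s.toB4 ∈ H := by
      intro s
      rw [Subgroup.mem_centralizer_singleton_iff]
      have h := toB4_mul_δ_zpow s 4
      have h4 : (rotPerm ^ (4 : ℤ)) s = s := by cases s <;> rfl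
      rw [h4] at h
      exact_mod_cast h
    rintro _ ⟨i, rfl⟩
    fin_cases i
    exacts [key a12, key a23, key a34]
  have : x ∈ H := hH ▸ Subgroup.mem_top x
  exact Subgroup.mem_centralizer_singleton_iff.1 this

/-- Centrality of `δ ^ 4` reduces negative exponents to the residue of `k` modulo four. -/
theorem conj_δ_zpow_mem {x : B4} (hx : x ∈ positive) (k : ℤ) : δ ^ (-k) * x * δ ^ k ∈ positive := by
  have hnat : ∀ n : ℕ, ∀ y ∈ positive, δ ^ (-(n : ℤ)) * y * δ ^ (n : ℤ) ∈ positive := by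
    intro n
    induction n with
    | zero => simp
    | succ n ih =>
      intro y hy
      have := ih _ (δ_inv_mul_mem hy)
      convert this using 1
      push_cast
      rw [neg_add, zpow_add, add_comm (n : ℤ), zpow_add]
      simp [mul_assoc]
  have h4 : ∀ n : ℤ, δ ^ (-(4 * n)) * x * δ ^ (4 * n) = x := by
    intro n
    have hc : Commute x (δ ^ (4 : ℤ)) := by exact_mod_cast δ_pow_four_comm x
    have := (hc.zpow_right n).eq
    rw [← zpow_mul] at this
    rw [mul_assoc, this, ← mul_assoc, ← zpow_add]
    simp
  have hk : k = 4 * (k / 4) + ((k % 4).toNat : ℤ) := by omega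
  have := hnat (k % 4).toNat x hx
  rw [← h4 (k / 4)] at this
  convert this using 1
  conv_lhs => rw [hk]
  rw [neg_add, add_comm (-(4 * (k / 4))), zpow_add, zpow_add]
  simp [mul_assoc]

/-- The order is invariant under left translation, and under right multiplication by `δ ^ k` because
conjugation by `δ` preserves positivity. -/
theorem mul_δ_zpow_le_iff {x y : B4} (k : ℤ) : x * δ ^ k ≤ y * δ ^ k ↔ x ≤ y := by
  have key : ∀ (k : ℤ) {x y : B4}, x ≤ y → x * δ ^ k ≤ y * δ ^ k := by
    intro k x y h
    have := conj_δ_zpow_mem h k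
    rw [le_def]
    convert this using 1
    simp [mul_assoc]
  refine ⟨fun h => ?_, key k⟩
  have := key (-k) h
  simpa [mul_assoc] using this

theorem le_mul_of_one_le {x p : B4} (h : 1 ≤ p) : x ≤ x * p := by
  simpa using mul_le_mul_right h x

theorem one_le_δ : 1 ≤ δ := atom_one_le delta

theorem δ_zpow_mono {j k : ℤ} (h : j ≤ k) : δ ^ j ≤ δ ^ k := by
  obtain ⟨n, rfl⟩ := Int.le.dest h
  rw [zpow_add]
  refine le_mul_of_one_le ?_
  rw [zpow_natCast]
  induction n with
  | zero => simp
  | succ n ih => rw [pow_succ]; exact (ih (by omega)).trans (le_mul_of_one_le one_le_δ)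

theorem mul_δ_zpow_mono (x : B4) {j k : ℤ} (h : j ≤ k) : x * δ ^ j ≤ x * δ ^ k :=
  mul_le_mul_right (δ_zpow_mono h) x

theorem exists_δ_zpow_le (x : B4) : ∃ k : ℕ, δ ^ (-(k : ℤ)) ≤ x := by
  have hadd : ∀ {x y : B4} {j k : ℕ}, δ ^ (-(j : ℤ)) ≤ x → δ ^ (-(k : ℤ)) ≤ y →
      δ ^ (-((j + k : ℕ) : ℤ)) ≤ x * y := by
    intro x y j k hx hy
    have h1 := (mul_δ_zpow_le_iff (-(k : ℤ))).2 hx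
    have h2 := mul_le_mul_right hy x
    push_cast
    rw [neg_add, zpow_add]
    exact h1.trans h2
  let H : Submonoid B4 :=
    { carrier := {x | ∃ k : ℕ, δ ^ (-(k : ℤ)) ≤ x}
      one_mem' := ⟨0, by simp⟩
      mul_mem' := by
        rintro a b ⟨j, hj⟩ ⟨k, hk⟩
        exact ⟨_, hadd hj hk⟩ }
  let S : Set B4 := Set.range PresentedGroup.of
  have hS : Subgroup.closure S = ⊤ := PresentedGroup.closure_range_of _
  have hx : x ∈ (Subgroup.closure S).toSubmonoid := by rw [hS]; trivial
  rw [Subgroup.closure_toSubmonoid] at hx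
  have hle : Submonoid.closure (S ∪ S⁻¹) ≤ H := by
    rw [Submonoid.closure_le]
    have key : ∀ s : Simple, s.toB4 ∈ H ∧ s.toB4⁻¹ ∈ H := by
      intro s
      refine ⟨⟨0, by simpa using atom_one_le s⟩, ⟨1, ?_⟩⟩
      obtain ⟨t, ht⟩ := exists_mul_eq_delta s
      have h1 : t.toB4 * s.toB4 = δ := toB4_mul ht
      have : s.toB4⁻¹ = δ⁻¹ * t.toB4 := by
        rw [← h1]; simp
      rw [this]
      simpa using le_mul_of_one_le (x := δ⁻¹) (atom_one_le t)
    rintro y (⟨i, rfl⟩ | ⟨i, hi⟩)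
    · fin_cases i
      exacts [(key a12).1, (key a23).1, (key a34).1]
    · rw [← inv_inv y, ← hi]
      fin_cases i
      exacts [(key a12).2, (key a23).2, (key a34).2]
  exact hle hx

theorem exists_isGLB (x y : B4) : ∃ d, d ≤ x ∧ d ≤ y ∧ ∀ e, e ≤ x → e ≤ y → e ≤ d := by
  have hlow : ∀ x : B4, ∃ k : ℕ, ∀ n : ℕ, k ≤ n → δ ^ (-(n : ℤ)) ≤ x := by
    intro x
    obtain ⟨k, hk⟩ := exists_δ_zpow_le x
    exact ⟨k, fun n hn => (δ_zpow_mono (by omega)).trans hk⟩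
  obtain ⟨k₁, h₁⟩ := hlow x
  obtain ⟨k₂, h₂⟩ := hlow y
  -- Translation by `δ ^ N` moves everything above `δ ^ (-N)` into the positive range. The candidate
  -- found is so far greatest only among common prefixes above `δ ^ (-N)`.
  have glb : ∀ N : ℕ, k₁ ≤ N → k₂ ≤ N → ∃ d, δ ^ (-(N : ℤ)) ≤ d ∧ d ≤ x ∧ d ≤ y ∧
      ∀ e, δ ^ (-(N : ℤ)) ≤ e → e ≤ x → e ≤ y → e ≤ d := by
    intro N hN₁ hN₂
    have tr : ∀ z : B4, δ ^ (-(N : ℤ)) ≤ z ↔ 1 ≤ δ ^ (N : ℤ) * z := by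
      intro z
      rw [← mul_le_mul_iff_left (δ ^ (N : ℤ))]
      simp
    have tr' : ∀ z w : B4, δ ^ (N : ℤ) * z ≤ w ↔ z ≤ δ ^ (-(N : ℤ)) * w := by
      intro z w
      rw [← mul_le_mul_iff_left (δ ^ (-(N : ℤ)))]
      simp
    obtain ⟨d, hdx, hdy, hd⟩ := exists_isGLB_of_one_le (len (δ ^ (N : ℤ) * x)).toNat
      (δ ^ (N : ℤ) * x) (δ ^ (N : ℤ) * y) ((tr x).1 (h₁ N hN₁)) ((tr y).1 (h₂ N hN₂))
      (Int.self_le_toNat _)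
    have h1d := hd 1 le_rfl ((tr x).1 (h₁ N hN₁)) ((tr y).1 (h₂ N hN₂))
    refine ⟨δ ^ (-(N : ℤ)) * d, ?_, ?_, ?_, fun e he hex hey => ?_⟩
    · exact le_mul_of_one_le h1d
    · rw [← mul_le_mul_iff_left (δ ^ (N : ℤ))]; simpa using hdx
    · rw [← mul_le_mul_iff_left (δ ^ (N : ℤ))]; simpa using hdy
    · exact (tr' _ _).1 (hd _ ((tr e).1 he) (mul_le_mul_right hex _) (mul_le_mul_right hey _))
  obtain ⟨d, -, hdx, hdy, hd⟩ := glb (max k₁ k₂) (le_max_left _ _) (le_max_right _ _)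
  refine ⟨d, hdx, hdy, fun e hex hey => ?_⟩
  obtain ⟨k₃, h₃⟩ := hlow e
  -- If `e` lies below the first bound, compare it with the gcd `d'` for a larger bound. That `d'`
  -- still lies above the first bound, hence below `d`.
  obtain ⟨d', hd'0, hdx', hdy', hd'⟩ := glb (max k₃ (max k₁ k₂)) (by simp) (by simp)
  have h1 : e ≤ d' := hd' e (h₃ _ (le_max_left _ _)) hex hey
  exact h1.trans (hd _ (hd' _ (δ_zpow_mono (by simp)) (h₁ _ (le_max_left _ _))
    (h₂ _ (le_max_right _ _))) hdx' hdy')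

noncomputable instance : SemilatticeInf B4 where
  inf x y := (exists_isGLB x y).choose
  inf_le_left x y := (exists_isGLB x y).choose_spec.1
  inf_le_right x y := (exists_isGLB x y).choose_spec.2.1
  le_inf _ _ _ h h' := (exists_isGLB _ _).choose_spec.2.2 _ h h'

theorem isGcd_iff {d x y : B4} : IsGcd d x y ↔ d = x ⊓ y := by
  change (d ≤ x ∧ d ≤ y ∧ ∀ e, e ≤ x → e ≤ y → e ≤ d) ↔ _
  constructor
  · rintro ⟨h1, h2, h3⟩
    exact le_antisymm (le_inf h1 h2) (h3 _ inf_le_left inf_le_right)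
  · rintro rfl
    exact ⟨inf_le_left, inf_le_right, fun e h h' => le_inf h h'⟩

theorem meet_eq (x y : B4) : BKL4.meet x y = x ⊓ y :=
  isGcd_iff.1 (Classical.epsilon_spec (p := fun d => IsGcd d x y) ⟨x ⊓ y, isGcd_iff.2 rfl⟩)

theorem mul_inf (c x y : B4) : c * (x ⊓ y) = c * x ⊓ c * y := by
  refine le_antisymm (le_inf (mul_le_mul_right inf_le_left c) (mul_le_mul_right inf_le_right c)) ?_
  rw [← mul_le_mul_iff_left c⁻¹, inv_mul_cancel_left]
  refine le_inf ?_ ?_ <;> rw [← mul_le_mul_iff_left c, mul_inv_cancel_left]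
  exacts [inf_le_left, inf_le_right]

theorem inf_mul_δ_zpow (x y : B4) (k : ℤ) : (x ⊓ y) * δ ^ k = x * δ ^ k ⊓ y * δ ^ k := by
  refine le_antisymm (le_inf ((mul_δ_zpow_le_iff k).2 inf_le_left)
    ((mul_δ_zpow_le_iff k).2 inf_le_right)) ?_
  rw [← mul_δ_zpow_le_iff (-k), mul_assoc, ← zpow_add, add_neg_cancel, zpow_zero, mul_one]
  refine le_inf ?_ ?_ <;>
    rw [← mul_δ_zpow_le_iff k, mul_assoc, ← zpow_add, neg_add_cancel, zpow_zero, mul_one]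
  exacts [inf_le_left, inf_le_right]

end BKL4

/-! ### Left normal forms in the braid group -/

namespace BKL4

theorem leftWeighted_iff {s t : B4} : LeftWeighted s t ↔ s⁻¹ * δ ⊓ t = 1 := by
  rw [LeftWeighted, isGcd_iff, eq_comm]; rfl

theorem isSimple_iff {s : B4} : IsSimple s ↔ 1 ≤ s ∧ s ≤ δ := Iff.rfl

theorem IsSimple.one_le {s : B4} (h : IsSimple s) : 1 ≤ s := h.1

theorem IsSimple.le_δ {s : B4} (h : IsSimple s) : s ≤ δ := h.2

theorem conjBy_mul (x a b : B4) : conjBy x (a * b) = conjBy (conjBy x a) b := by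
  simp [conjBy, mul_assoc]

@[simp] theorem conjBy_one (x : B4) : conjBy x 1 = x := by simp [conjBy]

@[simp] theorem len_conjBy (x a : B4) : len (conjBy x a) = len x := by simp [conjBy]

theorem len_pos {x : B4} (h : 1 ≤ x) (h1 : x ≠ 1) : 0 < len x := by
  have h0 := len_mono h
  rw [len_one] at h0
  rcases h0.lt_or_eq with h' | h'
  · exact h'
  · exact absurd (eq_of_le_of_len h (by rw [len_one, ← h'])).symm h1

theorem inf_δ_ne_one {x : B4} (h : 1 ≤ x) (h1 : x ≠ 1) : x ⊓ δ ≠ 1 := by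
  obtain ⟨a, ha, hax⟩ := exists_atom_le h h1
  intro h2
  have h3 : a.toB4 ≤ x ⊓ δ :=
    le_inf hax (Simple.Dvd.le (t := .delta) ⟨_, Simple.mul_compl a⟩)
  have h4 := len_mono h3
  have h5 : a.rank = 1 := ha
  rw [h2, len_one, len_toB4] at h4
  omega

theorem eq_one_of_inf_δ {x : B4} (h : 1 ≤ x) (h1 : x ⊓ δ = 1) : x = 1 := by
  by_contra h2
  exact inf_δ_ne_one h h2 h1

/-- Since `s⁻¹ δ ≤ δ`, only the first factor of the remaining product can meet the complement of
`s`, and left-weightedness says that this meet is trivial. -/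
theorem prod_inf_δ {s : B4} {L : List B4} (hs : ∀ t ∈ s :: L, IsSimple t)
    (hL : (s :: L).IsChain LeftWeighted) : (s :: L).prod ⊓ δ = s := by
  induction L generalizing s with
  | nil => simpa using (hs s (by simp)).le_δ
  | cons t L ih =>
    rw [List.isChain_cons_cons, leftWeighted_iff] at hL
    have h := ih (fun u hu => hs u (List.mem_cons_of_mem _ hu)) hL.2
    have hle : s⁻¹ * δ ≤ δ := by
      have := (mul_δ_zpow_le_iff 1).2 (mul_le_mul_right (hs s (by simp)).one_le s⁻¹)
      simpa using this
    calc (s :: t :: L).prod ⊓ δ = s * ((t :: L).prod ⊓ s⁻¹ * δ) := by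
          rw [mul_inf, mul_inv_cancel_left, List.prod_cons (a := s)]
      _ = s * ((t :: L).prod ⊓ δ ⊓ s⁻¹ * δ) := by rw [inf_assoc, inf_eq_right.2 hle]
      _ = s := by rw [h, inf_comm, hL.1, mul_one]

theorem one_le_prod {L : List B4} (hs : ∀ t ∈ L, IsSimple t) : 1 ≤ L.prod := by
  induction L with
  | nil => simp
  | cons s L ih =>
    rw [List.prod_cons]
    exact (hs s (by simp)).one_le.trans
      (le_mul_of_one_le (ih fun t ht => hs t (List.mem_cons_of_mem _ ht)))

theorem prod_le_δ_pow {L : List B4} (hs : ∀ t ∈ L, IsSimple t) :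
    L.prod ≤ δ ^ (L.length : ℤ) := by
  induction L with
  | nil => simp
  | cons s L ih =>
    rw [List.prod_cons, List.length_cons]
    push_cast
    rw [add_comm, zpow_add, zpow_one]
    exact (mul_le_mul_right (ih fun t ht => hs t (List.mem_cons_of_mem _ ht)) s).trans
      ((mul_δ_zpow_le_iff _).2 (hs s (by simp)).2)

/-- The mirror image of `prod_inf_δ`: passing to `x⁻¹ δ ^ n` exchanges the two ends of the word, so
the complement of the last factor becomes the first simple prefix. -/
theorem inv_prod_mul_δ_inf {L : List B4} {b : B4} (hs : ∀ t ∈ L ++ [b], IsSimple t)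
    (hL : (L ++ [b]).IsChain LeftWeighted) :
    (L ++ [b]).prod⁻¹ * δ ^ ((L ++ [b]).length : ℤ) ⊓ δ = b⁻¹ * δ := by
  induction L using List.reverseRecOn generalizing b with
  | nil =>
    have : b⁻¹ * δ ≤ δ := by
      have := (mul_δ_zpow_le_iff 1).2 (mul_le_mul_right (hs b (by simp)).one_le b⁻¹)
      simpa using this
    simpa using this
  | append_singleton L a ih =>
    have hs' : ∀ t ∈ L ++ [a], IsSimple t := fun t ht => hs t (List.mem_append_left _ ht)
    have hab : a⁻¹ * δ ⊓ b = 1 := by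
      rw [List.append_assoc, List.cons_append, List.nil_append,
        List.isChain_append_cons_cons] at hL
      exact leftWeighted_iff.1 hL.2.1
    have h := ih hs' hL.left_of_append
    have hb : b ≤ δ := (hs b (by simp)).2
    set Z := (L ++ [a]).prod⁻¹ * δ ^ ((L ++ [a]).length : ℤ) with hZ
    calc (L ++ [a] ++ [b]).prod⁻¹ * δ ^ ((L ++ [a] ++ [b]).length : ℤ) ⊓ δ
        = b⁻¹ * Z * δ ^ (1 : ℤ) ⊓ b⁻¹ * b * δ ^ (1 : ℤ) := by
          rw [List.prod_append (l₁ := L ++ [a]), List.length_append (as := L ++ [a]), hZ]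
          push_cast
          rw [zpow_add]
          simp [mul_assoc]
      _ = b⁻¹ * (Z ⊓ (δ ⊓ b)) * δ := by
          rw [← inf_mul_δ_zpow, ← mul_inf, zpow_one, inf_eq_right.2 hb]
      _ = b⁻¹ * δ := by rw [← inf_assoc, h, hab, mul_one]

/-- Greedy factorization: split off `x ⊓ δ`, which is nontrivial, so the exponent sum drops. -/
theorem exists_factors (n : ℕ) : ∀ x : B4, 1 ≤ x → len x ≤ n → ∃ L : List B4, x = L.prod ∧
    (∀ s ∈ L, IsSimple s ∧ s ≠ 1) ∧ L.IsChain LeftWeighted := by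
  induction n with
  | zero =>
    intro x hx hn
    exact ⟨[], (eq_of_le_of_len hx (by simpa using hn)).symm, by simp, List.isChain_nil⟩
  | succ n ih =>
    intro x hx hn
    by_cases h1 : x = 1
    · exact ⟨[], h1, by simp, List.isChain_nil⟩
    have hs1 : 1 ≤ x ⊓ δ := le_inf hx one_le_δ
    have hne := inf_δ_ne_one hx h1
    have hpos := len_pos hs1 hne
    obtain ⟨L, hL, hs, hc⟩ := ih ((x ⊓ δ)⁻¹ * x)
      (by rw [← inv_mul_cancel (x ⊓ δ)]; exact mul_le_mul_right inf_le_left _)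
      (by rw [len_mul, len_inv]; push_cast at hn; omega)
    refine ⟨(x ⊓ δ) :: L, by rw [List.prod_cons, ← hL, mul_inv_cancel_left], ?_, ?_⟩
    · intro s hs'
      rcases List.mem_cons.1 hs' with rfl | hs'
      · exact ⟨isSimple_iff.2 ⟨hs1, inf_le_right⟩, hne⟩
      · exact hs s hs'
    · cases L with
      | nil => exact List.isChain_singleton _
      | cons t L =>
        rw [List.isChain_cons_cons]
        refine ⟨leftWeighted_iff.2 (le_antisymm ?_ (le_inf ?_ (hs t (by simp)).1.1)), hc⟩
        · have h2 : t ≤ (x ⊓ δ)⁻¹ * x := by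
            rw [hL, List.prod_cons]
            exact le_mul_of_one_le (one_le_prod fun u hu => (hs u (List.mem_cons_of_mem _ hu)).1)
          calc (x ⊓ δ)⁻¹ * δ ⊓ t ≤ (x ⊓ δ)⁻¹ * δ ⊓ (x ⊓ δ)⁻¹ * x := inf_le_inf_left _ h2
            _ = 1 := by rw [← mul_inf, inf_comm, inv_mul_cancel]
        · rw [← inv_mul_cancel (x ⊓ δ)]; exact mul_le_mul_right inf_le_right _

theorem δ_zpow_le_δ_zpow {j k : ℤ} : δ ^ j ≤ δ ^ k ↔ j ≤ k :=
  ⟨fun h => by have := len_mono h; simp at this; omega, δ_zpow_mono⟩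

theorem exists_isNormalForm (x : B4) : ∃ q : ℤ × List B4, IsNormalForm x q.1 q.2 := by
  obtain ⟨k, hk⟩ := exists_δ_zpow_le x
  obtain ⟨p, hp, hmax⟩ := Int.exists_greatest_of_bdd (P := fun k : ℤ => δ ^ k ≤ x)
    ⟨(len x).natAbs, fun z hz => by
      have h1 := len_mono hz
      simp at h1
      omega⟩ ⟨_, hk⟩
  obtain ⟨L, hL, hs, hc⟩ := exists_factors (len (δ ^ (-p) * x)).toNat (δ ^ (-p) * x)
    (by have := mul_le_mul_right hp (δ ^ (-p)); simpa using this) (Int.self_le_toNat _)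
  refine ⟨(p, L), ⟨?_, ⟨hp, fun k hk => hmax k hk⟩, fun s h => (hs s h).1, fun h =>
    (hs _ (List.getLast_mem h)).2, hc⟩⟩
  rw [← hL]; simp

end BKL4

/-! ### Infimum, supremum and the two end factors as lattice data -/

namespace BKL4

theorem isNormalForm (x : B4) : IsNormalForm x (infimum x) (factors x) :=
  Classical.epsilon_spec (p := fun q : ℤ × List B4 => IsNormalForm x q.1 q.2)
    (exists_isNormalForm x)

theorem δ_zpow_le_iff {x : B4} {k : ℤ} : δ ^ k ≤ x ↔ k ≤ infimum x :=
  ⟨fun h => (isNormalForm x).greatest.2 h,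
    fun h => (δ_zpow_mono h).trans (isNormalForm x).greatest.1⟩

/-- The supremum, i.e. the least `k` with `x ≼ δ ^ k`. -/
noncomputable def supremum (x : B4) : ℤ := infimum x + canonicalLength x

theorem eq_append_of_pos {x : B4} (h : 1 ≤ canonicalLength x) :
    ∃ L, factors x = L ++ [finalFactor x] := by
  have hne : factors x ≠ [] := fun h0 => by simp [canonicalLength, h0] at h
  refine ⟨(factors x).dropLast, ?_⟩
  rw [finalFactor, List.getLastD_eq_getLast?, List.getLast?_eq_some_getLast hne]
  exact (List.dropLast_append_getLast hne).symm

theorem inv_mul_δ_inf_of_list {x : B4} {p : ℤ} {L : List B4} {b : B4}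
    (hx : x = δ ^ p * (L ++ [b]).prod) (hs : ∀ t ∈ L ++ [b], IsSimple t)
    (hL : (L ++ [b]).IsChain LeftWeighted) :
    x⁻¹ * δ ^ (p + ((L ++ [b]).length : ℤ)) ⊓ δ = b⁻¹ * δ := by
  rw [← inv_prod_mul_δ_inf hs hL, hx, zpow_add]
  simp [mul_assoc]

theorem rightComplement_finalFactor {x : B4} (h : 1 ≤ canonicalLength x) :
    rightComplement (finalFactor x) = x⁻¹ * δ ^ supremum x ⊓ δ := by
  obtain ⟨L, hL⟩ := eq_append_of_pos h
  have hn := isNormalForm x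
  rw [hL] at hn
  rw [rightComplement, ← inv_mul_δ_inf_of_list hn.eq_prod hn.simple hn.leftWeighted, supremum,
    canonicalLength, hL]

theorem finalFactor_ne_one {x : B4} (h : 1 ≤ canonicalLength x) : finalFactor x ≠ 1 := by
  obtain ⟨L, hL⟩ := eq_append_of_pos h
  have hn := (isNormalForm x).last_ne_one
  rw [hL] at hn
  simpa using hn (by simp)

theorem initialFactor_eq {x : B4} (h : 1 ≤ canonicalLength x) :
    initialFactor x = x * δ ^ (-infimum x) ⊓ δ := by
  have hn := isNormalForm x
  rw [initialFactor]
  cases hL : factors x with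
  | nil => simp [canonicalLength, hL] at h
  | cons s L =>
    rw [hL] at hn
    have h1 : s = (s :: L).prod ⊓ δ := (prod_inf_δ hn.simple hn.leftWeighted).symm
    have h2 : ∀ k : ℤ, (τ ^ k) s = δ ^ (-k) * s * δ ^ k := by
      intro k
      rw [τ, ← map_zpow, MulAut.conj_apply]
      simp
    rw [List.headD_cons, h2, neg_neg]
    nth_rw 1 [h1]
    nth_rw 3 [hn.eq_prod]
    rw [mul_inf, inf_mul_δ_zpow]
    congr 1
    rw [mul_assoc, ← zpow_one_add, ← zpow_add]
    simp

/-- A smaller upper bound would give `δ ≤ x⁻¹ δ ^ supremum x`. The complement of the final factor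
would then be all of `δ`, making that factor trivial. -/
theorem le_δ_zpow_iff {x : B4} {k : ℤ} : x ≤ δ ^ k ↔ supremum x ≤ k := by
  have hn := isNormalForm x
  have hle : x ≤ δ ^ supremum x := by
    nth_rw 1 [hn.eq_prod]
    rw [supremum, zpow_add]
    exact mul_le_mul_right (prod_le_δ_pow hn.simple) _
  refine ⟨fun h => ?_, fun h => hle.trans (δ_zpow_mono h)⟩
  by_cases h0 : 1 ≤ canonicalLength x
  · by_contra hk
    have h1 : x ≤ δ ^ (supremum x - 1) := h.trans (δ_zpow_mono (by omega))
    have h2 : δ ≤ x⁻¹ * δ ^ supremum x := by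
      have h3 := mul_le_mul_right ((mul_δ_zpow_le_iff 1).2 h1) x⁻¹
      rw [← zpow_add, sub_add_cancel] at h3
      simpa using h3
    have h4 := rightComplement_finalFactor h0
    rw [inf_eq_right.2 h2, rightComplement] at h4
    exact finalFactor_ne_one h0 (by simpa using h4)
  · have h1 : canonicalLength x = 0 := by omega
    have h2 : factors x = [] := List.length_eq_zero_iff.1 h1
    have h3 := hn.eq_prod
    rw [h2, List.prod_nil, mul_one] at h3
    rw [h3, δ_zpow_le_δ_zpow] at h
    simpa [supremum, h1] using h

theorem three_mul_infimum_le (x : B4) : 3 * infimum x ≤ len x := by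
  have := len_mono (δ_zpow_le_iff.2 (le_refl (infimum x)))
  simp at this; omega

theorem len_le_three_mul_supremum (x : B4) : len x ≤ 3 * supremum x := by
  have := len_mono (le_δ_zpow_iff.2 (le_refl (supremum x)))
  simp at this; omega

/-- Equality would force `x = δ ^ infimum x`. The strict bounds are expressed through `len` because
it is invariant under conjugation. -/
theorem three_mul_infimum_lt {x : B4} (h : 1 ≤ canonicalLength x) : 3 * infimum x < len x := by
  rcases (three_mul_infimum_le x).lt_or_eq with h1 | h1
  · exact h1
  · have h2 := eq_of_le_of_len (δ_zpow_le_iff.2 (le_refl (infimum x))) (by simp; omega)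
    have h3 : supremum x ≤ infimum x := le_δ_zpow_iff.1 h2.symm.le
    simp only [supremum] at h3
    omega

theorem len_lt_three_mul_supremum {x : B4} (h : 1 ≤ canonicalLength x) :
    len x < 3 * supremum x := by
  rcases (len_le_three_mul_supremum x).lt_or_eq with h1 | h1
  · exact h1
  · have h2 := eq_of_le_of_len (le_δ_zpow_iff.2 (le_refl (supremum x))) (by simp; omega)
    have h3 : supremum x ≤ infimum x := δ_zpow_le_iff.1 h2.symm.le
    simp only [supremum] at h3
    omega

/-! ### Operators on the lattice attached to a braid -/

/-- The operator `g ↦ y g δ ^ k ⊓ g`; cycling and decycling are of this form up to a power of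
`δ`. -/
noncomputable def pull (y : B4) (k : ℤ) (g : B4) : B4 := y * g * δ ^ k ⊓ g

theorem pull_le (y : B4) (k : ℤ) (g : B4) : pull y k g ≤ g := inf_le_right

theorem pull_mono (y : B4) (k : ℤ) : Monotone (pull y k) := fun _ _ h =>
  inf_le_inf ((mul_δ_zpow_le_iff k).2 (mul_le_mul_right h y)) h

theorem pull_inf (y : B4) (k : ℤ) (g h : B4) : pull y k (g ⊓ h) = pull y k g ⊓ pull y k h := by
  simp only [pull, mul_inf, inf_mul_δ_zpow]
  rw [inf_inf_inf_comm]

theorem pull_mul_δ_zpow (y : B4) (k j : ℤ) (g : B4) : pull y k (g * δ ^ j) = pull y k g * δ ^ j := by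
  simp only [pull, inf_mul_δ_zpow]
  congr 1
  simp only [mul_assoc, ← zpow_add, add_comm]

theorem pull_conjBy (y g : B4) (k : ℤ) (h : B4) : g * pull (conjBy y g) k h = pull y k (g * h) := by
  simp [pull, conjBy, mul_inf, mul_assoc]

theorem pull_inv_pull (y : B4) (k l : ℤ) (g : B4) :
    pull y⁻¹ l (pull y k g) =
      g * δ ^ (k + l) ⊓ g ⊓ (y * g * δ ^ k ⊓ y⁻¹ * g * δ ^ l) := by
  simp only [pull, mul_inf, inf_mul_δ_zpow, mul_assoc, inv_mul_cancel_left, ← zpow_add]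
  generalize y * (g * δ ^ k) = a, g * δ ^ (k + l) = b, y⁻¹ * (g * δ ^ l) = c
  ac_rfl

theorem pull_pull_inv (y : B4) (k l : ℤ) (g : B4) :
    pull y k (pull y⁻¹ l g) =
      g * δ ^ (k + l) ⊓ g ⊓ (y * g * δ ^ k ⊓ y⁻¹ * g * δ ^ l) := by
  simp only [pull, mul_inf, inf_mul_δ_zpow, mul_assoc, mul_inv_cancel_left, ← zpow_add,
    add_comm l k]
  generalize y * (g * δ ^ k) = a, g * δ ^ (k + l) = b, y⁻¹ * (g * δ ^ l) = c
  ac_rfl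

/-- Both composites equal the same meet of four terms. -/
theorem pull_commute (y : B4) (k l : ℤ) : Function.Commute (pull y⁻¹ l) (pull y k) := fun g => by
  rw [pull_inv_pull, pull_pull_inv]

/-- This turns a lower bound on a conjugate into a fixed-point condition on the conjugator; applied
to `y⁻¹` it gives upper bounds. Meets of conjugators then inherit the bounds. -/
theorem pull_eq_self_iff {y g : B4} {k : ℤ} : pull y k g = g ↔ δ ^ (-k) ≤ conjBy y g := by
  rw [pull, inf_eq_right, ← mul_le_mul_iff_left g⁻¹, ← mul_δ_zpow_le_iff (-k)]
  simp [conjBy, mul_assoc]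

theorem conjBy_inv (y g : B4) : conjBy y⁻¹ g = (conjBy y g)⁻¹ := by simp [conjBy, mul_assoc]

theorem pull_inv_eq_self_iff {y g : B4} {k : ℤ} : pull y⁻¹ k g = g ↔ conjBy y g ≤ δ ^ k := by
  rw [pull_eq_self_iff, conjBy_inv, ← mul_le_mul_iff_left (conjBy y g), ← mul_δ_zpow_le_iff k]
  simp [mul_assoc]

/-- The operator describing cyclic sliding, up to a power of `δ`. -/
noncomputable def slide (y : B4) (p s : ℤ) (g : B4) : B4 :=
  y * g * δ ^ (-p - 1) ⊓ y⁻¹ * g * δ ^ (s - 1) ⊓ g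

theorem slide_eq_inf (y : B4) (p s : ℤ) (g : B4) :
    slide y p s g = pull y (-p - 1) g ⊓ pull y⁻¹ (s - 1) g := by
  rw [slide, pull, pull, inf_inf_inf_comm, inf_idem]

theorem slide_mono (y : B4) (p s : ℤ) : Monotone (slide y p s) := fun g h hgh => by
  rw [slide_eq_inf, slide_eq_inf]
  exact inf_le_inf (pull_mono _ _ hgh) (pull_mono _ _ hgh)

theorem slide_mul_δ_zpow (y : B4) (p s j : ℤ) (g : B4) :
    slide y p s (g * δ ^ j) = slide y p s g * δ ^ j := by
  simp only [slide_eq_inf, pull_mul_δ_zpow, inf_mul_δ_zpow]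

theorem slide_inf (y : B4) (p s : ℤ) (g h : B4) :
    slide y p s (g ⊓ h) = slide y p s g ⊓ slide y p s h := by
  simp only [slide_eq_inf, pull_inf]
  rw [inf_inf_inf_comm]

theorem slide_conjBy (y g : B4) (p s : ℤ) (h : B4) :
    g * slide (conjBy y g) p s h = slide y p s (g * h) := by
  rw [slide_eq_inf, slide_eq_inf, mul_inf, pull_conjBy, ← conjBy_inv, pull_conjBy]

/-- The composite has one further term `g * δ ^ (s - p - 2)`, which lies above `g` when `p + 2 ≤ s`.
-/
theorem slide_eq_pull_pull {y : B4} {p s : ℤ} (h : p + 2 ≤ s) (g : B4) :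
    slide y p s g = pull y⁻¹ (s - 1) (pull y (-p - 1) g) := by
  have h1 : g ≤ g * δ ^ (-p - 1 + (s - 1)) := by
    simpa using mul_δ_zpow_mono g (show 0 ≤ -p - 1 + (s - 1) by omega)
  rw [pull_inv_pull, inf_eq_right.2 h1, slide, inf_comm]

theorem pull_slide_commute (y : B4) (p s k : ℤ) :
    Function.Commute (pull y k) (slide y p s) := fun g => by
  simp only [slide, pull, mul_inf, inf_mul_δ_zpow, mul_assoc, inv_mul_cancel_left,
    mul_inv_cancel_left, ← zpow_add, add_comm k]
  ac_rfl

theorem pull_inv_slide_commute (y : B4) (p s k : ℤ) :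
    Function.Commute (pull y⁻¹ k) (slide y p s) := fun g => by
  simp only [slide, pull, mul_inf, inf_mul_δ_zpow, mul_assoc, inv_mul_cancel_left,
    mul_inv_cancel_left, ← zpow_add, add_comm k]
  ac_rfl

theorem preferredPrefix_eq {x : B4} (h : 1 ≤ canonicalLength x) :
    preferredPrefix x = slide x (infimum x) (supremum x) 1 * δ := by
  rw [preferredPrefix, meet_eq, initialFactor_eq h, rightComplement_finalFactor h]
  have h1 : slide x (infimum x) (supremum x) 1 * δ ^ (1 : ℤ) =
      x * δ ^ (-infimum x) ⊓ x⁻¹ * δ ^ supremum x ⊓ δ := by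
    rw [slide, inf_mul_δ_zpow, inf_mul_δ_zpow, mul_one, mul_one, mul_assoc, mul_assoc,
      ← zpow_add, ← zpow_add, sub_add_cancel, sub_add_cancel, one_mul, zpow_one]
  rw [zpow_one] at h1
  rw [h1, inf_inf_inf_comm, inf_idem]

end BKL4

namespace BKL4

/-! ### Sliding circuits of a rigid braid -/

/-- An increasing sequence which is bounded above stabilizes. -/
theorem exists_stable {a : ℕ → B4} {c : B4} (h : ∀ n, a n ≤ a (n + 1)) (hc : ∀ n, a n ≤ c) :
    ∃ n, a (n + 1) = a n := by
  by_contra hne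
  push Not at hne
  have h1 : ∀ n, len (a n) + 1 ≤ len (a (n + 1)) := by
    intro n
    have := len_mono (h n)
    rcases this.lt_or_eq with h' | h'
    · omega
    · exact absurd (eq_of_le_of_len (h n) h'.symm.le).symm (hne n)
  have h2 : ∀ n : ℕ, len (a 0) + n ≤ len (a n) := by
    intro n
    induction n with
    | zero => simp
    | succ n ih => have := h1 n; push_cast; omega
  have h3 := h2 (len c - len (a 0) + 1).toNat
  have h4 := len_mono (hc (len c - len (a 0) + 1).toNat)
  have h5 := len_mono (hc 0)
  omega

/-- A decreasing sequence which is bounded below stabilizes. -/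
theorem exists_stable' {a : ℕ → B4} {c : B4} (h : ∀ n, a (n + 1) ≤ a n) (hc : ∀ n, c ≤ a n) :
    ∃ n, a (n + 1) = a n := by
  by_contra hne
  push Not at hne
  have h1 : ∀ n, len (a (n + 1)) + 1 ≤ len (a n) := by
    intro n
    have := len_mono (h n)
    rcases this.lt_or_eq with h' | h'
    · omega
    · exact absurd (eq_of_le_of_len (h n) h'.symm.le) (hne n)
  have h2 : ∀ n : ℕ, len (a n) + n ≤ len (a 0) := by
    intro n
    induction n with
    | zero => simp
    | succ n ih => have := h1 n; push_cast; omega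
  have h3 := h2 (len (a 0) - len c + 1).toNat
  have h4 := len_mono (hc (len (a 0) - len c + 1).toNat)
  have h5 := len_mono (hc 0)
  omega

/-- The iterates of `f` at `1` decrease and stay above the fixed point `c`, so they stabilize. As
`f'` commutes with `f`, the iterates of the composite are eventually fixed by `f` too; multiples of
`K` are chosen to fit the period of sliding. -/
theorem exists_fixed_iterate {f f' : B4 → B4} (hf : Monotone f) (hle : ∀ g, f g ≤ g)
    (hcomm : Function.Commute f' f) {c : B4} (hc : c ≤ 1) (hfc : f c = c) {K : ℕ} (hK : 1 ≤ K) :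
    ∃ N : ℕ, f ((f' ∘ f)^[K * N] 1) = (f' ∘ f)^[K * N] 1 := by
  have hbound : ∀ n, c ≤ f^[n] 1 := by
    intro n
    induction n with
    | zero => exact hc
    | succ n ih => rw [Function.iterate_succ_apply', ← hfc]; exact hf ih
  obtain ⟨n, hn⟩ := exists_stable' (a := fun n => f^[n] 1) (c := c)
    (fun n => by simpa only [Function.iterate_succ_apply'] using hle _) hbound
  simp only [Function.iterate_succ_apply'] at hn
  have hstable : ∀ m, f (f^[n + m] 1) = f^[n + m] 1 := by
    intro m
    induction m with
    | zero => exact hn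
    | succ m ih => rw [← add_assoc, Function.iterate_succ_apply', ih, ih]
  refine ⟨n, ?_⟩
  rw [hcomm.comp_iterate, Function.comp_apply, ((hcomm.symm.iterate_right (K * n)).eq _)]
  obtain ⟨m, hm⟩ := Nat.exists_eq_add_of_le (Nat.le_mul_of_pos_left n hK)
  rw [hm, hstable]

/-- Rigidity relative to prescribed infimum and supremum. -/
structure Rig (p s : ℤ) (y : B4) : Prop where
  inf_le : δ ^ p ≤ y
  le_sup : y ≤ δ ^ s
  slide_eq : slide y p s 1 * δ = 1

theorem Rig.inf_eq_one {p s : ℤ} {y : B4} (h : Rig p s y) :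
    y * δ ^ (-p) ⊓ y⁻¹ * δ ^ s ⊓ δ = 1 := by
  have := h.slide_eq
  rw [← zpow_one δ, slide, inf_mul_δ_zpow, inf_mul_δ_zpow] at this
  simpa [mul_assoc, ← zpow_add, ← zpow_add_one] using this

/-- If a prescribed bound were not sharp, one of the two terms would contain `δ`, and the trivial
meet would make the other term trivial. Then `y` would be a power of `δ` of excluded length. -/
theorem Rig.infimum_eq_and_supremum_eq {p s : ℤ} {y : B4} (h : Rig p s y) (h1 : 3 * p < len y)
    (h2 : len y < 3 * s) : infimum y = p ∧ supremum y = s := by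
  have h3 := h.inf_eq_one
  have hp := δ_zpow_le_iff.1 h.inf_le
  have hs := le_δ_zpow_iff.1 h.le_sup
  constructor
  · by_contra hne
    have h4 : δ ≤ y * δ ^ (-p) := by
      have := (mul_δ_zpow_le_iff (-p)).2
        (δ_zpow_le_iff.2 (show p + 1 ≤ infimum y by omega))
      rwa [← zpow_add, show p + 1 + -p = 1 by ring, zpow_one] at this
    rw [inf_right_comm, inf_eq_right.2 h4, inf_comm] at h3
    have h5 := congrArg len (eq_one_of_inf_δ (by
      have := mul_le_mul_right h.le_sup y⁻¹
      simpa using this) h3)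
    simp at h5
    omega
  · by_contra hne
    have h4 : δ ≤ y⁻¹ * δ ^ s := by
      have h4 := le_δ_zpow_iff.2 (show supremum y ≤ s - 1 by omega)
      have h5 := (mul_δ_zpow_le_iff 1).2 (mul_le_mul_right h4 y⁻¹)
      rwa [inv_mul_cancel, one_mul, zpow_one, zpow_sub_one, mul_assoc, inv_mul_cancel_right] at h5
    rw [inf_assoc, inf_eq_right.2 h4] at h3
    have h5 := congrArg len (eq_one_of_inf_δ (by
      have := (mul_δ_zpow_le_iff (-p)).2 h.inf_le
      simpa using this) h3)
    simp at h5
    omega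

theorem rig_conjBy_iff {p s : ℤ} {y g : B4} : Rig p s (conjBy y g) ↔
    pull y (-p) g = g ∧ pull y⁻¹ s g = g ∧ slide y p s g * δ = g := by
  rw [pull_eq_self_iff, pull_inv_eq_self_iff, neg_neg]
  have h : slide (conjBy y g) p s 1 * δ = 1 ↔ slide y p s g * δ = g := by
    rw [← mul_right_inj g, ← mul_assoc, slide_conjBy, mul_one]
  exact ⟨fun ⟨h1, h2, h3⟩ => ⟨h1, h2, h.1 h3⟩, fun ⟨h1, h2, h3⟩ => ⟨h1, h2, h.2 h3⟩⟩

theorem IsRigid.rig {x : B4} (hx : IsRigid x) : Rig (infimum x) (supremum x) x := by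
  refine ⟨δ_zpow_le_iff.2 le_rfl, le_δ_zpow_iff.2 le_rfl, ?_⟩
  rw [← preferredPrefix_eq hx.1, preferredPrefix, meet_eq, inf_comm]
  exact (isGcd_iff.1 hx.2).symm

theorem sliding_eq {x : B4} (h : 1 ≤ canonicalLength x) :
    sliding x = conjBy x (slide x (infimum x) (supremum x) 1 * δ) := by
  rw [sliding, if_neg (by omega), preferredPrefix_eq h]

theorem infimum_le_infimum_sliding (x : B4) : infimum x ≤ infimum (sliding x) := by
  by_cases h : canonicalLength x = 0
  · rw [sliding, if_pos h]
  rw [sliding_eq (by omega), ← δ_zpow_le_iff, ← neg_neg (infimum x), ← pull_eq_self_iff,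
    ← zpow_one δ, pull_mul_δ_zpow, (pull_slide_commute x _ _ _).eq]
  rw [neg_neg, (pull_eq_self_iff (g := 1)).2]
  simpa using δ_zpow_le_iff.2 le_rfl

theorem supremum_sliding_le (x : B4) : supremum (sliding x) ≤ supremum x := by
  by_cases h : canonicalLength x = 0
  · rw [sliding, if_pos h]
  rw [sliding_eq (by omega), ← le_δ_zpow_iff, ← pull_inv_eq_self_iff,
    ← zpow_one δ, pull_mul_δ_zpow, (pull_inv_slide_commute x _ _ _).eq]
  rw [(pull_inv_eq_self_iff (g := 1)).2]
  simpa using le_δ_zpow_iff.2 le_rfl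

theorem eq_of_monotone_of_periodic {f : ℕ → ℤ} (hf : ∀ n, f n ≤ f (n + 1)) {k : ℕ} (hk : 1 ≤ k)
    (hp : ∀ n, f (n + k) = f n) (n : ℕ) : f n = f 0 := by
  have hm := monotone_nat_of_le_succ hf
  have h1 : ∀ m, f (m * k) = f 0 := by
    intro m
    induction m with
    | zero => simp
    | succ m ih => rw [Nat.succ_mul, hp, ih]
  exact le_antisymm ((hm (Nat.le_mul_of_pos_right n hk)).trans (h1 n).le) (hm (Nat.zero_le n))

section Periodic

variable {y : B4} {k : ℕ}

theorem infimum_iterate_sliding (hk : 1 ≤ k) (hy : sliding^[k] y = y) (n : ℕ) :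
    infimum (sliding^[n] y) = infimum y :=
  eq_of_monotone_of_periodic (f := fun n => infimum (sliding^[n] y))
    (fun n => by simpa only [Function.iterate_succ_apply'] using infimum_le_infimum_sliding _) hk
    (fun n => by simp only [Function.iterate_add_apply, hy]) n

theorem supremum_iterate_sliding (hk : 1 ≤ k) (hy : sliding^[k] y = y) (n : ℕ) :
    supremum (sliding^[n] y) = supremum y :=
  neg_injective (eq_of_monotone_of_periodic (f := fun n => -supremum (sliding^[n] y))
    (fun n => by
      simpa only [Function.iterate_succ_apply', neg_le_neg_iff] using supremum_sliding_le _) hk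
    (fun n => by simp only [Function.iterate_add_apply, hy]) n)

/-- Along a sliding circuit the infimum and supremum do not change, so a single operator `slide`
describes all the steps. -/
theorem iterate_sliding_eq (hk : 1 ≤ k) (hy : sliding^[k] y = y) (h : 1 ≤ canonicalLength y)
    (n : ℕ) : sliding^[n] y =
      conjBy y ((slide y (infimum y) (supremum y))^[n] 1 * δ ^ (n : ℤ)) := by
  induction n with
  | zero => simp
  | succ n ih =>
    have h1 := infimum_iterate_sliding hk hy n
    have h2 := supremum_iterate_sliding hk hy n
    have h3 : 1 ≤ canonicalLength (sliding^[n] y) := by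
      simp only [supremum] at h2
      omega
    rw [Function.iterate_succ_apply', sliding_eq h3, h1, h2, ih, ← conjBy_mul, ← mul_assoc,
      slide_conjBy, mul_one, slide_mul_δ_zpow, Function.iterate_succ_apply', mul_assoc]
    push_cast
    rw [zpow_add_one]

end Periodic

theorem conjBy_mul_δ_pow_four (y g : B4) (k : ℤ) : conjBy y (g * δ ^ (4 * k)) = conjBy y g := by
  have h : Commute (conjBy y g) (δ ^ (4 * k)) := by
    rw [zpow_mul]
    exact Commute.zpow_right (by exact_mod_cast δ_pow_four_comm (conjBy y g)) k
  rw [conjBy_mul, conjBy, mul_assoc, h.eq, inv_mul_cancel_left]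

theorem exists_one_le_conjBy {x y : B4} (h : IsConj x y) : ∃ v, 1 ≤ v ∧ conjBy y v = x := by
  obtain ⟨c, hc⟩ := isConj_iff.1 h
  obtain ⟨m, hm⟩ := exists_δ_zpow_le c
  refine ⟨c * δ ^ (4 * (m : ℤ)), ?_, ?_⟩
  · have := (mul_δ_zpow_le_iff (4 * (m : ℤ))).2 hm
    rw [← zpow_add] at this
    exact le_trans (by simpa using δ_zpow_mono (show (0 : ℤ) ≤ -m + 4 * m by omega)) this
  · rw [conjBy_mul_δ_pow_four, conjBy, ← hc]
    simp [mul_assoc]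

theorem exists_le_one_conjBy {x y : B4} (h : IsConj x y) : ∃ v, v ≤ 1 ∧ conjBy y v = x := by
  obtain ⟨v, hv, hx⟩ := exists_one_le_conjBy h
  have : ∃ m : ℕ, v ≤ δ ^ (m : ℤ) := by
    obtain ⟨m, hm⟩ := exists_δ_zpow_le v⁻¹
    refine ⟨(supremum v).toNat, le_δ_zpow_iff.2 (Int.self_le_toNat _)⟩
  obtain ⟨m, hm⟩ := this
  refine ⟨v * δ ^ (4 * (-m : ℤ)), ?_, by rw [conjBy_mul_δ_pow_four, hx]⟩
  refine ((mul_δ_zpow_le_iff _).2 hm).trans ?_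
  rw [← zpow_add]
  simpa using δ_zpow_mono (show (m : ℤ) + 4 * (-m) ≤ 0 by omega)

/-- Write `x` as the conjugate of `y` by some `v ≤ 1`. If `x` had a better bound than `y`, then `v`
would be fixed by the corresponding `pull`, and by `exists_fixed_iterate` so would some iterated
slide. Such an iterate can be chosen to return to `y`, which would then have the better bound
itself. -/
theorem infimum_eq_of_mem_SC_aux {x y : B4} (hx : 1 ≤ canonicalLength x) (hy : y ∈ SC x)
    (hl : 1 ≤ canonicalLength y) : infimum x ≤ infimum y ∧ supremum y ≤ supremum x := by
  obtain ⟨hconj, k, hk, hper⟩ := hy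
  obtain ⟨v, hv, hvx⟩ := exists_le_one_conjBy hconj
  have hlen : len x = len y := by rw [← hvx, len_conjBy]
  have e1 := three_mul_infimum_lt hx
  have e2 := len_lt_three_mul_supremum hx
  have e3 := three_mul_infimum_lt hl
  have e4 := len_lt_three_mul_supremum hl
  have hperN : ∀ N, sliding^[k * N] y = y := by
    intro N
    rw [Function.iterate_mul]
    exact Function.iterate_fixed hper N
  constructor
  · by_contra hlt
    have h2 : infimum y + 2 ≤ supremum y := by omega
    have hc : pull y (-infimum y - 1) v = v := by
      rw [pull_eq_self_iff, hvx, δ_zpow_le_iff]; omega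
    obtain ⟨N, hN⟩ := exists_fixed_iterate (pull_mono y (-infimum y - 1)) (pull_le y _)
      (pull_commute y (-infimum y - 1) (supremum y - 1)) hv hc hk
    have hs : pull y⁻¹ (supremum y - 1) ∘ pull y (-infimum y - 1) =
        slide y (infimum y) (supremum y) := funext fun g => (slide_eq_pull_pull h2 g).symm
    rw [hs] at hN
    have h3 := congrArg (· * δ ^ ((k * N : ℕ) : ℤ)) hN
    simp only [← pull_mul_δ_zpow] at h3
    rw [pull_eq_self_iff, ← iterate_sliding_eq hk hper hl, hperN, δ_zpow_le_iff] at h3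
    omega
  · by_contra hlt
    have h2 : infimum y + 2 ≤ supremum y := by omega
    have hc : pull y⁻¹ (supremum y - 1) v = v := by
      rw [pull_inv_eq_self_iff, hvx, le_δ_zpow_iff]; omega
    obtain ⟨N, hN⟩ := exists_fixed_iterate (pull_mono y⁻¹ (supremum y - 1)) (pull_le y⁻¹ _)
      (pull_commute y (-infimum y - 1) (supremum y - 1)).symm hv hc hk
    have hs : pull y (-infimum y - 1) ∘ pull y⁻¹ (supremum y - 1) =
        slide y (infimum y) (supremum y) := funext fun g => by
      rw [slide_eq_pull_pull h2 g]
      exact (pull_commute y _ _).eq g |>.symm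
    rw [hs] at hN
    have h3 := congrArg (· * δ ^ ((k * N : ℕ) : ℤ)) hN
    simp only [← pull_mul_δ_zpow] at h3
    rw [pull_inv_eq_self_iff, ← iterate_sliding_eq hk hper hl, hperN, le_δ_zpow_iff] at h3
    omega

theorem eq_of_canonicalLength_eq_zero {y : B4} (h : canonicalLength y = 0) :
    y = δ ^ infimum y := by
  have h3 := (isNormalForm y).eq_prod
  rwa [List.length_eq_zero_iff.1 h, List.prod_nil, mul_one] at h3

/-- If `y = δ ^ q`, then `infimum x < q < supremum x` by comparing exponent sums, so `slide` fixes
every power of `δ`. The conjugator `v` satisfies `slide v * δ = v`, hence would lie above all powers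
of `δ`. -/
theorem one_le_canonicalLength_of_isConj {x y : B4} (hx : IsRigid x) (h : IsConj x y) :
    1 ≤ canonicalLength y := by
  by_contra hl
  have hy := eq_of_canonicalLength_eq_zero (y := y) (by omega)
  obtain ⟨v, hv, hvx⟩ := exists_one_le_conjBy h
  have hlen : len x = len y := by rw [← hvx, len_conjBy]
  have e1 := three_mul_infimum_lt hx.1
  have e2 := len_lt_three_mul_supremum hx.1
  rw [hlen, hy] at e1 e2
  simp only [len_zpow, len_δ] at e1 e2
  have hr := hx.rig
  rw [← hvx, rig_conjBy_iff, hvx] at hr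
  have hstep : ∀ n : ℕ, δ ^ (n : ℤ) ≤ v := by
    intro n
    induction n with
    | zero => simpa using hv
    | succ n ih =>
      have h1 := slide_mono y (infimum x) (supremum x) ih
      rw [← hr.2.2]
      have h2 := (mul_δ_zpow_le_iff 1).2 h1
      rw [zpow_one] at h2
      refine le_trans ?_ h2
      have h3 : slide y (infimum x) (supremum x) (δ ^ (n : ℤ)) = δ ^ (n : ℤ) := by
        rw [slide, hy, ← zpow_neg, ← zpow_add, ← zpow_add, ← zpow_add, ← zpow_add]
        exact inf_eq_right.2 (le_inf (δ_zpow_mono (by omega)) (δ_zpow_mono (by omega)))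
      rw [h3]
      push_cast
      rw [zpow_add_one]
  have h1 := len_mono (hstep (len v + 1).toNat)
  have h2 := len_mono hv
  simp at h1 h2
  omega

theorem pull_iterate_slide {y : B4} {p s k : ℤ} (h : δ ^ (-k) ≤ y) (n : ℕ) :
    pull y k ((slide y p s)^[n] 1 * δ ^ (n : ℤ)) = (slide y p s)^[n] 1 * δ ^ (n : ℤ) := by
  have h1 : pull y k 1 = 1 := pull_eq_self_iff.2 (by rwa [conjBy_one])
  have h2 := ((pull_slide_commute y p s k).iterate_right n).eq 1
  rw [pull_mul_δ_zpow, h2, h1]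

theorem pull_inv_iterate_slide {y : B4} {p s k : ℤ} (h : y ≤ δ ^ k) (n : ℕ) :
    pull y⁻¹ k ((slide y p s)^[n] 1 * δ ^ (n : ℤ)) = (slide y p s)^[n] 1 * δ ^ (n : ℤ) := by
  have h1 : pull y⁻¹ k 1 = 1 := pull_inv_eq_self_iff.2 (by rwa [conjBy_one])
  have h2 := ((pull_inv_slide_commute y p s k).iterate_right n).eq 1
  rw [pull_mul_δ_zpow, h2, h1]

/-- Take `v ≥ 1` conjugating `y` to the rigid `x`. The sliding conjugators `a n` increase and stay
below `v`, so they stabilize, at a rigid conjugate of `y`. As `y` recurs under sliding, it is itself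
such a stable conjugate. -/
theorem rig_of_mem_SC {x y : B4} (hx : IsRigid x) (hy : y ∈ SC x) :
    Rig (infimum x) (supremum x) y := by
  have hl := one_le_canonicalLength_of_isConj hx hy.1
  obtain ⟨hi, hs⟩ := infimum_eq_of_mem_SC_aux hx.1 hy hl
  obtain ⟨hconj, k, hk, hper⟩ := hy
  obtain ⟨v, hv, hvx⟩ := exists_one_le_conjBy hconj
  have hlen : len x = len y := by rw [← hvx, len_conjBy]
  have e1 := three_mul_infimum_lt hx.1
  have e2 := len_lt_three_mul_supremum hx.1
  set p := infimum x with hp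
  set s := supremum x with hs'
  have hr : Rig p s (conjBy y v) := by rw [hvx]; exact hx.rig
  rw [rig_conjBy_iff] at hr
  have hy1 : δ ^ p ≤ y := δ_zpow_le_iff.2 hi
  have hy2 : y ≤ δ ^ s := le_δ_zpow_iff.2 hs
  -- iterating the sliding operator from `1` stabilizes
  let a : ℕ → B4 := fun n => (slide y p s)^[n] 1 * δ ^ (n : ℤ)
  have hsucc : ∀ n, a (n + 1) = slide y p s (a n) * δ := by
    intro n
    simp only [a]
    rw [slide_mul_δ_zpow, Function.iterate_succ_apply', mul_assoc]
    push_cast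
    rw [zpow_add_one]
  have hmono : Monotone fun g => slide y p s g * δ := fun g h hgh => by
    have := (mul_δ_zpow_le_iff 1).2 (slide_mono y p s hgh)
    rwa [zpow_one] at this
  have h01 : a 0 ≤ a 1 := by
    rw [hsucc]
    have e3 : a 0 = 1 := by simp [a]
    rw [e3, ← zpow_one δ, slide, inf_mul_δ_zpow, inf_mul_δ_zpow]
    refine le_inf (le_inf ?_ ?_) ?_
    · have := (mul_δ_zpow_le_iff (-p)).2 hy1
      simpa [mul_assoc, ← zpow_add, ← zpow_add_one] using this
    · have := mul_le_mul_right hy2 y⁻¹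
      simpa [mul_assoc, ← zpow_add, ← zpow_add_one] using this
    · simpa using one_le_δ
  have hinc : ∀ n, a n ≤ a (n + 1) := by
    intro n
    induction n with
    | zero => exact h01
    | succ n ih => rw [hsucc n, hsucc (n + 1)]; exact hmono ih
  have hbd : ∀ n, a n ≤ v := by
    intro n
    induction n with
    | zero => simpa [a] using hv
    | succ n ih => exact (hsucc n).le.trans ((hmono ih).trans hr.2.2.le)
  obtain ⟨n, hn⟩ := exists_stable hinc hbd
  rw [hsucc] at hn
  have hA : ∀ n, pull y (-p) (a n) = a n ∧ pull y⁻¹ s (a n) = a n ∧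
      pull y (-infimum y) (a n) = a n ∧ pull y⁻¹ (supremum y) (a n) = a n := fun n =>
    ⟨pull_iterate_slide (by rwa [neg_neg]) n, pull_inv_iterate_slide hy2 n,
      pull_iterate_slide (by rw [neg_neg]; exact δ_zpow_le_iff.2 le_rfl) n,
      pull_inv_iterate_slide (le_δ_zpow_iff.2 le_rfl) n⟩
  have hz : Rig p s (conjBy y (a n)) := rig_conjBy_iff.2 ⟨(hA n).1, (hA n).2.1, hn⟩
  set z := conjBy y (a n) with hzdef
  obtain ⟨hzi, hzs⟩ := hz.infimum_eq_and_supremum_eq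
    (by rw [hzdef, len_conjBy]; omega) (by rw [hzdef, len_conjBy]; omega)
  have hi' : infimum y = p := by
    have := (pull_eq_self_iff (y := y) (g := a n) (k := -infimum y)).1 (hA n).2.2.1
    rw [neg_neg, δ_zpow_le_iff, ← hzdef] at this
    omega
  have hs'' : supremum y = s := by
    have := le_δ_zpow_iff.1 (pull_inv_eq_self_iff.1 (hA n).2.2.2)
    rw [← hzdef] at this
    omega
  refine ⟨hy1, hy2, ?_⟩
  -- by periodicity, stabilization happens at `y` itself
  have hstab : ∀ m, slide y p s (a (n + m)) * δ = a (n + m) := by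
    intro m
    induction m with
    | zero => exact hn
    | succ m ih => rw [← add_assoc, hsucc, ih, ih]
  have hN : sliding^[k * n] y = y := by
    rw [Function.iterate_mul]
    exact Function.iterate_fixed hper n
  obtain ⟨m, hm⟩ := Nat.exists_eq_add_of_le (Nat.le_mul_of_pos_left n hk)
  have h1 := iterate_sliding_eq hk hper hl (k * n)
  rw [hN, hi', hs'', hm] at h1
  have h2 : Rig p s (conjBy y (a (n + m))) :=
    rig_conjBy_iff.2 ⟨(hA _).1, (hA _).2.1, hstab m⟩
  rw [show conjBy y (a (n + m)) = y from h1.symm] at h2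
  exact h2.slide_eq

end BKL4

namespace BKL4

/-! ### Rigid braids whose factors are atoms -/

theorem pull_commute_self (y : B4) (k l : ℤ) : Function.Commute (pull y k) (pull y l) := fun g => by
  simp only [pull, mul_inf, inf_mul_δ_zpow, mul_assoc, ← zpow_add, add_comm k]
  ac_rfl

/-- Rigid braids of infimum `p` and canonical length `r`, whose factors have length one. -/
structure Atomic (p : ℤ) (r : ℕ) (y : B4) : Prop where
  pos : 1 ≤ r
  rig : Rig p (p + r) y
  len_eq : len y = 3 * p + r

namespace Atomic

variable {p : ℤ} {r : ℕ} {y z : B4}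

theorem infimum_eq (h : Atomic p r y) : infimum y = p :=
  (h.rig.infimum_eq_and_supremum_eq (by have := h.len_eq; have := h.pos; omega)
    (by have := h.len_eq; have := h.pos; omega)).1

theorem supremum_eq (h : Atomic p r y) : supremum y = p + r :=
  (h.rig.infimum_eq_and_supremum_eq (by have := h.len_eq; have := h.pos; omega)
    (by have := h.len_eq; have := h.pos; omega)).2

theorem canonicalLength_eq (h : Atomic p r y) : canonicalLength y = r := by
  have h1 := h.infimum_eq
  have h2 := h.supremum_eq
  simp only [supremum] at h2
  omega

theorem one_le_canonicalLength (h : Atomic p r y) : 1 ≤ canonicalLength y :=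
  h.canonicalLength_eq ▸ h.pos

theorem eq_prod (h : Atomic p r y) : y = δ ^ p * (factors y).prod := by
  nth_rw 1 [(isNormalForm y).eq_prod, h.infimum_eq]

theorem finalFactor_inv_eq (h : Atomic p r y) :
    (finalFactor y)⁻¹ = pull y⁻¹ (p + r - 1) 1 := by
  have h1 := rightComplement_finalFactor h.one_le_canonicalLength
  rw [h.supremum_eq, rightComplement] at h1
  rw [eq_mul_inv_of_mul_eq h1, ← zpow_neg_one δ, inf_mul_δ_zpow, pull, mul_one, mul_assoc,
    ← zpow_add, zpow_neg_one, mul_inv_cancel, sub_eq_add_neg]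

theorem initialFactor_eq_pull (h : Atomic p r y) :
    initialFactor y = pull y (-p - 1) 1 * δ := by
  have h1 : pull y (-p - 1) 1 * δ ^ (1 : ℤ) = y * δ ^ (-p) ⊓ δ := by
    rw [pull, inf_mul_δ_zpow, mul_one, mul_assoc, ← zpow_add, sub_add_cancel, one_mul, zpow_one]
  rw [initialFactor_eq h.one_le_canonicalLength, h.infimum_eq, ← h1, zpow_one]

theorem conj_of_fixed {g : B4} (h : Atomic p r y) (h1 : pull y (-p) g = g)
    (h2 : pull y⁻¹ (p + r) g = g) (h3 : slide y p (p + r) g * δ = g) : Atomic p r (conjBy y g) :=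
  ⟨h.pos, rig_conjBy_iff.2 ⟨h1, h2, h3⟩, by rw [len_conjBy, h.len_eq]⟩

theorem fixed_of_conj {g : B4} (h : Atomic p r (conjBy y g)) : pull y (-p) g = g ∧
    pull y⁻¹ (p + r) g = g ∧ slide y p (p + r) g * δ = g := rig_conjBy_iff.1 h.rig

theorem fixed_one (h : Atomic p r y) : pull y (-p) 1 = 1 ∧
    pull y⁻¹ (p + r) 1 = 1 ∧ slide y p (p + r) 1 * δ = 1 :=
  fixed_of_conj (by rwa [conjBy_one])

theorem conj_δ (h : Atomic p r y) : Atomic p r (conjBy y δ) := by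
  obtain ⟨h1, h2, h3⟩ := h.fixed_one
  have e : δ = 1 * δ ^ (1 : ℤ) := by simp
  refine h.conj_of_fixed ?_ ?_ ?_
  · rw [e, pull_mul_δ_zpow, h1]
  · rw [e, pull_mul_δ_zpow, h2]
  · nth_rw 1 [e]
    rw [slide_mul_δ_zpow, zpow_one, h3, one_mul]

theorem conj_inf {g k : B4} (h : Atomic p r y) (hg : Atomic p r (conjBy y g))
    (hk : Atomic p r (conjBy y k)) : Atomic p r (conjBy y (g ⊓ k)) := by
  obtain ⟨h1, h2, h3⟩ := hg.fixed_of_conj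
  obtain ⟨h1', h2', h3'⟩ := hk.fixed_of_conj
  refine h.conj_of_fixed (by rw [pull_inf, h1, h1']) (by rw [pull_inf, h2, h2']) ?_
  have := inf_mul_δ_zpow (slide y p (p + r) g) (slide y p (p + r) k) 1
  rw [zpow_one, h3, h3'] at this
  rw [slide_inf, this]

/-- All the operators defining `Atomic` fix `1` (up to the factor `δ`) and commute with `pull y⁻¹
k`, so they fix its value at `1` as well. -/
theorem conj_pull_inv (h : Atomic p r y) (k : ℤ) : Atomic p r (conjBy y (pull y⁻¹ k 1)) := by
  obtain ⟨h1, h2, h3⟩ := h.fixed_one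
  refine h.conj_of_fixed ?_ ?_ ?_
  · rw [← (pull_commute y (-p) k).eq, h1]
  · rw [(pull_commute_self y⁻¹ _ _).eq, h2]
  · rw [← (pull_inv_slide_commute y p (p + r) k).eq, ← zpow_one δ, ← pull_mul_δ_zpow, zpow_one, h3]

end Atomic

/-- Decycling: conjugation by the inverse of the final factor. -/
noncomputable def decycling (y : B4) : B4 := conjBy y (finalFactor y)⁻¹

namespace Atomic

variable {p : ℤ} {r : ℕ} {y z : B4}

theorem atomic_decycling (h : Atomic p r y) : Atomic p r (decycling y) := by
  rw [decycling, h.finalFactor_inv_eq]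
  exact h.conj_pull_inv _

theorem iterate_decycling (h : Atomic p r y) (n : ℕ) : Atomic p r (decycling^[n] y) := by
  induction n with
  | zero => exact h
  | succ n ih => rw [Function.iterate_succ_apply']; exact ih.atomic_decycling

/-- The two successive pulls from `1` amount to one slide, which rigidity evaluates to `δ⁻¹`. -/
theorem initialFactor_decycling (h : Atomic p r y) :
    initialFactor (decycling y) = finalFactor y := by
  rw [h.atomic_decycling.initialFactor_eq_pull]
  have h1 := pull_conjBy y (finalFactor y)⁻¹ (-p - 1) 1
  have hs := h.rig.slide_eq
  have h2 : pull y (-p - 1) (finalFactor y)⁻¹ = δ⁻¹ := by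
    rw [h.finalFactor_inv_eq, pull_pull_inv]
    have h3 : slide y p (p + r) 1 = δ⁻¹ := eq_inv_of_mul_eq_one_left hs
    rw [inf_assoc, inf_comm 1, ← slide, h3, one_mul, inf_eq_right]
    rw [← zpow_neg_one]
    -- The extra term is `δ ^ (r - 2)`; it lies above `δ⁻¹` because `r ≥ 1`.
    exact δ_zpow_mono (by have := h.pos; omega)
  rw [mul_one, h2] at h1
  rw [decycling, ← mul_right_inj (finalFactor y)⁻¹, ← mul_assoc, h1]
  simp

theorem cycling_eq (h : Atomic p r y) : cycling y = conjBy y (initialFactor y) := by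
  rw [cycling, if_neg (by have := h.one_le_canonicalLength; omega)]

theorem cycling_decycling (h : Atomic p r y) : cycling (decycling y) = y := by
  rw [h.atomic_decycling.cycling_eq, h.initialFactor_decycling, decycling, ← conjBy_mul]
  simp

theorem leftWeighted_final_initial (h : Atomic p r y) :
    LeftWeighted (finalFactor y) (initialFactor y) := by
  have h1 := h.rig.slide_eq
  rw [← h.supremum_eq] at h1
  nth_rw 1 [← h.infimum_eq] at h1
  rw [← preferredPrefix_eq h.one_le_canonicalLength, preferredPrefix, meet_eq, inf_comm] at h1
  exact leftWeighted_iff.2 h1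

theorem leftWeighted_decycling (h : Atomic p r y) :
    LeftWeighted (finalFactor (decycling y)) (finalFactor y) := by
  have := h.atomic_decycling.leftWeighted_final_initial
  rwa [h.initialFactor_decycling] at this

/-- The `r` factors have positive length and total length `r`. That none is trivial follows from the
last one, since a trivial factor can only be followed by trivial ones. -/
theorem len_of_mem_factors (h : Atomic p r y) {s : B4} (hs : s ∈ factors y) : len s = 1 := by
  have hn := isNormalForm y
  have hne : ∀ L : List B4, (∀ t ∈ L, IsSimple t) → (∀ h : L ≠ [], L.getLast h ≠ 1) →
      L.IsChain LeftWeighted → ∀ t ∈ L, t ≠ 1 := by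
    intro L
    induction L with
    | nil => simp
    | cons t L ih =>
      intro h1 h2 h3 u hu
      cases L with
      | nil => simp at hu; subst hu; simpa using h2
      | cons v L =>
        rw [List.isChain_cons_cons] at h3
        have hrec := ih (fun u hu => h1 u (List.mem_cons_of_mem _ hu))
          (fun hne => by simpa using h2) h3.2
        rcases List.mem_cons.1 hu with rfl | hu
        · rintro rfl
          have h4 := leftWeighted_iff.1 h3.1
          rw [inv_one, one_mul, inf_eq_right.2 (h1 v (by simp)).le_δ] at h4
          exact hrec v (by simp) h4
        · exact hrec u hu
  have hone := hne _ hn.simple hn.last_ne_one hn.leftWeighted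
  have hpos : ∀ t ∈ factors y, 1 ≤ len t := fun t ht => len_pos (hn.simple t ht).one_le (hone t ht)
  have hlist : ∀ L : List B4, (∀ t ∈ L, 1 ≤ len t) → (L.length : ℤ) ≤ len L.prod ∧
      (len L.prod ≤ L.length → ∀ t ∈ L, len t = 1) := by
    intro L
    induction L with
    | nil => simp
    | cons t L ih =>
      intro h1
      obtain ⟨i1, i2⟩ := ih fun u hu => h1 u (List.mem_cons_of_mem _ hu)
      have h2 := h1 t (by simp)
      rw [List.prod_cons, len_mul, List.length_cons]
      push_cast
      refine ⟨by omega, fun h3 u hu => ?_⟩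
      rcases List.mem_cons.1 hu with rfl | hu
      · omega
      · exact i2 (by omega) u hu
  refine (hlist _ hpos).2 ?_ s hs
  have h1 := h.len_eq
  rw [h.eq_prod, len_mul, len_zpow, len_δ] at h1
  have h2 := h.canonicalLength_eq
  rw [canonicalLength] at h2
  omega

theorem finalFactor_mem (h : Atomic p r y) : finalFactor y ∈ factors y := by
  obtain ⟨L, hL⟩ := eq_append_of_pos h.one_le_canonicalLength
  rw [hL]; simp

/-- The final factor, as an element of the germ. -/
noncomputable def _root_.BKL4.lastAtom (y : B4) : Simple := head (finalFactor y)

theorem finalFactor_eq_toB4 (h : Atomic p r y) : finalFactor y = (lastAtom y).toB4 ∧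
    (lastAtom y).IsAtom := by
  have h1 := h.len_of_mem_factors h.finalFactor_mem
  have h2 := ((isNormalForm y).simple _ h.finalFactor_mem).one_le
  obtain ⟨a, ha, he⟩ := eq_toB4_of_len_eq_one (one_le_iff.1 h2) h1
  rw [lastAtom, he, head_toB4]
  exact ⟨rfl, ha⟩

end Atomic

theorem lw_of_leftWeighted {s t : Simple} (h : LeftWeighted s.toB4 t.toB4) : Simple.LW s t := by
  rw [leftWeighted_iff] at h
  have hc : s.toB4⁻¹ * δ = s.compl.toB4 := by
    rw [inv_mul_eq_iff_eq_mul]; exact (Simple.toB4_mul (Simple.mul_compl s)).symm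
  have h1 := Simple.meet_dvd s.compl t
  have h2 : (Simple.meet s.compl t).toB4 ≤ 1 := by
    rw [← h, hc]; exact le_inf h1.1.le h1.2.le
  exact toB4_injective (le_antisymm h2 (atom_one_le _))

theorem Atomic.lw_lastAtom {p : ℤ} {r : ℕ} {y : B4} (h : Atomic p r y) :
    Simple.LW (lastAtom (decycling y)) (lastAtom y) := by
  apply lw_of_leftWeighted
  rw [← h.finalFactor_eq_toB4.1, ← h.atomic_decycling.finalFactor_eq_toB4.1]
  exact h.leftWeighted_decycling

/-- Product of the final factors met along iterated decycling. -/
noncomputable def acc (y : B4) : ℕ → B4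
  | 0 => 1
  | n + 1 => finalFactor (decycling^[n] y) * acc y n

theorem iterate_decycling_eq (y : B4) (n : ℕ) : decycling^[n] y = conjBy y (acc y n)⁻¹ := by
  induction n with
  | zero => simp [acc]
  | succ n ih =>
    rw [Function.iterate_succ_apply']
    nth_rw 1 [decycling]
    rw [acc, mul_inv_rev, conjBy_mul, ← ih]

theorem acc_succ (y : B4) (n : ℕ) : acc y (n + 1) = acc (decycling y) n * finalFactor y := by
  induction n with
  | zero => simp [acc]
  | succ n ih => rw [acc, ih, acc, ← mul_assoc, Function.iterate_succ_apply]

theorem leftWeighted_conj {s t : B4} (k : ℤ) (h : LeftWeighted s t) :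
    LeftWeighted (δ ^ (-k) * s * δ ^ k) (δ ^ (-k) * t * δ ^ k) := by
  rw [leftWeighted_iff] at h ⊢
  have h1 : (δ ^ (-k) * s * δ ^ k)⁻¹ * δ = δ ^ (-k) * (s⁻¹ * δ) * δ ^ k := by
    have : δ * δ ^ k = δ ^ k * δ := by rw [← zpow_one_add, ← zpow_add_one, add_comm]
    simp [mul_assoc, this]
  rw [h1, ← inf_mul_δ_zpow, ← mul_inf, h]
  simp

namespace Atomic

variable {p : ℤ} {r : ℕ} {y z : B4}

/-- Decycling moves the last letter to the front, twisted by `τ ^ p`. Prefixing the twisted copy of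
`B` in the chain hypothesis keeps the hypothesis valid when a letter passes from `B` to `A`. -/
theorem acc_eq_prod (B : List B4) : ∀ (A : List B4) {y : B4}, Atomic p r y →
    y = δ ^ p * (A ++ B).prod → (A ++ B).length = r → (∀ t ∈ A ++ B, IsSimple t) →
    (B.map (fun b => δ ^ (-p) * b * δ ^ p) ++ (A ++ B)).IsChain LeftWeighted →
    acc y B.length = B.prod ∧ ∀ i < B.length, finalFactor (decycling^[i] y) ∈ B := by
  induction B using List.reverseRecOn with
  | nil => intros; simp [acc]
  | append_singleton B b ih =>
    intro A y h hy hlen hs hc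
    have hc' := hc.right_of_append
    rw [← List.append_assoc] at hy hlen hs hc'
    have hfin : finalFactor y = b := by
      have h1 := inv_mul_δ_inf_of_list hy hs hc'
      rw [hlen, ← h.supremum_eq, ← rightComplement_finalFactor h.one_le_canonicalLength,
        rightComplement] at h1
      exact inv_injective (mul_right_cancel h1)
    have hsimple : IsSimple (δ ^ (-p) * b * δ ^ p) := by
      have hb := hs b (by simp)
      rw [isSimple_iff]
      constructor
      · rw [one_le_iff]; exact conj_δ_zpow_mem (one_le_iff.1 hb.one_le) p
      · have h1 := mul_le_mul_right ((mul_δ_zpow_le_iff p).2 hb.le_δ) (δ ^ (-p))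
        have h2 : δ ^ (-p) * (δ * δ ^ p) = δ := by
          rw [← zpow_one_add, ← zpow_add]; simp
        rw [h2, ← mul_assoc] at h1
        exact h1
    have hd := ih ((δ ^ (-p) * b * δ ^ p) :: A) h.atomic_decycling (by
        rw [decycling, hfin, conjBy, hy]
        simp [mul_assoc])
      (by simpa [add_comm, add_left_comm, add_assoc] using hlen)
      (by
        intro t ht
        rcases List.mem_cons.1 ht with rfl | ht
        · exact hsimple
        · exact hs t (List.mem_append_left _ ht))
      (by
        have e : (B ++ [b]).map (fun b => δ ^ (-p) * b * δ ^ p) ++ (A ++ (B ++ [b])) =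
            (B.map (fun b => δ ^ (-p) * b * δ ^ p) ++ (δ ^ (-p) * b * δ ^ p :: A ++ B)) ++ [b] := by
          simp
        rw [e] at hc
        exact hc.left_of_append)
    rw [List.length_append, List.length_singleton, acc_succ, hd.1, hfin]
    refine ⟨by simp, fun i hi => ?_⟩
    cases i with
    | zero => simp [hfin]
    | succ i =>
      rw [Function.iterate_succ_apply]
      exact List.mem_append_left _ (hd.2 i (by omega))

theorem isChain_map_append (h : Atomic p r y) :
    ((factors y).map (fun b => δ ^ (-p) * b * δ ^ p) ++ factors y).IsChain LeftWeighted := by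
  have hn := isNormalForm y
  rw [List.isChain_append]
  refine ⟨?_, hn.leftWeighted, ?_⟩
  · rw [List.isChain_map]
    exact hn.leftWeighted.imp fun _ _ h => leftWeighted_conj p h
  · intro s hs t ht
    obtain ⟨L, hL⟩ := eq_append_of_pos h.one_le_canonicalLength
    have h1 : s = δ ^ (-p) * finalFactor y * δ ^ p := by
      rw [hL] at hs
      simpa using hs.symm
    have h2 : t = δ ^ (-p) * initialFactor y * δ ^ p := by
      cases hf : factors y with
      | nil => rw [hf] at ht; simp at ht
      | cons u M =>
        rw [hf] at ht
        have hu : u = t := by simpa using ht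
        subst hu
        rw [initialFactor, hf, h.infimum_eq, τ, ← map_zpow, MulAut.conj_apply]
        simp [mul_assoc]
    rw [h1, h2]
    exact leftWeighted_conj p h.leftWeighted_final_initial

theorem acc_length (h : Atomic p r y) : acc y r = δ ^ (-p) * y ∧
    ∀ i < r, finalFactor (decycling^[i] y) ∈ factors y := by
  have hl : (factors y).length = r := h.canonicalLength_eq
  have := acc_eq_prod (factors y) [] h h.eq_prod hl (isNormalForm y).simple h.isChain_map_append
  rw [hl] at this
  refine ⟨?_, this.2⟩
  rw [this.1]
  nth_rw 2 [h.eq_prod]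
  simp

theorem iterate_decycling_length (h : Atomic p r y) :
    decycling^[r] y = δ ^ (-p) * y * δ ^ p := by
  rw [iterate_decycling_eq, h.acc_length.1, conjBy]
  simp [mul_assoc]

/-- The first `r` final factors multiply up to `δ ^ (-p) * y`. -/
theorem eq_of_finalFactor (hy : Atomic p r y) (hz : Atomic p r z)
    (h : ∀ n, finalFactor (decycling^[n] y) = finalFactor (decycling^[n] z)) : y = z := by
  have h1 : ∀ n, acc y n = acc z n := by
    intro n
    induction n with
    | zero => rfl
    | succ n ih => rw [acc, acc, ih, h]
  have h2 := h1 r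
  rw [hy.acc_length.1, hz.acc_length.1] at h2
  exact mul_left_cancel h2

end Atomic

end BKL4

namespace BKL4
namespace Simple

/-! ### Moving an atom through a word of atoms -/

/-- The atoms which are sides of the square. -/
def isEdge : Simple → Bool
  | a12 => true | a23 => true | a34 => true | a14 => true | _ => false

/-- A proposition-valued version of `isEdge`. -/
abbrev IsEdge (s : Simple) : Prop := isEdge s = true

/-- The product of two simple elements is not simple. -/
abbrev NonSimple (s t : Simple) : Prop := (mul s t).isNone = true

/-- Boolean implication. -/
def imp (p q : Bool) : Bool := !p || q

theorem imp_iff (p q : Bool) : imp p q = true ↔ (p = true → q = true) := by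
  cases p <;> simp [imp]

theorem mem_all (s : Simple) : s ∈ all := by cases s <;> decide

theorem LW.nonSimple : ∀ s t : Simple, LW s t → t ≠ one → NonSimple s t := by
  decide +kernel

/-- The factorizations `t' b` of the simple element `a t` with `t'` an atom other than `a`. -/
def flips : Simple → Simple → List (Simple × Simple)
  | a12, a23 => [(a23, a13), (a13, a12)] | a23, a13 => [(a12, a23), (a13, a12)]
  | a13, a12 => [(a12, a23), (a23, a13)] | a23, a34 => [(a34, a24), (a24, a23)]
  | a34, a24 => [(a23, a34), (a24, a23)] | a24, a23 => [(a23, a34), (a34, a24)]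
  | a34, a14 => [(a14, a13), (a13, a34)] | a14, a13 => [(a34, a14), (a13, a34)]
  | a13, a34 => [(a34, a14), (a14, a13)] | a14, a12 => [(a12, a24), (a24, a14)]
  | a12, a24 => [(a14, a12), (a24, a14)] | a24, a14 => [(a14, a12), (a12, a24)]
  | a12, a34 => [(a34, a12)] | a34, a12 => [(a12, a34)]
  | a23, a14 => [(a14, a23)] | a14, a23 => [(a23, a14)]
  | _, _ => []

theorem mem_flips : ∀ a t m : Simple, mul a t = some m → a.IsAtom → t.IsAtom →
    ∀ t' : Simple, t'.IsAtom → t' ≠ a → ∀ b : Simple, mul t' b = some m →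
    (t', b) ∈ flips a t := by
  have key : (all.all fun a => all.all fun t => all.all fun m =>
      imp (decide (mul a t = some m)) <| imp (decide a.IsAtom) <| imp (decide t.IsAtom) <|
      all.all fun t' => imp (decide t'.IsAtom) <| imp (decide (t' ≠ a)) <| all.all fun b =>
      imp (decide (mul t' b = some m)) <| decide ((t', b) ∈ flips a t)) = true := by
    decide +kernel
  simpa only [List.all_eq_true, imp_iff, decide_eq_true_iff, mem_all, forall_const] using key

/-- One step of two composed moves: `a`, `x.2`, `y.2` are the letters of the three words, `t`, `u`
the moving atoms before the step and `x.1`, `y.1` those after it. The data `a'`, `x'`, `y'` belong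
to the next step and enter through the condition that consecutive letters have no simple product. -/
theorem not_back_step : ∀ a : Simple, IsEdge a → ∀ t : Simple, ∀ x ∈ flips a t, ∀ u : Simple,
    ∀ y ∈ flips x.2 u, ∀ a' : Simple, IsEdge a' → NonSimple a' a →
    ∀ x' ∈ flips a' x.1, NonSimple x'.2 x.2 → ∀ y' ∈ flips x'.2 y.1, NonSimple y'.2 y.2 →
    mul t u ≠ some (compl a) → mul x.1 y.1 ≠ some (compl a') := by
  have key : (all.all fun a => imp (isEdge a) <| all.all fun t => (flips a t).all fun x =>
      all.all fun u => (flips x.2 u).all fun y => all.all fun a' => imp (isEdge a') <|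
      imp (mul a' a).isNone <| (flips a' x.1).all fun x' => imp (mul x'.2 x.2).isNone <|
      (flips x'.2 y.1).all fun y' => imp (mul y'.2 y.2).isNone <|
      imp (decide (mul t u ≠ some (compl a))) (decide (mul x.1 y.1 ≠ some (compl a')))) = true := by
    decide +kernel
  simpa only [List.all_eq_true, imp_iff, decide_eq_true_iff, mem_all, forall_const] using key

/-- The situation in which no diagonal can be met any more. -/
def Stuck (a t u : Simple) : Prop := t = u ∨ u = a ∧ ¬ IsEdge t

instance (a t u : Simple) : Decidable (Stuck a t u) :=
  inferInstanceAs (Decidable (t = u ∨ u = a ∧ ¬ IsEdge t))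

/-- A stuck state persists and only emits sides into the intermediate word, so it is incompatible
with meeting diagonals infinitely often. -/
theorem stuck_step : ∀ a : Simple, IsEdge a → ∀ t : Simple, ∀ x ∈ flips a t, ∀ u : Simple,
    ∀ y ∈ flips x.2 u, ∀ a' : Simple, IsEdge a' → NonSimple a' a →
    ∀ x' ∈ flips a' x.1, NonSimple x'.2 x.2 → ∀ y' ∈ flips x'.2 y.1, NonSimple y'.2 y.2 →
    Stuck a t u → IsEdge x.2 ∧ Stuck a' x.1 y.1 := by
  have key : (all.all fun a => imp (isEdge a) <| all.all fun t => (flips a t).all fun x =>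
      all.all fun u => (flips x.2 u).all fun y => all.all fun a' => imp (isEdge a') <|
      imp (mul a' a).isNone <| (flips a' x.1).all fun x' => imp (mul x'.2 x.2).isNone <|
      (flips x'.2 y.1).all fun y' => imp (mul y'.2 y.2).isNone <|
      imp (decide (Stuck a t u)) (decide (IsEdge x.2 ∧ Stuck a' x.1 y.1))) = true := by
    decide +kernel
  simpa only [List.all_eq_true, imp_iff, decide_eq_true_iff, mem_all, forall_const] using key

/-- Once a diagonal has been met without going back, and barring a stuck state, the next
intermediate letter is again a diagonal; from then on the final word is a turned copy of the first.
-/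
theorem diagonal_step : ∀ a : Simple, IsEdge a → ∀ t : Simple, ∀ x ∈ flips a t, ∀ u : Simple,
    ∀ y ∈ flips x.2 u, ∀ a' : Simple, IsEdge a' → NonSimple a' a →
    ∀ x' ∈ flips a' x.1, NonSimple x'.2 x.2 → ∀ y' ∈ flips x'.2 y.1, NonSimple y'.2 y.2 →
    ¬ IsEdge x.2 → mul t u ≠ some (compl a) →
    Stuck a' x.1 y.1 ∨ (rot y.2 = a ∧ ¬ IsEdge x'.2) := by
  have key : (all.all fun a => imp (isEdge a) <| all.all fun t => (flips a t).all fun x =>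
      all.all fun u => (flips x.2 u).all fun y => all.all fun a' => imp (isEdge a') <|
      imp (mul a' a).isNone <| (flips a' x.1).all fun x' => imp (mul x'.2 x.2).isNone <|
      (flips x'.2 y.1).all fun y' => imp (mul y'.2 y.2).isNone <|
      imp (decide (¬ IsEdge x.2)) <| imp (decide (mul t u ≠ some (compl a)))
        (decide (Stuck a' x.1 y.1 ∨ (rot y.2 = a ∧ ¬ IsEdge x'.2)))) = true := by
    decide +kernel
  simpa only [List.all_eq_true, imp_iff, decide_eq_true_iff, mem_all, forall_const] using key

theorem adjacent_step : ∀ a : Simple, IsEdge a → ∀ t : Simple, ∀ x ∈ flips a t, IsEdge x.2 →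
    ∀ u : Simple, mul u t = some (compl a) → ∀ y ∈ flips a u, IsEdge y.2 →
    ∀ a' : Simple, IsEdge a' → NonSimple a' a → ∀ x' ∈ flips a' x.1, ∀ y' ∈ flips a' y.1,
    y.2 = a ∧ mul y.1 x.1 = some (compl a') := by
  have key : (all.all fun a => imp (isEdge a) <| all.all fun t => (flips a t).all fun x =>
      imp (isEdge x.2) <| all.all fun u => imp (decide (mul u t = some (compl a))) <|
      (flips a u).all fun y => imp (isEdge y.2) <| all.all fun a' => imp (isEdge a') <|
      imp (mul a' a).isNone <| (flips a' x.1).all fun x' => (flips a' y.1).all fun y' =>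
      decide (y.2 = a ∧ mul y.1 x.1 = some (compl a'))) = true := by
    decide +kernel
  simpa only [List.all_eq_true, imp_iff, decide_eq_true_iff, mem_all, forall_const] using key

/-- Both atoms lie in the triangle complementary to the side `a`, where two distinct atoms multiply
to the whole triangle in one of the two orders. -/
theorem adjacent_of_ne : ∀ a : Simple, IsEdge a → ∀ t : Simple, ∀ x ∈ flips a t,
    ∀ u : Simple, ∀ y ∈ flips a u, t ≠ u →
    mul u t = some (compl a) ∨ mul t u = some (compl a) := by
  have key : (all.all fun a => imp (isEdge a) <| all.all fun t => (flips a t).all fun _ =>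
      all.all fun u => (flips a u).all fun _ => imp (decide (t ≠ u)) <|
      decide (mul u t = some (compl a) ∨ mul t u = some (compl a))) = true := by
    decide +kernel
  simpa only [List.all_eq_true, imp_iff, decide_eq_true_iff, mem_all, forall_const] using key

end Simple

open Simple

/-- Two composable moves starting from a word of edges: if the intermediate word meets infinitely
many diagonals, the second move undoes the first one, or the result is eventually a rotated copy of
the initial word. -/
theorem back_or_rot {w t w' u w'' : ℕ → Simple} (hE : ∀ n, IsEdge (w n))
    (h₁ : ∀ n, (t (n + 1), w' n) ∈ flips (w n) (t n))
    (h₂ : ∀ n, (u (n + 1), w'' n) ∈ flips (w' n) (u n))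
    (hw : ∀ n, NonSimple (w (n + 1)) (w n)) (hw' : ∀ n, NonSimple (w' (n + 1)) (w' n))
    (hw'' : ∀ n, NonSimple (w'' (n + 1)) (w'' n)) (hd : ∀ N, ∃ n, N ≤ n ∧ ¬ IsEdge (w' n)) :
    mul (t 0) (u 0) = some (compl (w 0)) ∨ ∃ N, ∀ n, N ≤ n → rot (w'' n) = w n := by
  rw [or_iff_not_imp_left]
  intro h0
  have hnb : ∀ n, mul (t n) (u n) ≠ some (compl (w n)) := by
    intro n
    induction n with
    | zero => exact h0
    | succ n ih =>
      exact not_back_step _ (hE n) _ _ (h₁ n) _ _ (h₂ n) _ (hE (n + 1)) (hw n) _ (h₁ (n + 1))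
        (hw' n) _ (h₂ (n + 1)) (hw'' n) ih
  have hstuck : ∀ n, ¬ Stuck (w n) (t n) (u n) := by
    intro n hn
    have hall : ∀ m, Stuck (w (n + m)) (t (n + m)) (u (n + m)) := by
      intro m
      induction m with
      | zero => exact hn
      | succ m ih =>
        exact (stuck_step _ (hE _) _ _ (h₁ _) _ _ (h₂ _) _ (hE (n + m + 1)) (hw _) _ (h₁ _)
          (hw' _) _ (h₂ _) (hw'' _) ih).2
    obtain ⟨k, hk, hdk⟩ := hd n
    obtain ⟨m, rfl⟩ := Nat.exists_eq_add_of_le hk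
    exact hdk (stuck_step _ (hE _) _ _ (h₁ _) _ _ (h₂ _) _ (hE (n + m + 1)) (hw _) _ (h₁ _)
          (hw' _) _ (h₂ _) (hw'' _) (hall m)).1
  have hstep : ∀ n, ¬ IsEdge (w' n) → rot (w'' n) = w n ∧ ¬ IsEdge (w' (n + 1)) := by
    intro n hn
    exact (diagonal_step _ (hE _) _ _ (h₁ _) _ _ (h₂ _) _ (hE (n + 1)) (hw _) _ (h₁ _)
          (hw' _) _ (h₂ _) (hw'' _) hn (hnb n)).resolve_left (hstuck (n + 1))
  obtain ⟨N, -, hN⟩ := hd 0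
  have hall : ∀ m, ¬ IsEdge (w' (N + m)) := by
    intro m
    induction m with
    | zero => exact hN
    | succ m ih => exact (hstep _ ih).2
  refine ⟨N, fun n hn => ?_⟩
  obtain ⟨m, rfl⟩ := Nat.exists_eq_add_of_le hn
  exact (hstep _ (hall m)).1

/-- Of two distinct moves from a word of edges to words of edges, one does not change the word. -/
theorem eq_or_eq_of_ne {w t w' u w'' : ℕ → Simple} (hE : ∀ n, IsEdge (w n))
    (h₁ : ∀ n, (t (n + 1), w' n) ∈ flips (w n) (t n))
    (h₂ : ∀ n, (u (n + 1), w'' n) ∈ flips (w n) (u n))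
    (hw : ∀ n, NonSimple (w (n + 1)) (w n)) (hE' : ∀ n, IsEdge (w' n)) (hE'' : ∀ n, IsEdge (w'' n))
    (hne : t 0 ≠ u 0) : (∀ n, w' n = w n) ∨ (∀ n, w'' n = w n) := by
  have key : ∀ {t w' u w'' : ℕ → Simple},
      (∀ n, (t (n + 1), w' n) ∈ flips (w n) (t n)) →
      (∀ n, (u (n + 1), w'' n) ∈ flips (w n) (u n)) → (∀ n, IsEdge (w' n)) →
      (∀ n, IsEdge (w'' n)) → mul (u 0) (t 0) = some (compl (w 0)) → ∀ n, w'' n = w n := by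
    intro t w' u w'' h₁ h₂ hE' hE'' h0
    have hadj : ∀ n, mul (u n) (t n) = some (compl (w n)) := by
      intro n
      induction n with
      | zero => exact h0
      | succ n ih =>
        exact (adjacent_step _ (hE n) _ _ (h₁ n) (hE' n) _ ih _ (h₂ n) (hE'' n) _ (hE (n + 1))
          (hw n) _ (h₁ _) _ (h₂ _)).2
    intro n
    exact (adjacent_step _ (hE n) _ _ (h₁ n) (hE' n) _ (hadj n) _ (h₂ n) (hE'' n) _ (hE (n + 1))
          (hw n) _ (h₁ _) _ (h₂ _)).1
  rcases adjacent_of_ne _ (hE 0) _ _ (h₁ 0) _ _ (h₂ 0) hne with h | h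
  · exact Or.inr (key h₁ h₂ hE' hE'' h)
  · exact Or.inl (key h₂ h₁ hE'' hE' h)

end BKL4

namespace BKL4
open Simple

/-! ### Orbits -/

theorem τ_zpow_apply (k : ℤ) (y : B4) : (τ ^ k) y = conjBy y (δ ^ k) := by
  rw [τ, ← map_zpow, MulAut.conj_apply, conjBy]
  simp

theorem τ_pow_apply (k : ℕ) (y : B4) : (τ ^ k) y = conjBy y (δ ^ (k : ℤ)) := by
  rw [← τ_zpow_apply, zpow_natCast]

theorem self_mem_orbit (y : B4) : y ∈ orbit y := ⟨0, 0, by simp⟩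

namespace Atomic

variable {p : ℤ} {r : ℕ} {y z : B4}

theorem conj_δ_zpow (h : Atomic p r y) (k : ℤ) : Atomic p r (conjBy y (δ ^ k)) := by
  obtain ⟨h1, h2, h3⟩ := h.fixed_one
  have e : δ ^ k = 1 * δ ^ k := by simp
  refine h.conj_of_fixed ?_ ?_ ?_
  · rw [e, pull_mul_δ_zpow, h1]
  · rw [e, pull_mul_δ_zpow, h2]
  · nth_rw 1 [e]
    rw [slide_mul_δ_zpow, mul_assoc, ← zpow_add_one, show k + 1 = 1 + k from add_comm k 1,
      zpow_one_add, ← mul_assoc, h3, one_mul]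

theorem finalFactor_conj_δ_zpow (h : Atomic p r y) (k : ℤ) :
    finalFactor (conjBy y (δ ^ k)) = conjBy (finalFactor y) (δ ^ k) := by
  have h1 := pull_conjBy y⁻¹ (δ ^ k) (p + r - 1) 1
  have h2 := pull_mul_δ_zpow y⁻¹ (p + r - 1) k 1
  rw [one_mul, ← h.finalFactor_inv_eq] at h2
  rw [conjBy_inv, ← (h.conj_δ_zpow k).finalFactor_inv_eq, mul_one, h2] at h1
  rw [← inv_inj, ← mul_right_inj (δ ^ k), h1, conjBy]
  simp [mul_assoc]

theorem decycling_conj_δ_zpow (h : Atomic p r y) (k : ℤ) :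
    decycling (conjBy y (δ ^ k)) = conjBy (decycling y) (δ ^ k) := by
  rw [decycling, h.finalFactor_conj_δ_zpow, decycling]
  simp [conjBy, mul_assoc]

theorem iterate_decycling_conj_δ_zpow (h : Atomic p r y) (k : ℤ) (n : ℕ) :
    decycling^[n] (conjBy y (δ ^ k)) = conjBy (decycling^[n] y) (δ ^ k) := by
  induction n with
  | zero => rfl
  | succ n ih =>
    rw [Function.iterate_succ_apply', ih, (h.iterate_decycling n).decycling_conj_δ_zpow,
      Function.iterate_succ_apply']

theorem iterate_decycling_mul (h : Atomic p r y) (m : ℕ) :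
    decycling^[r * m] y = conjBy y (δ ^ (p * m)) := by
  induction m with
  | zero => simp
  | succ m ih =>
    rw [Nat.mul_succ, add_comm, Function.iterate_add_apply, ih,
      h.iterate_decycling_conj_δ_zpow, h.iterate_decycling_length]
    push_cast
    rw [mul_add, mul_one, add_comm, zpow_add, conjBy_mul]
    simp [conjBy]

theorem iterate_decycling_order (h : Atomic p r y) (m : ℕ) :
    decycling^[r * (4 * m)] y = y := by
  rw [h.iterate_decycling_mul]
  push_cast
  rw [show p * (4 * (m : ℤ)) = 4 * (p * m) by ring, ← one_mul (δ ^ _), conjBy_mul_δ_pow_four,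
    conjBy_one]

theorem iterate_cycling_iterate_decycling (h : Atomic p r y) (n : ℕ) :
    cycling^[n] (decycling^[n] y) = y := by
  induction n with
  | zero => rfl
  | succ n ih =>
    rw [Function.iterate_succ_apply, Function.iterate_succ_apply' (f := decycling),
      (h.iterate_decycling n).cycling_decycling, ih]

/-- Cycling undoes decycling, and `4 * r` decyclings are the identity, so cycling is itself an
iterate of decycling. -/
theorem iterate_cycling_eq (h : Atomic p r y) {n m : ℕ} (hn : n ≤ r * (4 * m)) :
    cycling^[n] y = decycling^[r * (4 * m) - n] y := by
  obtain ⟨k, hk⟩ := Nat.exists_eq_add_of_le hn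
  conv_lhs => rw [← h.iterate_decycling_order m, hk, Function.iterate_add_apply]
  rw [(h.iterate_decycling k).iterate_cycling_iterate_decycling, hk, Nat.add_sub_cancel_left]

theorem exists_iterate_cycling_eq (h : Atomic p r y) (n : ℕ) :
    ∃ m, cycling^[n] y = decycling^[m] y := by
  refine ⟨_, h.iterate_cycling_eq (m := n) ?_⟩
  calc n ≤ 4 * n := by omega
    _ ≤ r * (4 * n) := Nat.le_mul_of_pos_left _ h.pos

theorem exists_iterate_decycling_eq (h : Atomic p r y) (n : ℕ) :
    ∃ m, decycling^[n] y = cycling^[m] y := by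
  have hn : n ≤ r * (4 * n) := by
    calc n ≤ 4 * n := by omega
      _ ≤ r * (4 * n) := Nat.le_mul_of_pos_left _ h.pos
  refine ⟨r * (4 * n) - n, ?_⟩
  rw [h.iterate_cycling_eq (m := n) (Nat.sub_le _ _), Nat.sub_sub_self hn]

theorem mem_orbit_iff (h : Atomic p r y) :
    z ∈ orbit y ↔ ∃ (k : ℤ) (l : ℕ), z = conjBy (decycling^[l] y) (δ ^ k) := by
  constructor
  · rintro ⟨k, l, rfl⟩
    obtain ⟨m, hm⟩ := h.exists_iterate_cycling_eq l
    exact ⟨k, m, by rw [τ_pow_apply, hm]⟩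
  · rintro ⟨k, l, rfl⟩
    obtain ⟨m, hm⟩ := h.exists_iterate_decycling_eq l
    refine ⟨(k % 4).toNat, m, ?_⟩
    rw [τ_pow_apply, hm]
    have hk : k = ((k % 4).toNat : ℤ) + 4 * (k / 4) := by omega
    conv_lhs => rw [hk, zpow_add, conjBy_mul_δ_pow_four]

theorem of_mem_orbit (h : Atomic p r y) (hz : z ∈ orbit y) : Atomic p r z := by
  obtain ⟨k, l, rfl⟩ := h.mem_orbit_iff.1 hz
  exact (h.iterate_decycling l).conj_δ_zpow k

theorem orbit_eq_of_mem (h : Atomic p r y) (hz : z ∈ orbit y) : orbit z = orbit y := by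
  have hza := h.of_mem_orbit hz
  obtain ⟨k, l, rfl⟩ := h.mem_orbit_iff.1 hz
  have hl := h.iterate_decycling l
  ext u
  rw [hza.mem_orbit_iff, h.mem_orbit_iff]
  constructor
  · rintro ⟨k', l', rfl⟩
    refine ⟨k + k', l' + l, ?_⟩
    rw [hl.iterate_decycling_conj_δ_zpow, ← conjBy_mul, ← zpow_add, Function.iterate_add_apply]
  · rintro ⟨k', l', rfl⟩
    have hn : l ≤ r * (4 * l) := by
      calc l ≤ 4 * l := by omega
        _ ≤ r * (4 * l) := Nat.le_mul_of_pos_left _ h.pos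
    refine ⟨k' - k, l' + (r * (4 * l) - l), ?_⟩
    rw [hl.iterate_decycling_conj_δ_zpow, ← conjBy_mul, ← zpow_add, add_sub_cancel,
      ← Function.iterate_add_apply, add_assoc, Nat.sub_add_cancel hn, Function.iterate_add_apply,
      h.iterate_decycling_order]

theorem orbit_conj_δ_zpow (h : Atomic p r y) (k : ℤ) : orbit (conjBy y (δ ^ k)) = orbit y :=
  h.orbit_eq_of_mem (h.mem_orbit_iff.2 ⟨k, 0, rfl⟩)

theorem orbit_iterate_decycling (h : Atomic p r y) (n : ℕ) : orbit (decycling^[n] y) = orbit y :=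
  h.orbit_eq_of_mem (h.mem_orbit_iff.2 ⟨0, n, by simp⟩)

/-- Since `r` decyclings equal `τ ^ p` and `τ` has order dividing four, exponents matter only modulo
`r` and modulo `4`. -/
theorem encard_orbit_le (h : Atomic p r y) : (orbit y).encard ≤ ((4 * r : ℕ) : ℕ∞) := by
  classical
  have hsub : orbit y ⊆ ((Finset.range 4 ×ˢ Finset.range r).image
      fun q : ℕ × ℕ => conjBy (decycling^[q.2] y) (δ ^ (q.1 : ℤ)) : Finset B4) := by
    intro z hz
    obtain ⟨k, l, rfl⟩ := h.mem_orbit_iff.1 hz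
    have hl : l = l % r + r * (l / r) := (Nat.mod_add_div l r).symm
    set j := p * ((l / r : ℕ) : ℤ) + k with hj
    have hj' : j = ((j % 4).toNat : ℤ) + 4 * (j / 4) := by omega
    rw [Finset.mem_coe, Finset.mem_image]
    refine ⟨((j % 4).toNat, l % r), ?_, ?_⟩
    · rw [Finset.mem_product, Finset.mem_range, Finset.mem_range]
      exact ⟨by simp only; omega, Nat.mod_lt _ h.pos⟩
    · conv_rhs => rw [hl, Function.iterate_add_apply, h.iterate_decycling_mul,
        h.iterate_decycling_conj_δ_zpow, ← conjBy_mul, ← zpow_add, ← hj, hj', zpow_add,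
        conjBy_mul_δ_pow_four]
  refine (Set.encard_le_encard hsub).trans ?_
  rw [Set.encard_coe_eq_coe_finsetCard]
  refine Nat.cast_le.2 (Finset.card_image_le.trans ?_)
  rw [Finset.card_product, Finset.card_range, Finset.card_range]

end Atomic

/-! ### Conjugations by atoms -/

/-- Transport of a conjugating element along iterated decycling. -/
noncomputable def transport (y z t : B4) (n : ℕ) : B4 := acc y n * t * (acc z n)⁻¹

theorem transport_succ (y z t : B4) (n : ℕ) : transport y z t (n + 1) =
    finalFactor (decycling^[n] y) * transport y z t n * (finalFactor (decycling^[n] z))⁻¹ := by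
  simp [transport, acc, mul_assoc]

theorem conjBy_transport {y z t : B4} (h : conjBy y t = z) (n : ℕ) :
    conjBy (decycling^[n] y) (transport y z t n) = decycling^[n] z := by
  rw [iterate_decycling_eq, iterate_decycling_eq z, transport, ← conjBy_mul, ← h, ← conjBy_mul]
  simp [mul_assoc]

namespace Atomic

variable {p : ℤ} {r : ℕ} {y z t : B4}

/-- Monotonicity of `pull y⁻¹` applied to `1 ≤ t` compares `(finalFactor y)⁻¹` with `t *
(finalFactor z)⁻¹`. The length is preserved because both final factors are atoms. -/
theorem transport_step (hy : Atomic p r y) (hz : Atomic p r z) (h : conjBy y t = z) (ht : 1 ≤ t)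
    (hl : len t = 1) : 1 ≤ finalFactor y * t * (finalFactor z)⁻¹ ∧
      len (finalFactor y * t * (finalFactor z)⁻¹) = 1 := by
  constructor
  · have h1 := pull_mono y⁻¹ (p + r - 1) ht
    have h2 := pull_conjBy y⁻¹ t (p + r - 1) 1
    rw [conjBy_inv, h, ← hz.finalFactor_inv_eq, mul_one] at h2
    rw [← h2, ← hy.finalFactor_inv_eq] at h1
    have := mul_le_mul_right h1 (finalFactor y)
    rwa [mul_inv_cancel, ← mul_assoc] at this
  · rw [len_mul, len_mul, len_inv, hl, hy.len_of_mem_factors hy.finalFactor_mem,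
      hz.len_of_mem_factors hz.finalFactor_mem]
    rfl

theorem transport_spec (hy : Atomic p r y) (hz : Atomic p r z) (h : conjBy y t = z) (ht : 1 ≤ t)
    (hl : len t = 1) (n : ℕ) : 1 ≤ transport y z t n ∧ len (transport y z t n) = 1 := by
  induction n with
  | zero => simpa [transport, acc] using ⟨ht, hl⟩
  | succ n ih =>
    rw [transport_succ]
    exact (hy.iterate_decycling n).transport_step (hz.iterate_decycling n)
      (conjBy_transport h n) ih.1 ih.2

end Atomic

theorem head_mul_toB4 {s t : Simple} (ht : t ≠ one) : head (s.toB4 * t.toB4) = fstN s t := by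
  have h : (nfHom (s.toB4 * t.toB4) nfOne).1 = reduce 0 (act s (act t [])) := by
    rw [map_mul, nfHom_toB4, nfHom_toB4, Equiv.Perm.mul_apply]
    change gact s (reduce 0 (act t [])) = _
    rw [gact_reduce, zpow_zero]; rfl
  rw [head_of_reduce h]
  simp [act, ht]

theorem mul_of_two_atoms : ∀ a : Simple, a.IsAtom → ∀ t : Simple, t.IsAtom → ∀ t' : Simple,
    t'.IsAtom → t' ≠ a → a.Dvd (fstN a t) → t'.Dvd (fstN a t) → mul a t = some (fstN a t) := by
  decide +kernel

theorem ne_one_of_isAtom {a : Simple} (h : a.IsAtom) : a ≠ one := by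
  rintro rfl
  exact absurd h (by decide)

/-- Two distinct atoms dividing `a t` on the left force this product to be simple, which places the
equality inside the germ. -/
theorem mem_flips_of_mul_eq {a t t' b : Simple} (ha : a.IsAtom) (ht : t.IsAtom) (ht' : t'.IsAtom)
    (hne : t' ≠ a) (h : a.toB4 * t.toB4 = t'.toB4 * b.toB4) : (t', b) ∈ flips a t := by
  have hh := head_mul_toB4 (s := a) (ne_one_of_isAtom ht)
  have h1 : a.Dvd (fstN a t) := by
    rw [← hh]; exact dvd_head_toB4_mul (toB4_mem_positive t) a
  have h2 : t'.Dvd (fstN a t) := by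
    rw [← hh, h]; exact dvd_head_toB4_mul (toB4_mem_positive b) t'
  have h3 := mul_of_two_atoms a ha t ht t' ht' hne h1 h2
  obtain ⟨c, hc⟩ := h2
  have h4 : c = b := by
    apply toB4_injective
    have := (toB4_mul hc).trans ((toB4_mul h3).symm.trans h)
    exact mul_left_cancel this
  exact mem_flips a t _ h3 ha ht t' ht' hne b (h4 ▸ hc)

/-- The atoms occurring in the normal forms of the iterated decyclings. -/
noncomputable def atomSeq (y : B4) (n : ℕ) : Simple := lastAtom (decycling^[n] y)

namespace Atomic

variable {p : ℤ} {r : ℕ} {y z : B4}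

theorem finalFactor_iterate (hy : Atomic p r y) (n : ℕ) :
    finalFactor (decycling^[n] y) = (atomSeq y n).toB4 :=
  (hy.iterate_decycling n).finalFactor_eq_toB4.1

theorem atomSeq_isAtom (hy : Atomic p r y) (n : ℕ) : (atomSeq y n).IsAtom :=
  (hy.iterate_decycling n).finalFactor_eq_toB4.2

theorem nonSimple_atomSeq (hy : Atomic p r y) (n : ℕ) :
    NonSimple (atomSeq y (n + 1)) (atomSeq y n) := by
  have h := (hy.iterate_decycling n).lw_lastAtom
  rw [← Function.iterate_succ_apply' decycling] at h
  exact h.nonSimple _ _ (ne_one_of_isAtom (hy.atomSeq_isAtom n))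

theorem exists_flips (hy : Atomic p r y) (hz : Atomic p r z) {a : Simple} (ha : a.IsAtom)
    (h : conjBy y a.toB4 = z) (hne : orbit z ≠ orbit y) :
    ∃ T : ℕ → Simple, T 0 = a ∧ (∀ n, (T (n + 1), atomSeq z n) ∈ flips (atomSeq y n) (T n)) ∧
      ∀ n, (T n).IsAtom ∧ conjBy (decycling^[n] y) (T n).toB4 = decycling^[n] z := by
  have hspec := hy.transport_spec hz h (atom_one_le a) (by rw [len_toB4]; exact ha)
  have hT : ∀ n, ∃ s : Simple, s.IsAtom ∧ transport y z a.toB4 n = s.toB4 := fun n =>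
    eq_toB4_of_len_eq_one (one_le_iff.1 (hspec n).1) (hspec n).2
  choose T hT1 hT2 using hT
  have hconj : ∀ n, conjBy (decycling^[n] y) (T n).toB4 = decycling^[n] z := fun n => by
    rw [← hT2]; exact conjBy_transport h n
  refine ⟨T, ?_, fun n => ?_, fun n => ⟨hT1 n, hconj n⟩⟩
  · apply toB4_injective
    rw [← hT2]; simp [transport, acc]
  · refine mem_flips_of_mul_eq (hy.atomSeq_isAtom n) (hT1 n) (hT1 (n + 1)) ?_ ?_
    -- If the moving atom were the letter just read, conjugation by it would undo that decycling,
    -- putting `z` in the orbit of `y`.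
    · intro heq
      apply hne
      have h1 := hconj (n + 1)
      rw [heq, ← hy.finalFactor_iterate, Function.iterate_succ_apply', decycling, ← conjBy_mul,
        inv_mul_cancel, conjBy_one] at h1
      rw [← hz.orbit_iterate_decycling (n + 1), ← h1, hy.orbit_iterate_decycling]
    · have h1 := transport_succ y z a.toB4 n
      rw [hT2, hT2, hy.finalFactor_iterate, hz.finalFactor_iterate, eq_mul_inv_iff_mul_eq] at h1
      exact h1.symm

end Atomic

end BKL4

namespace BKL4
open Simple

/-! ### Words of edges -/

theorem conjBy_toB4_δ (s : Simple) : conjBy s.toB4 δ = (rot s).toB4 := by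
  rw [conjBy, mul_assoc, toB4_mul_δ, inv_mul_cancel_left]

theorem isEdge_rot (s : Simple) : IsEdge (rot s) ↔ IsEdge s := by cases s <;> decide

theorem atomSeq_iterate_decycling (y : B4) (m n : ℕ) :
    atomSeq (decycling^[m] y) n = atomSeq y (n + m) := by
  rw [atomSeq, ← Function.iterate_add_apply, atomSeq]

/-- All the atoms met along iterated decycling are sides of the square. -/
def EdgeType (y : B4) : Prop := ∀ n, IsEdge (atomSeq y n)

namespace Atomic

variable {p : ℤ} {r : ℕ} {y z v w : B4}

theorem atomSeq_conj_δ (h : Atomic p r y) (n : ℕ) :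
    atomSeq (conjBy y δ) n = rot (atomSeq y n) := by
  apply toB4_injective
  have h1 := h.iterate_decycling_conj_δ_zpow 1 n
  have h2 := (h.iterate_decycling n).finalFactor_conj_δ_zpow 1
  rw [zpow_one] at h1 h2
  rw [← h.conj_δ.finalFactor_iterate, h1, h2, h.finalFactor_iterate, conjBy_toB4_δ]

theorem isEdge_atomSeq_conj_δ_zpow (h : Atomic p r y) (k : ℤ) (n : ℕ) :
    IsEdge (atomSeq (conjBy y (δ ^ k)) n) ↔ IsEdge (atomSeq y n) := by
  have hs : ∀ k : ℤ, conjBy y (δ ^ (k + 1)) = conjBy (conjBy y (δ ^ k)) δ := fun k => by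
    rw [zpow_add_one, conjBy_mul]
  induction k with
  | zero => simp
  | succ k ih => rw [hs, (h.conj_δ_zpow _).atomSeq_conj_δ]; exact (isEdge_rot _).trans ih
  | pred k ih =>
    refine Iff.trans ?_ ih
    rw [← isEdge_rot, ← (h.conj_δ_zpow _).atomSeq_conj_δ, ← hs, sub_add_cancel]

theorem edgeType_of_mem_orbit (h : Atomic p r y) (hE : EdgeType y) (hz : z ∈ orbit y) :
    EdgeType z := by
  obtain ⟨k, l, rfl⟩ := h.mem_orbit_iff.1 hz
  intro n
  rw [(h.iterate_decycling l).isEdge_atomSeq_conj_δ_zpow, atomSeq_iterate_decycling]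
  exact hE _

theorem frequently_not_isEdge (h : Atomic p r y) (hE : ¬ EdgeType y) (N : ℕ) :
    ∃ n, N ≤ n ∧ ¬ IsEdge (atomSeq y n) := by
  obtain ⟨n, hn⟩ := not_forall.1 hE
  refine ⟨n + r * (4 * N), ?_, ?_⟩
  · have : 4 * N ≤ r * (4 * N) := Nat.le_mul_of_pos_left _ h.pos
    omega
  · rwa [← atomSeq_iterate_decycling, h.iterate_decycling_order]

theorem edgeType_of_forall_lt (h : Atomic p r y) (hE : ∀ n < r, IsEdge (atomSeq y n)) :
    EdgeType y := by
  intro n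
  rw [← Nat.mod_add_div n r, ← atomSeq_iterate_decycling, h.iterate_decycling_mul,
    h.isEdge_atomSeq_conj_δ_zpow]
  exact hE _ (Nat.mod_lt _ h.pos)

theorem orbit_eq_of_atomSeq (hy : Atomic p r y) (hz : Atomic p r z) (N : ℕ)
    (h : ∀ n, N ≤ n → atomSeq y n = atomSeq z n) : orbit y = orbit z := by
  rw [← hy.orbit_iterate_decycling N, ← hz.orbit_iterate_decycling N]
  congr 1
  refine (hy.iterate_decycling N).eq_of_finalFactor (hz.iterate_decycling N) fun n => ?_
  rw [(hy.iterate_decycling N).finalFactor_iterate, (hz.iterate_decycling N).finalFactor_iterate,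
    atomSeq_iterate_decycling, atomSeq_iterate_decycling, h _ (Nat.le_add_left _ _)]

theorem rightComplement_finalFactor_eq (h : Atomic p r y) :
    (finalFactor y)⁻¹ * δ = (compl (atomSeq y 0)).toB4 := by
  rw [inv_mul_eq_iff_eq_mul, show finalFactor y = _ from h.finalFactor_iterate 0]
  exact (toB4_mul (mul_compl _)).symm

theorem conj_rightComplement (h : Atomic p r y) :
    Atomic p r (conjBy y ((finalFactor y)⁻¹ * δ)) := by
  rw [conjBy_mul]; exact h.atomic_decycling.conj_δ

theorem orbit_conj_rightComplement (h : Atomic p r y) :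
    orbit (conjBy y ((finalFactor y)⁻¹ * δ)) = orbit y := by
  have h1 := h.atomic_decycling.orbit_conj_δ_zpow 1
  rw [zpow_one] at h1
  rw [conjBy_mul]
  exact h1.trans (h.orbit_iterate_decycling 1)

/-! ### Moves between orbits -/

/-- After a move from a word of edges to a word with a diagonal, a second move does not lead to a
new orbit. -/
theorem orbit_eq_or_of_not_edgeType (hy : Atomic p r y) (hE : EdgeType y) {a u : Simple}
    (ha : a.IsAtom) (hu : u.IsAtom) (hz : Atomic p r (conjBy y a.toB4))
    (hv : Atomic p r (conjBy (conjBy y a.toB4) u.toB4)) (hne : orbit (conjBy y a.toB4) ≠ orbit y)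
    (hnE : ¬ EdgeType (conjBy y a.toB4)) :
    orbit (conjBy (conjBy y a.toB4) u.toB4) = orbit y ∨
      orbit (conjBy (conjBy y a.toB4) u.toB4) = orbit (conjBy y a.toB4) := by
  by_cases hvz : orbit (conjBy (conjBy y a.toB4) u.toB4) = orbit (conjBy y a.toB4)
  · exact Or.inr hvz
  left
  obtain ⟨t, ht0, ht, -⟩ := hy.exists_flips hz ha rfl hne
  obtain ⟨s, hs0, hs, -⟩ := hz.exists_flips hv hu rfl hvz
  rcases back_or_rot hE ht hs hy.nonSimple_atomSeq hz.nonSimple_atomSeq hv.nonSimple_atomSeq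
    (hz.frequently_not_isEdge hnE) with h | ⟨N, hN⟩
  -- Here the two atoms multiply to the complement of the final factor, which conjugates `y` to a
  -- rotated decycling of itself.
  · rw [ht0, hs0] at h
    rw [← conjBy_mul, toB4_mul h, ← hy.rightComplement_finalFactor_eq,
      hy.orbit_conj_rightComplement]
  · have h1 := hv.orbit_conj_δ_zpow 1
    rw [zpow_one] at h1
    rw [← h1]
    exact hv.conj_δ.orbit_eq_of_atomSeq hy N fun n hn => by rw [hv.atomSeq_conj_δ, hN n hn]

theorem eq_of_edgeType (hy : Atomic p r y) (hE : EdgeType y) {a b : Simple}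
    (ha : a.IsAtom) (hb : b.IsAtom) (hz : Atomic p r (conjBy y a.toB4))
    (hv : Atomic p r (conjBy y b.toB4)) (hzE : EdgeType (conjBy y a.toB4))
    (hvE : EdgeType (conjBy y b.toB4)) (hzne : orbit (conjBy y a.toB4) ≠ orbit y)
    (hvne : orbit (conjBy y b.toB4) ≠ orbit y) : a = b := by
  by_contra hab
  obtain ⟨t, ht0, ht, -⟩ := hy.exists_flips hz ha rfl hzne
  obtain ⟨s, hs0, hs, -⟩ := hy.exists_flips hv hb rfl hvne
  rcases eq_or_eq_of_ne hE ht hs hy.nonSimple_atomSeq hzE hvE (by rwa [ht0, hs0]) with h | h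
  · exact hzne (hz.orbit_eq_of_atomSeq hy 0 fun n _ => h n)
  · exact hvne (hv.orbit_eq_of_atomSeq hy 0 fun n _ => h n)

/-- Moves can be performed from any element of an orbit. -/
theorem exists_conj_of_mem_orbit (hw : Atomic p r w) (hz : z ∈ orbit w) {c : Simple}
    (hc : c.IsAtom) (hv : Atomic p r (conjBy w c.toB4)) :
    ∃ c' : Simple, c'.IsAtom ∧ Atomic p r (conjBy z c'.toB4) ∧
      orbit (conjBy z c'.toB4) = orbit (conjBy w c.toB4) := by
  obtain ⟨k, l, rfl⟩ := hw.mem_orbit_iff.1 hz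
  obtain ⟨h1, h2⟩ := hw.transport_spec hv rfl (atom_one_le c) (by rw [len_toB4]; exact hc) l
  have h3 := conjBy_transport (y := w) (t := c.toB4) rfl l
  obtain ⟨c', hc', he⟩ := eq_toB4_of_len_eq_one (conj_δ_zpow_mem (one_le_iff.1 h1) k)
    (by simpa using h2)
  have h4 : conjBy (conjBy (decycling^[l] w) (δ ^ k)) c'.toB4 =
      conjBy (decycling^[l] (conjBy w c.toB4)) (δ ^ k) := by
    rw [← he, ← h3, ← conjBy_mul, ← conjBy_mul]
    congr 1
    simp [mul_assoc]
  have hl := hv.iterate_decycling l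
  exact ⟨c', hc', h4 ▸ hl.conj_δ_zpow k,
    by rw [h4, hl.orbit_conj_δ_zpow, hv.orbit_iterate_decycling]⟩

/-- Take `s` of least length among the nontrivial simple conjugators below `v`. Admissible
conjugators are closed under meets, so `s` either divides the complement of the final factor, of
length two, or is coprime to it. -/
theorem exists_minimal_conj (hy : Atomic p r y) (hv1 : 1 ≤ v) (hv : v ≠ 1)
    (hyv : Atomic p r (conjBy y v)) : ∃ s, 1 ≤ s ∧ s ≤ v ∧ s ≠ 1 ∧ Atomic p r (conjBy y s) ∧
      ((∃ a : Simple, a.IsAtom ∧ s = a.toB4) ∨ s = (finalFactor y)⁻¹ * δ) := by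
  let S : Set B4 := {s | 1 ≤ s ∧ s ≤ v ∧ s ≤ δ ∧ s ≠ 1 ∧ Atomic p r (conjBy y s)}
  have hS : S.Nonempty := ⟨v ⊓ δ, le_inf hv1 one_le_δ, inf_le_left, inf_le_right,
    inf_δ_ne_one hv1 hv, hy.conj_inf hyv hy.conj_δ⟩
  obtain ⟨s, ⟨h1, h2, h3, h4, h5⟩, hmin⟩ :=
    (measure fun s : B4 => (len s).toNat).wf.has_min S hS
  refine ⟨s, h1, h2, h4, h5, ?_⟩
  have hpos := len_pos h1 h4
  have atom_of_len : len s ≤ 1 → ∃ a : Simple, a.IsAtom ∧ s = a.toB4 := fun h =>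
    eq_toB4_of_len_eq_one (one_le_iff.1 h1) (by omega)
  have hφ := hy.len_of_mem_factors hy.finalFactor_mem
  by_cases hm : (finalFactor y)⁻¹ * δ ⊓ s = 1
  · left
    apply atom_of_len
    have hn := isNormalForm y
    obtain ⟨L, hL⟩ := eq_append_of_pos hy.one_le_canonicalLength
    have hss : IsSimple s := ⟨h1, h3⟩
    have hchain : (factors y ++ [s]).IsChain LeftWeighted := by
      rw [List.isChain_append]
      refine ⟨hn.leftWeighted, by simp, fun a ha b hb => ?_⟩
      rw [hL] at ha
      have ha' : finalFactor y = a := by simpa using ha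
      have hb' : s = b := by simpa using hb
      rw [← ha', ← hb', leftWeighted_iff]
      exact hm
    -- In the coprime case appending `s` keeps the word left-weighted. The bound `δ ^ p ≤ s⁻¹ y s`
    -- makes the twist of `s` a prefix of that word, hence of its first letter, an atom.
    have hle : δ ^ (-p) * s * δ ^ p ≤ (factors y ++ [s]).prod := by
      have h6 := h5.rig.inf_le
      have h7 := mul_le_mul_right (mul_le_mul_right h6 s) (δ ^ (-p))
      have h8 : (factors y).prod = δ ^ (-p) * y := by
        rw [zpow_neg, eq_inv_mul_iff_mul_eq]; exact hy.eq_prod.symm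
      rw [List.prod_append, List.prod_singleton, h8]
      simpa [conjBy, mul_assoc] using h7
    have hle' : δ ^ (-p) * s * δ ^ p ≤ δ := by
      have h1 := mul_le_mul_right ((mul_δ_zpow_le_iff p).2 h3) (δ ^ (-p))
      have h2 : δ ^ (-p) * (δ * δ ^ p) = δ := by
        rw [← zpow_one_add, ← zpow_add]; simp
      rw [h2, ← mul_assoc] at h1
      exact h1
    cases hf : factors y with
    | nil => rw [hf] at hL; simp at hL
    | cons f M =>
      rw [hf] at hchain hle
      have h6 := prod_inf_δ (s := f) (L := M ++ [s]) (by
        intro t ht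
        rw [← List.cons_append, ← hf, List.mem_append, List.mem_singleton] at ht
        rcases ht with ht | rfl
        · exact hn.simple t ht
        · exact hss) hchain
      have h7 := len_mono (h6 ▸ le_inf hle hle')
      have h8 := hy.len_of_mem_factors (s := f) (by rw [hf]; simp)
      simpa [h8] using h7
  · have h6 : (finalFactor y)⁻¹ * δ ⊓ s ∈ S := by
      refine ⟨le_inf ?_ h1, inf_le_right.trans h2, inf_le_right.trans h3, hm,
        hy.conj_inf hy.conj_rightComplement h5⟩
      rw [hy.rightComplement_finalFactor_eq]
      exact atom_one_le _
    have h7 : ¬ (len ((finalFactor y)⁻¹ * δ ⊓ s)).toNat < (len s).toNat := hmin _ h6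
    have h8 : (finalFactor y)⁻¹ * δ ⊓ s = s := eq_of_le_of_len inf_le_right (by omega)
    have h9 : s ≤ (finalFactor y)⁻¹ * δ := inf_eq_right.1 h8
    have h10 : len ((finalFactor y)⁻¹ * δ) = 2 := by
      rw [len_mul, len_inv, hφ, len_δ]; rfl
    by_cases h11 : len s ≤ 1
    · exact Or.inl (atom_of_len h11)
    · exact Or.inr (eq_of_le_of_len h9 (by omega))

/-- A set of orbits which is closed under moves contains all the orbits. -/
theorem orbit_mem_of_closed {T : Set (Set B4)}
    (hT : ∀ (z : B4) (a : Simple), Atomic p r z → orbit z ∈ T → a.IsAtom →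
      Atomic p r (conjBy z a.toB4) → orbit (conjBy z a.toB4) ∈ T)
    (hy : Atomic p r y) (hyT : orbit y ∈ T) (hv1 : 1 ≤ v) (hyv : Atomic p r (conjBy y v)) :
    orbit (conjBy y v) ∈ T := by
  induction hn : (len v).toNat using Nat.strong_induction_on generalizing y v with
  | _ n ih =>
    by_cases hv : v = 1
    · rw [hv, conjBy_one]; exact hyT
    obtain ⟨s, h1, h2, h3, h4, h5⟩ := hy.exists_minimal_conj hv1 hv hyv
    have e : conjBy y v = conjBy (conjBy y s) (s⁻¹ * v) := by
      rw [← conjBy_mul, mul_inv_cancel_left]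
    have hsT : orbit (conjBy y s) ∈ T := by
      rcases h5 with ⟨a, ha, rfl⟩ | rfl
      · exact hT y a hy hyT ha h4
      · rwa [hy.orbit_conj_rightComplement]
    have h6 : 1 ≤ s⁻¹ * v := by simpa using mul_le_mul_right h2 s⁻¹
    have h7 := len_mono h6
    have h8 := len_pos h1 h3
    rw [len_one, len_mul, len_inv] at h7
    rw [e]
    exact ih _ (by rw [← hn, len_mul, len_inv]; omega) h4 hsT h6 (e ▸ hyv) rfl

end Atomic

/-! ### Counting orbits -/

/-- The orbits reached from `y` by the moves which divide the complement of the final factor. -/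
def neighbours (p : ℤ) (r : ℕ) (y : B4) : Set (Set B4) :=
  {O | ∃ a : Simple, a.IsAtom ∧ a.Dvd (compl (atomSeq y 0)) ∧ Atomic p r (conjBy y a.toB4) ∧
    O = orbit (conjBy y a.toB4)}

theorem length_filter_atoms_dvd_le : ∀ s : Simple, s.IsAtom →
    (all.filter fun a => decide (a.IsAtom ∧ a.Dvd (compl s))).length ≤ 3 := by
  decide +kernel

theorem dvd_compl_of_mem_flips : ∀ s a : Simple, ∀ x ∈ flips s a, a.Dvd (compl s) := by
  decide +kernel

theorem isAtom_of_mul_eq_compl : ∀ s : Simple, s.IsAtom → ∀ a : Simple, a.IsAtom → ∀ b : Simple,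
    mul a b = some (compl s) → b.IsAtom := by
  decide +kernel

namespace Atomic

variable {p : ℤ} {r : ℕ} {y z v w : B4}

theorem encard_neighbours_le (hy : Atomic p r y) : (neighbours p r y).encard ≤ 3 := by
  classical
  set l := all.filter fun a => decide (a.IsAtom ∧ a.Dvd (compl (atomSeq y 0))) with hl
  have hsub : neighbours p r y ⊆
      (l.toFinset.image fun a : Simple => orbit (conjBy y a.toB4) : Finset (Set B4)) := by
    rintro O ⟨a, ha, hd, -, rfl⟩
    rw [Finset.mem_coe, Finset.mem_image]
    refine ⟨a, ?_, rfl⟩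
    rw [List.mem_toFinset, hl, List.mem_filter]
    exact ⟨mem_all a, decide_eq_true ⟨ha, hd⟩⟩
  refine (Set.encard_le_encard hsub).trans ?_
  rw [Set.encard_coe_eq_coe_finsetCard]
  exact_mod_cast Finset.card_image_le.trans ((List.toFinset_card_le l).trans
    (length_filter_atoms_dvd_le _ (hy.atomSeq_isAtom 0)))

theorem dvd_compl (hy : Atomic p r y) {a : Simple} (ha : a.IsAtom)
    (hz : Atomic p r (conjBy y a.toB4)) (hne : orbit (conjBy y a.toB4) ≠ orbit y) :
    a.Dvd (compl (atomSeq y 0)) := by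
  obtain ⟨t, ht0, ht, -⟩ := hy.exists_flips hz ha rfl hne
  exact ht0 ▸ dvd_compl_of_mem_flips _ _ _ (ht 0)

theorem mem_neighbours (hy : Atomic p r y) {a : Simple} (ha : a.IsAtom)
    (hz : Atomic p r (conjBy y a.toB4)) (hne : orbit (conjBy y a.toB4) ≠ orbit y) :
    orbit (conjBy y a.toB4) ∈ neighbours p r y :=
  ⟨a, ha, hy.dvd_compl ha hz hne, hz, rfl⟩

theorem orbit_conj_mem (hy : Atomic p r y) {T : Set (Set B4)} (hyT : orbit y ∈ T)
    (hN : neighbours p r y ⊆ T) (hw : Atomic p r w) (hwy : orbit w = orbit y) {c : Simple}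
    (hc : c.IsAtom) (hv : Atomic p r (conjBy w c.toB4)) : orbit (conjBy w c.toB4) ∈ T := by
  obtain ⟨c', hc', hv', he⟩ := hw.exists_conj_of_mem_orbit (hwy ▸ self_mem_orbit y) hc hv
  rw [← he]
  by_cases h : orbit (conjBy y c'.toB4) = orbit y
  · rwa [h]
  · exact hN (hy.mem_neighbours hc' hv' h)

theorem orbit_conj_mem_of_neighbours (hy : Atomic p r y) (hE : EdgeType y) {T : Set (Set B4)}
    (hyT : orbit y ∈ T) (hN : neighbours p r y ⊆ T)
    (hT : ∀ a : Simple, a.IsAtom → Atomic p r (conjBy y a.toB4) → EdgeType (conjBy y a.toB4) →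
      orbit (conjBy y a.toB4) ≠ orbit y → ∀ c : Simple, c.IsAtom →
      Atomic p r (conjBy (conjBy y a.toB4) c.toB4) →
      orbit (conjBy (conjBy y a.toB4) c.toB4) ∈ T)
    (hw : Atomic p r w) (hwN : orbit w ∈ neighbours p r y) {c : Simple} (hc : c.IsAtom)
    (hv : Atomic p r (conjBy w c.toB4)) : orbit (conjBy w c.toB4) ∈ T := by
  obtain ⟨a, ha, -, hz, he⟩ := hwN
  by_cases hne : orbit (conjBy y a.toB4) = orbit y
  · exact hy.orbit_conj_mem hyT hN hw (he.trans hne) hc hv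
  obtain ⟨c', hc', hv', he'⟩ := hw.exists_conj_of_mem_orbit (z := conjBy y a.toB4)
    (by rw [he]; exact self_mem_orbit _) hc hv
  rw [← he']
  by_cases hzE : EdgeType (conjBy y a.toB4)
  · exact hT a ha hz hzE hne c' hc' hv'
  · rcases hy.orbit_eq_or_of_not_edgeType hE ha hc' hz hv' hne hzE with h | h
    · rwa [h]
    · rw [h]; exact hN (hy.mem_neighbours ha hz hne)

/-- Starting from a word of edges, at most six orbits can be reached by moves. -/
theorem exists_closed (hy : Atomic p r y) (hE : EdgeType y) :
    ∃ T : Set (Set B4), T.encard ≤ 6 ∧ orbit y ∈ T ∧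
      ∀ (w : B4) (c : Simple), Atomic p r w → orbit w ∈ T → c.IsAtom →
        Atomic p r (conjBy w c.toB4) → orbit (conjBy w c.toB4) ∈ T := by
  by_cases h : ∃ a : Simple, a.IsAtom ∧ Atomic p r (conjBy y a.toB4) ∧
      EdgeType (conjBy y a.toB4) ∧ orbit (conjBy y a.toB4) ≠ orbit y
  · obtain ⟨a, ha, hz, hzE, hne⟩ := h
    -- Completing `a` to the complement of the final factor yields an atom `b` leading from the
    -- second centre back to the orbit of `y`. Each centre is thus the unique side-word neighbour of
    -- the other.
    obtain ⟨b, hb⟩ := hy.dvd_compl ha hz hne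
    have hbA := isAtom_of_mul_eq_compl _ (hy.atomSeq_isAtom 0) a ha b hb
    have hconj : conjBy (conjBy y a.toB4) b.toB4 = conjBy y ((finalFactor y)⁻¹ * δ) := by
      rw [← conjBy_mul, toB4_mul hb, hy.rightComplement_finalFactor_eq]
    have hy' : Atomic p r (conjBy (conjBy y a.toB4) b.toB4) := hconj ▸ hy.conj_rightComplement
    have horb : orbit (conjBy (conjBy y a.toB4) b.toB4) = orbit y := by
      rw [hconj, hy.orbit_conj_rightComplement]
    have hE' : EdgeType (conjBy (conjBy y a.toB4) b.toB4) :=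
      hy.edgeType_of_mem_orbit hE (horb ▸ self_mem_orbit _)
    have hne' : orbit (conjBy (conjBy y a.toB4) b.toB4) ≠ orbit (conjBy y a.toB4) :=
      horb ▸ hne.symm
    have hzT := Set.mem_union_left (neighbours p r (conjBy y a.toB4))
      (hy.mem_neighbours ha hz hne)
    have hyT : orbit y ∈ neighbours p r y ∪ neighbours p r (conjBy y a.toB4) :=
      Set.mem_union_right _ (horb ▸ hz.mem_neighbours hbA hy' hne')
    refine ⟨neighbours p r y ∪ neighbours p r (conjBy y a.toB4), ?_, hyT, ?_⟩
    -- Each centre is among the neighbours of the other, so two sets of at most three suffice.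
    · refine (Set.encard_union_le _ _).trans ((add_le_add hy.encard_neighbours_le
        hz.encard_neighbours_le).trans (by norm_num))
    · rintro w c hw (hwN | hwN) hc hv
      · refine hy.orbit_conj_mem_of_neighbours hE hyT Set.subset_union_left ?_ hw hwN hc hv
        intro a' ha' hz' hzE' hne1 c' hc' hv'
        obtain rfl := hy.eq_of_edgeType hE ha ha' hz hz' hzE hzE' hne hne1
        exact hz.orbit_conj_mem hzT Set.subset_union_right hz rfl hc' hv'
      · refine hz.orbit_conj_mem_of_neighbours hzE hzT Set.subset_union_right ?_ hw hwN hc hv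
        intro a' ha' hz' hzE' hne1 c' hc' hv'
        obtain rfl := hz.eq_of_edgeType hzE hbA ha' hy' hz' hE' hzE' hne' hne1
        exact hy.orbit_conj_mem hyT Set.subset_union_left hy' horb hc' hv'
  · have hyT := Set.mem_insert (orbit y) (neighbours p r y)
    have hN := Set.subset_insert (orbit y) (neighbours p r y)
    refine ⟨insert (orbit y) (neighbours p r y), ?_, hyT, ?_⟩
    · refine (Set.encard_insert_le _ _).trans ((add_le_add_left hy.encard_neighbours_le 1).trans
        (by norm_num))
    · rintro w c hw (hwy | hwN) hc hv
      · exact hy.orbit_conj_mem hyT hN hw hwy hc hv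
      · exact hy.orbit_conj_mem_of_neighbours hE hyT hN
          -- Without an adjacent orbit of side words, all neighbours outside the orbit of `y`
          -- contain diagonals and lead nowhere new.
          (fun a ha hz hzE hne => absurd ⟨a, ha, hz, hzE, hne⟩ h) hw hwN hc hv

end Atomic

/-! ### Counting sliding circuits -/

theorem len_eq_of_isConj {x y : B4} (h : IsConj x y) : len x = len y := by
  obtain ⟨c, rfl⟩ := isConj_iff.1 h
  simp

theorem edge_eq_toB4 {s : B4} (hs : s ∈ edgeGenerators) :
    ∃ a : Simple, a.IsAtom ∧ IsEdge a ∧ s = a.toB4 := by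
  rcases hs with rfl | rfl | rfl | rfl
  · exact ⟨.a23, by decide, by decide, rfl⟩
  · exact ⟨.a34, by decide, by decide, rfl⟩
  · exact ⟨.a14, by decide, by decide, rfl⟩
  · exact ⟨.a12, by decide, by decide, rfl⟩

theorem len_eq_of_factors {y : B4} (h : ∀ s ∈ factors y, s ∈ edgeGenerators) :
    len y = 3 * infimum y + canonicalLength y := by
  have key : ∀ L : List B4, (∀ s ∈ L, s ∈ edgeGenerators) → len L.prod = L.length := by
    intro L
    induction L with
    | nil => simp
    | cons s L ih =>
      intro hL
      obtain ⟨a, ha, -, he⟩ := edge_eq_toB4 (hL s (by simp))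
      have ha' : a.rank = 1 := ha
      rw [List.prod_cons, len_mul, ih fun t ht => hL t (List.mem_cons_of_mem _ ht), he, len_toB4,
        ha', List.length_cons]
      push_cast
      ring
  have h1 := congrArg len (isNormalForm y).eq_prod
  rw [len_mul, len_zpow, len_δ, key _ h] at h1
  rw [h1, canonicalLength]
  ring

/-- The exponent sum of `y` is `3 * infimum y` plus its canonical length; it is shared by all of `SC
x`, where rigidity also fixes the infimum and supremum. -/
theorem atomic_of_mem_SC {x y : B4} (hx : IsRigid x) (hy : y ∈ SC x)
    (h : ∀ s ∈ factors y, s ∈ edgeGenerators) {z : B4} (hz : z ∈ SC x) :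
    Atomic (infimum x) (canonicalLength x) z := by
  have h1 := three_mul_infimum_lt hx.1
  have h2 := len_lt_three_mul_supremum hx.1
  have h3 := len_eq_of_isConj hy.1
  rw [h3] at h1 h2
  obtain ⟨h4, h5⟩ := (rig_of_mem_SC hx hy).infimum_eq_and_supremum_eq h1 h2
  have h6 := len_eq_of_factors h
  refine ⟨hx.1, rig_of_mem_SC hx hz, ?_⟩
  rw [← len_eq_of_isConj hz.1, h3, h6, h4]
  simp only [supremum] at h5
  omega

theorem edgeType_of_factors {p : ℤ} {r : ℕ} {y : B4} (hy : Atomic p r y)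
    (h : ∀ s ∈ factors y, s ∈ edgeGenerators) : EdgeType y := by
  refine hy.edgeType_of_forall_lt fun n hn => ?_
  obtain ⟨a, -, ha, he⟩ := edge_eq_toB4 (h _ (hy.acc_length.2 n hn))
  rw [hy.finalFactor_iterate] at he
  rwa [toB4_injective he]

theorem encard_image_orbit_le {x : B4} (hx : IsRigid x)
    (hy : ∃ y ∈ SC x, ∀ s ∈ factors y, s ∈ edgeGenerators) : (orbit '' SC x).encard ≤ 6 := by
  obtain ⟨y, hy, h⟩ := hy
  have hA := fun z hz => atomic_of_mem_SC hx hy h (z := z) hz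
  obtain ⟨T, hT6, hyT, hT⟩ := (hA y hy).exists_closed (edgeType_of_factors (hA y hy) h)
  refine (Set.encard_le_encard ?_).trans hT6
  rintro O ⟨z, hz, rfl⟩
  obtain ⟨v, hv, rfl⟩ := exists_one_le_conjBy (hz.1.symm.trans hy.1)
  exact (hA y hy).orbit_mem_of_closed hT hyT hv (hA _ hz)

theorem card_quotientGraph_le (x : B4) : ENat.card (quotientGraph x) ≤ (orbit '' SC x).encard := by
  let f : SCQuotient x → (orbit '' SC x) := fun O =>
    ⟨orbit O.rep, Set.mem_image_of_mem _ (Subtype.prop _)⟩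
  refine ENat.card_le_card_of_injective (f := f) fun O O' h => ?_
  have h1 : orbit O.rep = orbit O'.rep := congrArg Subtype.val h
  exact Quotient.out_equiv_out.1 h1

theorem encard_le_mul {α ι : Type*} {S : Set α} {T : Set ι} (f : ι → Set α) {m n : ℕ}
    (hS : S ⊆ ⋃ i ∈ T, f i) (hT : T.encard ≤ m) (hf : ∀ i ∈ T, (f i).encard ≤ n) :
    S.encard ≤ ((m * n : ℕ) : ℕ∞) := by
  have hfin : T.Finite := Set.finite_of_encard_le_coe hT
  rw [hfin.encard_eq_coe_toFinset_card, Nat.cast_le] at hT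
  calc S.encard ≤ (⋃ i ∈ hfin.toFinset, f i).encard := Set.encard_le_encard (by simpa using hS)
    _ ≤ ∑ i ∈ hfin.toFinset, (f i).encard := hfin.toFinset.set_encard_biUnion_le f
    _ ≤ hfin.toFinset.card • (n : ℕ∞) :=
      Finset.sum_le_card_nsmul _ _ _ fun i hi => hf i (hfin.mem_toFinset.1 hi)
    _ ≤ ((m * n : ℕ) : ℕ∞) := by
      rw [nsmul_eq_mul]
      exact_mod_cast Nat.mul_le_mul_right n hT

end BKL4

theorem proposition3p4 (x : BKL4.B4) (hx : BKL4.IsRigid x)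
    (hy : ∃ y ∈ BKL4.SC x, ∀ s ∈ BKL4.factors y, s ∈ BKL4.edgeGenerators) :
    ENat.card (BKL4.quotientGraph x) ≤ 6 ∧
      (BKL4.SC x).encard ≤ ((24 * BKL4.canonicalLength x : ℕ) : ℕ∞) := by
  have h6 := BKL4.encard_image_orbit_le hx hy
  refine ⟨(BKL4.card_quotientGraph_le x).trans h6, ?_⟩
  obtain ⟨y, hy, h⟩ := hy
  -- At most six orbits, each with at most four elements per unit of canonical length.
  rw [show 24 * BKL4.canonicalLength x = 6 * (4 * BKL4.canonicalLength x) by ring]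
  refine BKL4.encard_le_mul (T := BKL4.orbit '' BKL4.SC x) id ?_ h6 ?_
  · intro z hz
    exact Set.mem_biUnion (Set.mem_image_of_mem _ hz) (BKL4.self_mem_orbit z)
  · rintro O ⟨z, hz, rfl⟩
    exact (BKL4.atomic_of_mem_SC hx hy h hz).encard_orbit_le
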